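/- Let $V\in L^\infty(\mathbb R^2)$ be a compactly supported (possibly complex-valued) potential, and let $\rho\in C_0^\infty(\mathbb R^2)$ satisfy $\rho=1$ on $\operatorname{supp}V$. For $\operatorname{Im}\lambda>0$ let $R_V(\lambda)=(-\Delta-\lambda^2+V)^{-1}$ denote the bounded inverse on $L^2(\mathbb R^2)$ of $-\Delta-\lambda^2+V$ with domain $H^2(\mathbb R^2)$, whenever this inverse exists. Let $$S=\{\lambda\in\mathbb C:\ \lambda\neq 0,\ \arg\lambda\in[-\tfrac{\pi}{4},\tfrac{\pi}{4}]\cup[\tfrac{3\pi}{4},\tfrac{5\pi}{4}]\}.$$ Then $R_V(\lambda)$ exists for all $\lambda$ with $\operatorname{Im}\lambda$ sufficiently large, and the cutoff resolvent $\rho R_V(\lambda)\rho$, defined where $\operatorname{Im}\lambda>0$ and $R_V(\lambda)$ exists, continues to a meromorphic family of bounded operators $L^2(\mathbb R^2)\to L^2(\mathbb R^2)$ on $S$, again denoted $\rho R_V(\lambda)\rho$. (This means: near each $\lambda_0\in S$ the family is the sum of an analytic operator-valued function and a finite sum $\sum_{k=1}^{N}(\lambda-\lambda_0)^{-k}A_k$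 with $A_k$ of finite rank; removable singularities are removed.) Moreover, let $L>\operatorname{diam}(\operatorname{supp}\rho)=\sup\{|x-y|:x,y\in\operatorname{supp}\rho\}$ with $L>0$, and let $0<\delta<\frac1{4L}$. Then there are constants $C_0>0$ and $C>0$ such that, with $$\Omega_\delta=\{\lambda\in\mathbb C:\ \operatorname{Im}\lambda\ge-\delta\log(1+|\lambda|),\ |\lambda|\ge C_0\},$$ the family $\rho R_V(\lambda)\rho$ is analytic at every $\lambda\in S\cap\Omega_\delta$, and for all such $\lambda$ $$\|\rho R_V(\lambda)\rho\|_{L^2(\mathbb R^2)\to H^j(\mathbb R^2)}\le C|\lambda|^{-1/2}(1+|\lambda|^2)^{j/2}e^{L(\operatorname{Im}\lambda)_-},\qquad j=0,1,2,$$ where $t_-=\max\{-t,0\}$. Finally, $\rho R_V(\lambda)\rho$ has only finitely many poles in $$\{\lambda\in S:\ \operatorname{Im}\lambda\ge-\delta\log(1+|\lambda|),\ |\lambda|\le C_0\}.$$ -/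

import Mathlib

open MeasureTheory Topology Filter
open scoped ENNReal ContDiff Laplacian SchwartzMap FourierTransform

noncomputable section

namespace Scattering2D

/-- The Euclidean plane `ℝ²`. -/
abbrev Plane : Type := EuclideanSpace ℝ (Fin 2)

/-- The complex Hilbert space `L²(ℝ²)`. -/
abbrev L2 : Type := Lp ℂ 2 (volume : Measure Plane)

/-- The multiplication operator `u ↦ g u` on `L²(ℝ²)` by a function `g ∈ L^∞(ℝ²)`. -/
def mulL2 (g : Plane → ℂ) (hg : MemLp g ∞ (volume : Measure Plane)) : L2 →L[ℂ] L2 :=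
  (ContinuousLinearMap.mul ℂ ℂ).holderL volume ∞ 2 2 (hg.toLp g)

/-- `SolvesSchrodinger V hV l u f` : the function `u` lies in the Sobolev space `H²(ℝ²)` and
`(-Δ - l² + V) u = f`, where `Δ` is the distributional Laplacian. -/
def SolvesSchrodinger (V : Plane → ℂ) (hV : MemLp V ∞ (volume : Measure Plane)) (l : ℂ)
    (u f : L2) : Prop :=
  TemperedDistribution.MemSobolev 2 2 (u : 𝓢'(Plane, ℂ)) ∧
    -Δ (u : 𝓢'(Plane, ℂ)) - l ^ 2 • (u : 𝓢'(Plane, ℂ)) + (mulL2 V hV u : 𝓢'(Plane, ℂ))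
      = (f : 𝓢'(Plane, ℂ))

/-- `IsResolvent V hV l T` : the bounded operator `T` on `L²(ℝ²)` is the two-sided inverse
`(-Δ - l² + V)⁻¹` of the operator `-Δ - l² + V` with domain `H²(ℝ²)`. Such a `T` is unique. -/
def IsResolvent (V : Plane → ℂ) (hV : MemLp V ∞ (volume : Measure Plane)) (l : ℂ)
    (T : L2 →L[ℂ] L2) : Prop :=
  ∀ u f : L2, SolvesSchrodinger V hV l u f ↔ T f = u

/-- The norm `‖(1 + |D|²)^{s/2} u‖_{L²}` of the Sobolev space `H^s(ℝ²)`, with value `∞` when `u`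
is not in `H^s(ℝ²)`. The factor `2π` comes from the normalization of the Fourier transform,
`𝓕 u (ξ) = ∫ exp (-2πi x·ξ) u(x) dx`. -/
def sobolevENorm (s : ℝ) (u : L2) : ℝ≥0∞ :=
  eLpNorm (fun ξ : Plane ↦ (1 + (2 * Real.pi * ‖ξ‖) ^ 2) ^ (s / 2) • (𝓕 u : L2) ξ) 2 volume

/-- The symmetric double sector of all `l ≠ 0` with `arg l ∈ [-π/4, π/4] ∪ [3π/4, 5π/4]`. -/
def sector : Set ℂ := {l | l ≠ 0 ∧ |l.im| ≤ |l.re|}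

/-- The region `Im l ≥ -δ log (1 + |l|)`, `|l| ≥ C₀`. -/
def outerRegion (δ C₀ : ℝ) : Set ℂ := {l | -δ * Real.log (1 + ‖l‖) ≤ l.im ∧ C₀ ≤ ‖l‖}

/-- The region `Im l ≥ -δ log (1 + |l|)`, `|l| ≤ C₀`. -/
def innerRegion (δ C₀ : ℝ) : Set ℂ := {l | -δ * Real.log (1 + ‖l‖) ≤ l.im ∧ ‖l‖ ≤ C₀}

/-- `F` is a meromorphic family of bounded operators on (a neighbourhood of every point of) `U`:
near each point `l₀` of `U` it is the sum of an analytic operator-valued function and of a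
polynomial in `(l - l₀)⁻¹` without constant term whose coefficients are operators of finite
rank. -/
def IsMeromorphicFamilyOn (F : ℂ → L2 →L[ℂ] L2) (U : Set ℂ) : Prop :=
  ∀ l₀ ∈ U, ∃ (N : ℕ) (A : ℕ → L2 →L[ℂ] L2) (G : ℂ → L2 →L[ℂ] L2),
    (∀ k, FiniteDimensional ℂ (A k).range) ∧ AnalyticAt ℂ G l₀ ∧
      ∀ᶠ l in 𝓝[≠] l₀, F l = ∑ k ∈ Finset.range N, ((l - l₀) ^ (k + 1))⁻¹ • A k + G l

/-- `l₀` is a pole of `F`. -/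
def IsPole (F : ℂ → L2 →L[ℂ] L2) (l₀ : ℂ) : Prop :=
  meromorphicOrderAt F l₀ < 0

/-- `F` is the meromorphic continuation to the double sector of the cutoff resolvent
`ρ R_V(l) ρ`, `R_V(l) = (-Δ - l² + V)⁻¹`, from the upper half plane. -/
structure IsCutoffResolvent (V : Plane → ℂ) (hV : MemLp V ∞ (volume : Measure Plane))
    (ρ : Plane → ℂ) (hρ : MemLp ρ ∞ (volume : Measure Plane)) (F : ℂ → L2 →L[ℂ] L2) : Prop where
  /-- The resolvent exists, as a bounded operator on `L²`, when `Im l` is large. -/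
  exists_resolvent : ∃ A : ℝ, ∀ l : ℂ, A ≤ l.im → ∃ T, IsResolvent V hV l T
  /-- `F l = ρ R_V(l) ρ` wherever `Im l > 0` and the resolvent `R_V(l)` exists. -/
  eq_resolvent : ∀ l : ℂ, 0 < l.im → ∀ T, IsResolvent V hV l T →
    F l = mulL2 ρ hρ ∘L T ∘L mulL2 ρ hρ
  /-- `F` is meromorphic on the double sector. -/
  meromorphic : IsMeromorphicFamilyOn F sector
  /-- Removable singularities have been removed. -/
  analyticAt_of_not_isPole : ∀ l ∈ sector, ¬ IsPole F l → AnalyticAt ℂ F l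

/-- Test functions are bounded. -/
theorem memLp_top_of_testFunction {ρ : Plane → ℂ} (hρ : ContDiff ℝ ∞ ρ)
    (hρc : HasCompactSupport ρ) : MemLp ρ ∞ (volume : Measure Plane) :=
  hρ.continuous.memLp_of_hasCompactSupport hρc

end Scattering2D

end

/-! Put w = -iλ, so that Im λ > 0 becomes Re w > 0 and the free resolvent (-Δ + w²)⁻¹ is convolution
with K₀(w|x-y|)/(2π). Cut off by ρ on both sides it is a Hilbert-Schmidt operator K(λ), and the
integral formula for K₀ continues it analytically to an open cone of w that contains the image of
the double sector (`cutoff_freeRes`, `analyticOnNhd_KOp`). The bound |K₀(w)| ≤ C |w|^(-1/2) e^(-Re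
w) on that cone yields the factor |λ|^(-1/2) e^(L (Im λ)_-). A commutator identity for (1-Δ)χ
converts the L² bounds into H² bounds, and interpolation gives H¹ (`exists_sobolevENorm_KOp_le`).

Since Vρ = V, the resolvent identity gives ρ R_V ρ = K (1 + V K)⁻¹ wherever R_V exists
(`IsResolvent.cutoff`). The operators V K are norm limits of finite rank operators and depend
analytically on λ. A Neumann series makes R_V exist high in the upper half plane, so 1 + V K is
invertible somewhere, and the analytic Fredholm alternative makes the right-hand side meromorphic
with principal parts of finite rank (`exists_fredholm_local`, `eventually_isUnit_of_preconnected`,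
`exists_cutoffResAux_eq`).

For Im λ ≥ -δ log(1+|λ|) the inequality Lδ < 1/4 gives ‖V K‖ = O(|λ|^(-1/4)). Beyond a suitable
radius this is at most 1/2, so the inverse has norm at most 2, there are no poles, and the bounds on
K pass to ρ R_V ρ.

In a disc the poles could accumulate only at 0, which lies outside the domain of continuation. Near
0 one has K = log w · A(w) + B(w) with A, B analytic and A(0) of rank at most one
(`exists_KOp_eq_log`). Invertibility of 1 + V K then amounts to the nonvanishing of an analytic
function of (w, w log w), which near 0 vanishes either identically or nowhere
(`eventually_isUnit_or_eventually_not_log`). The first case is excluded by the Fredholm alternative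
on the positive imaginary λ-axis. -/

noncomputable section

namespace Scattering2D

/-! ### Finite rank operators, determinants, and reduction of invertibility to ℂⁿ -/

section Fredholm

variable {E : Type*} [NormedAddCommGroup E] [NormedSpace ℂ E]

/-- The norm limits of bounded operators of finite rank. -/
def finiteRankClosure (E : Type*) [NormedAddCommGroup E] [NormedSpace ℂ E] : Set (E →L[ℂ] E) :=
  closure {T | FiniteDimensional ℂ T.range}

theorem finiteDimensional_range_comp_left {F G : Type*} [NormedAddCommGroup F] [NormedSpace ℂ F]
    [NormedAddCommGroup G] [NormedSpace ℂ G] (A : F →L[ℂ] G) (P : E →L[ℂ] F)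
    (hP : FiniteDimensional ℂ P.range) : FiniteDimensional ℂ (A ∘L P).range := by
  have : (A ∘L P).range = P.range.map (A : F →ₗ[ℂ] G) := by
    ext x; simp
  rw [this]
  infer_instance

theorem finiteDimensional_range_comp_right {F G : Type*} [NormedAddCommGroup F] [NormedSpace ℂ F]
    [NormedAddCommGroup G] [NormedSpace ℂ G] (A : F →L[ℂ] G) (P : E →L[ℂ] F)
    (hA : FiniteDimensional ℂ A.range) : FiniteDimensional ℂ (A ∘L P).range := by
  have : (A ∘L P).range ≤ A.range := by
    rintro x ⟨y, rfl⟩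
    exact ⟨P y, rfl⟩
  exact Submodule.finiteDimensional_of_le this

theorem finiteDimensional_range_add {A B : E →L[ℂ] E} (hA : FiniteDimensional ℂ A.range)
    (hB : FiniteDimensional ℂ B.range) : FiniteDimensional ℂ (A + B).range := by
  have : (A + B).range ≤ A.range ⊔ B.range := by
    rintro x ⟨y, rfl⟩
    exact Submodule.add_mem_sup ⟨y, rfl⟩ ⟨y, rfl⟩
  exact Submodule.finiteDimensional_of_le this

theorem comp_mem_finiteRankClosure (A : E →L[ℂ] E) {T : E →L[ℂ] E}
    (hT : T ∈ finiteRankClosure E) : A ∘L T ∈ finiteRankClosure E := by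
  have hc : Continuous fun S : E →L[ℂ] E => A ∘L S := by fun_prop
  exact map_mem_closure hc hT fun S hS => finiteDimensional_range_comp_left A S hS

/-- Two operators of finite rank factor through a common finite dimensional space, with the same
second factor. -/
theorem exists_common_factor (P A : E →L[ℂ] E) (hP : FiniteDimensional ℂ P.range)
    (hA : FiniteDimensional ℂ A.range) :
    ∃ (n : ℕ) (X : (Fin n → ℂ) →L[ℂ] E) (Y₀ Y₁ : E →L[ℂ] (Fin n → ℂ)),
      P = X ∘L Y₀ ∧ A = X ∘L Y₁ := by
  let S : Submodule ℂ E := P.range ⊔ A.range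
  have : FiniteDimensional ℂ S := Submodule.finiteDimensional_sup _ _
  let e : S ≃L[ℂ] (Fin (Module.finrank ℂ S) → ℂ) :=
    ContinuousLinearEquiv.ofFinrankEq (by simp)
  refine ⟨Module.finrank ℂ S, S.subtypeL ∘L (e.symm : _ →L[ℂ] S),
    (e : S →L[ℂ] _) ∘L P.codRestrict S fun x => (le_sup_left : P.range ≤ S) ⟨x, rfl⟩,
    (e : S →L[ℂ] _) ∘L A.codRestrict S fun x => (le_sup_right : A.range ≤ S) ⟨x, rfl⟩, ?_, ?_⟩
  · ext x; simp
  · ext x; simp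

/-! ### Determinants on `ℂⁿ` -/

/-- The determinant of an operator on `ℂⁿ`. -/
def cdet {n : ℕ} (M : (Fin n → ℂ) →L[ℂ] (Fin n → ℂ)) : ℂ :=
  (LinearMap.toMatrix' (M : (Fin n → ℂ) →ₗ[ℂ] (Fin n → ℂ))).det

/-- The linear map sending a matrix to the operator on `ℂⁿ` it defines. -/
def ofMatrix (n : ℕ) : (Fin n → Fin n → ℂ) →L[ℂ] ((Fin n → ℂ) →L[ℂ] (Fin n → ℂ)) :=
  LinearMap.toContinuousLinearMap
    ((LinearMap.toContinuousLinearMap (𝕜 := ℂ) (E := Fin n → ℂ) (F' := Fin n → ℂ)).toLinearMap ∘ₗ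
      (Matrix.toLin' (R := ℂ) (n := Fin n) (m := Fin n)).toLinearMap)

/-- The adjugate of an operator on `ℂⁿ`. -/
def cadj {n : ℕ} (M : (Fin n → ℂ) →L[ℂ] (Fin n → ℂ)) : (Fin n → ℂ) →L[ℂ] (Fin n → ℂ) :=
  ofMatrix n (LinearMap.toMatrix' (M : (Fin n → ℂ) →ₗ[ℂ] (Fin n → ℂ))).adjugate

theorem toMatrix'_mulVec {n : ℕ} (M : (Fin n → ℂ) →L[ℂ] (Fin n → ℂ)) (v : Fin n → ℂ) :
    (LinearMap.toMatrix' (M : (Fin n → ℂ) →ₗ[ℂ] (Fin n → ℂ))).mulVec v = M v := by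
  rw [LinearMap.toMatrix'_mulVec]; rfl

theorem cadj_mul {n : ℕ} (M : (Fin n → ℂ) →L[ℂ] (Fin n → ℂ)) : cadj M * M = cdet M • 1 := by
  ext1 v
  change (Matrix.of _).mulVec (M v) = cdet M • v
  rw [← toMatrix'_mulVec M v]
  erw [Matrix.mulVec_mulVec, Matrix.adjugate_mul]
  simp [cdet, Matrix.smul_mulVec]

theorem mul_cadj {n : ℕ} (M : (Fin n → ℂ) →L[ℂ] (Fin n → ℂ)) : M * cadj M = cdet M • 1 := by
  ext1 v
  change M ((Matrix.of _).mulVec v) = cdet M • v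
  rw [← toMatrix'_mulVec M]
  erw [Matrix.mulVec_mulVec, Matrix.mul_adjugate]
  simp [cdet, Matrix.smul_mulVec]

theorem cdet_mul {n : ℕ} (M N : (Fin n → ℂ) →L[ℂ] (Fin n → ℂ)) :
    cdet (M * N) = cdet M * cdet N := by
  unfold cdet
  rw [← Matrix.det_mul, ← LinearMap.toMatrix'_comp]
  rfl

theorem cdet_one {n : ℕ} : cdet (1 : (Fin n → ℂ) →L[ℂ] (Fin n → ℂ)) = 1 := by
  unfold cdet
  have : ((1 : (Fin n → ℂ) →L[ℂ] (Fin n → ℂ)) : (Fin n → ℂ) →ₗ[ℂ] (Fin n → ℂ)) = LinearMap.id :=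
    rfl
  rw [this, LinearMap.toMatrix'_id, Matrix.det_one]

theorem cdet_smul {n : ℕ} (c : ℂ) (M : (Fin n → ℂ) →L[ℂ] (Fin n → ℂ)) :
    cdet (c • M) = c ^ n * cdet M := by
  unfold cdet
  rw [ContinuousLinearMap.toLinearMap_smul, map_smul, Matrix.det_smul, Fintype.card_fin]

theorem mul_inv_smul_cadj {n : ℕ} {M : (Fin n → ℂ) →L[ℂ] (Fin n → ℂ)} (h : cdet M ≠ 0) :
    M * ((cdet M)⁻¹ • cadj M) = 1 := by
  ext1 v
  have := DFunLike.congr_fun (mul_cadj M) v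
  simp only [mul_apply_eq_comp, smul_apply, map_smul, one_apply_eq_self] at this ⊢
  rw [this, smul_smul, inv_mul_cancel₀ h, one_smul]

theorem inv_smul_cadj_mul {n : ℕ} {M : (Fin n → ℂ) →L[ℂ] (Fin n → ℂ)} (h : cdet M ≠ 0) :
    ((cdet M)⁻¹ • cadj M) * M = 1 := by
  ext1 v
  have := DFunLike.congr_fun (cadj_mul M) v
  simp only [mul_apply_eq_comp, smul_apply, one_apply_eq_self] at this ⊢
  rw [this, smul_smul, inv_mul_cancel₀ h, one_smul]

theorem isUnit_iff_cdet_ne_zero {n : ℕ} (M : (Fin n → ℂ) →L[ℂ] (Fin n → ℂ)) :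
    IsUnit M ↔ cdet M ≠ 0 := by
  constructor
  · rintro ⟨u, rfl⟩ h
    have := cdet_mul (u : (Fin n → ℂ) →L[ℂ] (Fin n → ℂ)) ((u⁻¹ : Units _) : _)
    rw [Units.mul_inv, cdet_one, h, zero_mul] at this
    exact one_ne_zero this
  · intro h
    refine ⟨⟨M, (cdet M)⁻¹ • cadj M, ?_, ?_⟩, rfl⟩
    · exact mul_inv_smul_cadj h
    · exact inv_smul_cadj_mul h

section analytic

theorem analyticAt_clm_comp {Z E F G : Type*} [NormedAddCommGroup Z] [NormedSpace ℂ Z]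
    [NormedAddCommGroup E] [NormedSpace ℂ E] [NormedAddCommGroup F] [NormedSpace ℂ F]
    [NormedAddCommGroup G] [NormedSpace ℂ G] {A : Z → F →L[ℂ] G} {B : Z → E →L[ℂ] F} {z : Z}
    (hA : AnalyticAt ℂ A z) (hB : AnalyticAt ℂ B z) : AnalyticAt ℂ (fun z => A z ∘L B z) z :=
  ((ContinuousLinearMap.compL ℂ E F G).analyticAt_bilinear (A z, B z)).comp₂ hA hB

variable {Z : Type*} [NormedAddCommGroup Z] [NormedSpace ℂ Z] {n : ℕ}

theorem analyticAt_matrix_det {A : Z → Matrix (Fin n) (Fin n) ℂ} {z : Z}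
    (hA : ∀ i j, AnalyticAt ℂ (fun z => A z i j) z) : AnalyticAt ℂ (fun z => (A z).det) z := by
  simp_rw [Matrix.det_apply']
  refine Finset.analyticAt_fun_sum _ fun σ _ => analyticAt_const.mul ?_
  exact Finset.analyticAt_fun_prod _ fun i _ => hA _ _

theorem analyticAt_toMatrix'_entry {M : Z → (Fin n → ℂ) →L[ℂ] (Fin n → ℂ)} {z : Z}
    (hM : AnalyticAt ℂ M z) (i j : Fin n) :
    AnalyticAt ℂ (fun z => LinearMap.toMatrix' (M z : (Fin n → ℂ) →ₗ[ℂ] (Fin n → ℂ)) i j) z := by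
  simp_rw [LinearMap.toMatrix'_apply]
  exact ((ContinuousLinearMap.proj (R := ℂ) (φ := fun _ : Fin n => ℂ) i).comp
    (ContinuousLinearMap.apply ℂ (Fin n → ℂ) (Pi.single j (1 : ℂ)))).analyticAt _ |>.comp hM

theorem analyticAt_cdet {M : Z → (Fin n → ℂ) →L[ℂ] (Fin n → ℂ)} {z : Z}
    (hM : AnalyticAt ℂ M z) : AnalyticAt ℂ (fun z => cdet (M z)) z :=
  analyticAt_matrix_det fun i j => analyticAt_toMatrix'_entry hM i j

theorem analyticAt_cadj {M : Z → (Fin n → ℂ) →L[ℂ] (Fin n → ℂ)} {z : Z}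
    (hM : AnalyticAt ℂ M z) : AnalyticAt ℂ (fun z => cadj (M z)) z := by
  refine ((ofMatrix n).analyticAt _).comp (f := fun z => fun i j =>
    (LinearMap.toMatrix' (M z : (Fin n → ℂ) →ₗ[ℂ] (Fin n → ℂ))).adjugate i j) ?_
  refine AnalyticAt.pi fun i => AnalyticAt.pi fun j => ?_
  simp_rw [Matrix.adjugate_apply]
  refine analyticAt_matrix_det fun k l => ?_
  by_cases hk : k = j
  · subst hk
    simp only [Matrix.updateRow_self]
    exact analyticAt_const
  · simp only [Matrix.updateRow_ne hk]
    exact analyticAt_toMatrix'_entry hM k l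

end analytic

/-! ### Perturbation of the identity by a small operator and an operator of finite rank -/

/-- The push-through identity (1 + XY)⁻¹ = 1 - X (1 + YX)⁻¹ Y. With F = ℂⁿ it moves an invertibility
question from E to a matrix. -/
theorem isUnit_one_add_comp_comm {F : Type*} [NormedAddCommGroup F] [NormedSpace ℂ F]
    (X : F →L[ℂ] E) (Y : E →L[ℂ] F) {N : F →L[ℂ] F} (h₁ : (1 + Y ∘L X) * N = 1)
    (h₂ : N * (1 + Y ∘L X) = 1) :
    (1 + X ∘L Y) * (1 - X ∘L N ∘L Y) = 1 ∧ (1 - X ∘L N ∘L Y) * (1 + X ∘L Y) = 1 := by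
  have h₁' (v : F) : N v + Y (X (N v)) = v := by simpa using DFunLike.congr_fun h₁ v
  have h₂' (v : F) : N v + N (Y (X v)) = v := by simpa using DFunLike.congr_fun h₂ v
  constructor
  · ext v
    have h := congrArg X (h₁' (Y v))
    rw [map_add] at h
    simp only [mul_apply_eq_comp, add_apply, sub_apply, one_apply_eq_self,
      ContinuousLinearMap.comp_apply, map_sub]
    rw [← h]
    abel
  · ext v
    have h := congrArg X (h₂' (Y v))
    rw [map_add] at h
    simp only [mul_apply_eq_comp, add_apply, sub_apply, one_apply_eq_self,
      ContinuousLinearMap.comp_apply, map_add]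
    have h' : X (Y v) - X (N (Y (X (Y v)))) = X (N (Y v)) := by rw [sub_eq_iff_eq_add, h]
    rw [h', sub_add_cancel]

theorem isUnit_one_add_comp_iff {F : Type*} [NormedAddCommGroup F] [NormedSpace ℂ F]
    (X : F →L[ℂ] E) (Y : E →L[ℂ] F) : IsUnit (1 + X ∘L Y) ↔ IsUnit (1 + Y ∘L X) := by
  constructor
  · rintro ⟨u, hu⟩
    obtain ⟨h₁, h₂⟩ := isUnit_one_add_comp_comm Y X (N := ((u⁻¹ : Units _) : E →L[ℂ] E))
      (by rw [← hu]; simp) (by rw [← hu]; simp)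
    exact ⟨⟨_, _, h₁, h₂⟩, rfl⟩
  · rintro ⟨u, hu⟩
    obtain ⟨h₁, h₂⟩ := isUnit_one_add_comp_comm X Y (N := ((u⁻¹ : Units _) : F →L[ℂ] F))
      (by rw [← hu]; simp) (by rw [← hu]; simp)
    exact ⟨⟨_, _, h₁, h₂⟩, rfl⟩

theorem one_add_small_add_comp {n : ℕ} {S : E →L[ℂ] E} (hS : IsUnit (1 + S))
    (X : (Fin n → ℂ) →L[ℂ] E) (Y : E →L[ℂ] (Fin n → ℂ)) :
    1 + (S + X ∘L Y) = (1 + S) * (1 + (Ring.inverse (1 + S) ∘L X) ∘L Y) := by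
  have h : (1 + S) * Ring.inverse (1 + S) = 1 := Ring.mul_inverse_cancel _ hS
  have h' : (1 + S) * ((Ring.inverse (1 + S) ∘L X) ∘L Y) = X ∘L Y := by
    have : (1 + S) * ((Ring.inverse (1 + S) ∘L X) ∘L Y)
      = (((1 + S) * Ring.inverse (1 + S)) ∘L X) ∘L Y := rfl
    rw [this, h]; rfl
  rw [mul_add, h', mul_one, add_assoc]

/-- Factor out the invertible 1 + S and exchange the two factors of the remaining finite rank term.
What remains is an operator on ℂⁿ, tested by one scalar determinant. -/
theorem isUnit_one_add_small_add_comp_iff {n : ℕ} {S : E →L[ℂ] E} (hS : IsUnit (1 + S))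
    (X : (Fin n → ℂ) →L[ℂ] E) (Y : E →L[ℂ] (Fin n → ℂ)) :
    IsUnit (1 + (S + X ∘L Y)) ↔ cdet (1 + Y ∘L Ring.inverse (1 + S) ∘L X) ≠ 0 := by
  rw [one_add_small_add_comp hS, ← isUnit_iff_cdet_ne_zero, ← isUnit_one_add_comp_iff]
  obtain ⟨u, hu⟩ := hS
  rw [show (1 + S) * (1 + (Ring.inverse (1 + S) ∘L X) ∘L Y) =
    (u : E →L[ℂ] E) * (1 + (Ring.inverse (1 + S) ∘L X) ∘L Y) by rw [hu], Units.isUnit_units_mul]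

/-- Writing the inverse on ℂⁿ as adjugate over determinant isolates the only possible singularity, a
scalar factor multiplying an operator that factors through ℂⁿ. -/
theorem inverse_one_add_small_add_comp {n : ℕ} {S : E →L[ℂ] E} (hS : IsUnit (1 + S))
    (X : (Fin n → ℂ) →L[ℂ] E) (Y : E →L[ℂ] (Fin n → ℂ))
    (h : cdet (1 + Y ∘L Ring.inverse (1 + S) ∘L X) ≠ 0) :
    Ring.inverse (1 + (S + X ∘L Y)) = Ring.inverse (1 + S) -
      (cdet (1 + Y ∘L Ring.inverse (1 + S) ∘L X))⁻¹ • ((Ring.inverse (1 + S) ∘L X) ∘L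
        cadj (1 + Y ∘L Ring.inverse (1 + S) ∘L X) ∘L (Y ∘L Ring.inverse (1 + S))) := by
  set W := Ring.inverse (1 + S) with hW
  set D := 1 + Y ∘L W ∘L X with hD
  have e₁ : D * ((cdet D)⁻¹ • cadj D) = 1 := mul_inv_smul_cadj h
  have e₂ : ((cdet D)⁻¹ • cadj D) * D = 1 := inv_smul_cadj_mul h
  obtain ⟨h₁, h₂⟩ := isUnit_one_add_comp_comm (W ∘L X) Y e₁ e₂
  rw [one_add_small_add_comp hS, ← hW]
  have key : (1 - (W ∘L X) ∘L ((cdet D)⁻¹ • cadj D) ∘L Y) * W =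
      W - (cdet D)⁻¹ • ((W ∘L X) ∘L cadj D ∘L (Y ∘L W)) := by
    ext v
    simp
  rw [← key]
  obtain ⟨u, hu⟩ := hS
  have hu' : W = ((u⁻¹ : Units _) : E →L[ℂ] E) := by rw [hW, ← hu, Ring.inverse_unit]
  rw [hu', ← hu]
  rw [hu'] at h₁ h₂
  exact Ring.inverse_unit (u * ⟨_, _, h₁, h₂⟩)

section analytic

variable [CompleteSpace E]

theorem analyticAt_inverse_comp {Z R : Type*} [NormedAddCommGroup Z] [NormedSpace ℂ Z]
    [NormedRing R] [NormedAlgebra ℂ R] [CompleteSpace R] {M : Z → R} {z : Z}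
    (hM : AnalyticAt ℂ M z) (hu : IsUnit (M z)) : AnalyticAt ℂ (fun z => Ring.inverse (M z)) z := by
  obtain ⟨u, hu⟩ := hu
  exact (hu ▸ analyticAt_inverse u : AnalyticAt ℂ Ring.inverse (M z)).comp hM

theorem isUnit_one_add_of_norm_lt {S : E →L[ℂ] E} (h : ‖S‖ < 1) : IsUnit (1 + S) := by
  have := isUnit_one_sub_of_norm_lt_one (x := -S) (by rwa [norm_neg])
  rwa [sub_neg_eq_add] at this

end analytic

end Fredholm

/-! ### Analytic Fredholm theory, including the logarithmic case -/

section Fredholm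

variable {E : Type*} [NormedAddCommGroup E] [NormedSpace ℂ E]

theorem exists_eq_add_sub_smul {G : Type*} [NormedAddCommGroup G] [NormedSpace ℂ G]
    {f : ℂ → G} {z₀ : ℂ} (hf : AnalyticAt ℂ f z₀) :
    ∃ g : ℂ → G, AnalyticAt ℂ g z₀ ∧ ∀ z, f z = f z₀ + (z - z₀) • g z := by
  obtain ⟨p, hp⟩ := hf
  refine ⟨dslope f z₀, ⟨_, hp.has_fpower_series_dslope_fslope⟩, fun z => ?_⟩
  rw [sub_smul_dslope, add_sub_cancel]

/-- Near `z₀` the family `Q` has, for each `m`, a Taylor expansion of order `m` whose coefficients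
have finite rank. -/
def HasFiniteRankTaylor (Q : ℂ → E →L[ℂ] E) (z₀ : ℂ) (m : ℕ) : Prop :=
  ∃ (q : ℕ → E →L[ℂ] E) (R : ℂ → E →L[ℂ] E), (∀ k, FiniteDimensional ℂ (q k).range) ∧
    AnalyticAt ℂ R z₀ ∧ ∀ z, Q z = ∑ k ∈ Finset.range m, (z - z₀) ^ k • q k + (z - z₀) ^ m • R z

theorem HasFiniteRankTaylor.add {Q Q' : ℂ → E →L[ℂ] E} {z₀ : ℂ} {m : ℕ}
    (h : HasFiniteRankTaylor Q z₀ m) (h' : HasFiniteRankTaylor Q' z₀ m) :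
    HasFiniteRankTaylor (Q + Q') z₀ m := by
  obtain ⟨q, R, hq, hR, e⟩ := h
  obtain ⟨q', R', hq', hR', e'⟩ := h'
  refine ⟨q + q', R + R', fun k => finiteDimensional_range_add (hq k) (hq' k), hR.add hR',
    fun z => ?_⟩
  simp only [Pi.add_apply, e, e', smul_add, Finset.sum_add_distrib]
  abel

/-- With Φ = Φ(z₀) + (z-z₀)Φ' and likewise for Ψ, the product is Φ(z₀)Ψ(z₀) + (z-z₀)(Φ'Ψ + Φ(z₀)Ψ').
The constant term factors through ℂⁿ and both terms of the remainder have the original form, so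
induction on the order applies. -/
theorem hasFiniteRankTaylor_comp {n : ℕ} {z₀ : ℂ} (m : ℕ) {Φ : ℂ → (Fin n → ℂ) →L[ℂ] E}
    {Ψ : ℂ → E →L[ℂ] (Fin n → ℂ)} (hΦ : AnalyticAt ℂ Φ z₀) (hΨ : AnalyticAt ℂ Ψ z₀) :
    HasFiniteRankTaylor (fun z => Φ z ∘L Ψ z) z₀ m := by
  induction m generalizing Φ Ψ with
  | zero =>
    refine ⟨0, fun z => Φ z ∘L Ψ z, fun k => ?_, analyticAt_clm_comp hΦ hΨ, by simp⟩
    change FiniteDimensional ℂ (0 : E →L[ℂ] E).range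
    rw [show (0 : E →L[ℂ] E).range = ⊥ from LinearMap.range_zero]
    infer_instance
  | succ m ih =>
    obtain ⟨Φ', hΦ', eΦ⟩ := exists_eq_add_sub_smul hΦ
    obtain ⟨Ψ', hΨ', eΨ⟩ := exists_eq_add_sub_smul hΨ
    obtain ⟨q, R, hq, hR, e⟩ := (ih hΦ' hΨ).add (ih (analyticAt_const (v := Φ z₀)) hΨ')
    refine ⟨fun k => Nat.casesOn k (Φ z₀ ∘L Ψ z₀) q, R, fun k => ?_, hR, fun z => ?_⟩
    · cases k with
      | zero =>
        refine finiteDimensional_range_comp_right _ _ ?_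
        infer_instance
      | succ k => exact hq k
    · have e1 : Φ z ∘L Ψ z = Φ z₀ ∘L Ψ z₀ +
          (z - z₀) • (Φ' z ∘L Ψ z + Φ z₀ ∘L Ψ' z) := by
        conv_lhs => rw [eΦ z]
        rw [ContinuousLinearMap.add_comp, ContinuousLinearMap.smul_comp, smul_add]
        conv_lhs => enter [1]; rw [eΨ z]
        rw [ContinuousLinearMap.comp_add, ContinuousLinearMap.comp_smul]
        abel
      have e2 := e z
      simp only [Pi.add_apply] at e2
      change Φ z ∘L Ψ z = _
      rw [e1, e2, Finset.sum_range_succ', smul_add, Finset.smul_sum]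
      simp only [pow_succ', mul_smul, pow_zero, one_smul]
      rw [add_comm (Φ z₀ ∘L Ψ z₀), add_right_comm]
      rfl

/-- A quotient of a product of analytic families through `ℂⁿ` by an analytic function which does
not vanish identically has a Laurent expansion with a principal part of finite rank. -/
theorem exists_principal_part {n : ℕ} {z₀ : ℂ} {Φ : ℂ → (Fin n → ℂ) →L[ℂ] E}
    {Ψ : ℂ → E →L[ℂ] (Fin n → ℂ)} {d : ℂ → ℂ} (hΦ : AnalyticAt ℂ Φ z₀) (hΨ : AnalyticAt ℂ Ψ z₀)
    (hd : AnalyticAt ℂ d z₀) (hd0 : ∀ᶠ z in 𝓝[≠] z₀, d z ≠ 0) :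
    ∃ (N : ℕ) (A : ℕ → E →L[ℂ] E) (G : ℂ → E →L[ℂ] E),
      (∀ k, FiniteDimensional ℂ (A k).range) ∧ AnalyticAt ℂ G z₀ ∧
      ∀ᶠ z in 𝓝[≠] z₀, (d z)⁻¹ • (Φ z ∘L Ψ z) =
        ∑ k ∈ Finset.range N, ((z - z₀) ^ (k + 1))⁻¹ • A k + G z := by
  have h1 : ¬ ∀ᶠ z in 𝓝 z₀, d z = 0 := fun h => by
    obtain ⟨z, hz, hz'⟩ := (hd0.and (h.filter_mono nhdsWithin_le_nhds)).exists
    exact hz hz'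
  obtain ⟨m, g, hg, hg0, e⟩ := hd.exists_eventuallyEq_pow_smul_nonzero_iff.2 h1
  obtain ⟨q, R, hq, hR, eq⟩ := hasFiniteRankTaylor_comp m ((hg.inv hg0).smul hΦ) hΨ
  -- Division by (z-z₀)^m turns the Taylor coefficient of index m-1-k into the coefficient of
  -- (z-z₀)^(-(k+1)). Only k < m occurs, so the truncated subtraction is harmless.
  refine ⟨m, fun k => q (m - 1 - k), R, fun k => hq _, hR, ?_⟩
  filter_upwards [e.filter_mono nhdsWithin_le_nhds, self_mem_nhdsWithin] with z hz hne
  have hne' : z - z₀ ≠ 0 := sub_ne_zero.2 hne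
  have h2 : (d z)⁻¹ • (Φ z ∘L Ψ z) = ((z - z₀) ^ m)⁻¹ • ((((g⁻¹) • Φ) z) ∘L Ψ z) := by
    rw [hz, smul_eq_mul, mul_inv, mul_smul]
    rfl
  rw [h2]
  have h3 := eq z
  simp only at h3
  rw [h3, smul_add, smul_smul, inv_mul_cancel₀ (pow_ne_zero _ hne'), one_smul, Finset.smul_sum,
    ← Finset.sum_range_reflect]
  congr 1
  refine Finset.sum_congr rfl fun k hk => ?_
  rw [Finset.mem_range] at hk
  rw [smul_smul]
  congr 1
  have : m = (m - 1 - k) + (k + 1) := by omega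
  conv_lhs => rw [this, pow_add]
  have h4 : m - 1 - k + (k + 1) - 1 - k = m - 1 - k := by omega
  rw [h4]
  field_simp

variable [CompleteSpace E]

/-- Local form of a family `1 + T z`, `T z₀` a limit of operators of finite rank. -/
theorem exists_fredholm_local {T : ℂ → E →L[ℂ] E} {z₀ : ℂ} (hT : AnalyticAt ℂ T z₀)
    (hc : T z₀ ∈ finiteRankClosure E) :
    ∃ (n : ℕ) (d : ℂ → ℂ) (W : ℂ → E →L[ℂ] E) (Φ : ℂ → (Fin n → ℂ) →L[ℂ] E)
      (Ψ : ℂ → E →L[ℂ] (Fin n → ℂ)), AnalyticAt ℂ d z₀ ∧ AnalyticAt ℂ W z₀ ∧ AnalyticAt ℂ Φ z₀ ∧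
      AnalyticAt ℂ Ψ z₀ ∧ ∀ᶠ z in 𝓝 z₀, (IsUnit (1 + T z) ↔ d z ≠ 0) ∧
        (d z ≠ 0 → Ring.inverse (1 + T z) = W z - (d z)⁻¹ • (Φ z ∘L Ψ z)) := by
  -- A finite rank P at distance less than 1 from T z₀ leaves 1 + (T z - P) invertible by a Neumann
  -- series for z near z₀.
  obtain ⟨P, hP, hPT⟩ := Metric.mem_closure_iff.1 hc 1 one_pos
  obtain ⟨n, X, Y, -, hXY, -⟩ := exists_common_factor P P hP hP
  rw [dist_eq_norm] at hPT
  have hS : AnalyticAt ℂ (fun z => T z - P) z₀ := hT.sub analyticAt_const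
  have hW : AnalyticAt ℂ (fun z => Ring.inverse (1 + (T z - P))) z₀ :=
    analyticAt_inverse_comp (analyticAt_const.add hS) (isUnit_one_add_of_norm_lt hPT)
  have hD : AnalyticAt ℂ (fun z => 1 + Y ∘L Ring.inverse (1 + (T z - P)) ∘L X) z₀ :=
    analyticAt_const.add
      (analyticAt_clm_comp analyticAt_const (analyticAt_clm_comp hW analyticAt_const))
  refine ⟨n, fun z => cdet (1 + Y ∘L Ring.inverse (1 + (T z - P)) ∘L X),
    fun z => Ring.inverse (1 + (T z - P)), fun z => Ring.inverse (1 + (T z - P)) ∘L X,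
    fun z => cadj (1 + Y ∘L Ring.inverse (1 + (T z - P)) ∘L X) ∘L
      (Y ∘L Ring.inverse (1 + (T z - P))), analyticAt_cdet hD, hW, analyticAt_clm_comp hW analyticAt_const,
      analyticAt_clm_comp (analyticAt_cadj hD) (analyticAt_clm_comp analyticAt_const hW), ?_⟩
  have hlt : ∀ᶠ z in 𝓝 z₀, ‖T z - P‖ < 1 := hS.continuousAt.norm.eventually_lt_const hPT
  filter_upwards [hlt] with z hz
  have hu := isUnit_one_add_of_norm_lt hz
  have hT' : 1 + T z = 1 + ((T z - P) + X ∘L Y) := by rw [← hXY]; abel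
  rw [hT']
  exact ⟨isUnit_one_add_small_add_comp_iff hu X Y, inverse_one_add_small_add_comp hu X Y⟩

/-- Invertibility is the nonvanishing of an analytic scalar determinant, whose zeros are isolated
unless it vanishes identically near z₀. -/
theorem eventually_isUnit_or_eventually_not {T : ℂ → E →L[ℂ] E} {z₀ : ℂ} (hT : AnalyticAt ℂ T z₀)
    (hc : T z₀ ∈ finiteRankClosure E) :
    (∀ᶠ z in 𝓝 z₀, ¬ IsUnit (1 + T z)) ∨ ∀ᶠ z in 𝓝[≠] z₀, IsUnit (1 + T z) := by
  obtain ⟨n, d, W, Φ, Ψ, hd, -, -, -, h⟩ := exists_fredholm_local hT hc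
  rcases hd.eventually_eq_zero_or_eventually_ne_zero with h0 | h0
  · left
    filter_upwards [h, h0] with z hz hz0
    rw [hz.1, not_not]; exact hz0
  · right
    filter_upwards [h.filter_mono nhdsWithin_le_nhds, h0] with z hz hz0
    exact hz.1.2 hz0

theorem eventually_isUnit_of_isUnit {T : ℂ → E →L[ℂ] E} {z : ℂ} (hT : ContinuousAt T z)
    (h : IsUnit (1 + T z)) : ∀ᶠ x in 𝓝 z, IsUnit (1 + T x) :=
  (continuousAt_const.add hT).eventually_mem (Units.isOpen.mem_nhds h)

/-- **Analytic Fredholm alternative**: `1 + T z` is invertible outside a discrete set, if it is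
invertible somewhere. -/
theorem eventually_isUnit_of_preconnected {T : ℂ → E →L[ℂ] E} {U : Set ℂ} (hU : IsOpen U)
    (hU' : IsPreconnected U) (hT : AnalyticOnNhd ℂ T U) (hc : ∀ z ∈ U, T z ∈ finiteRankClosure E)
    {z₁ : ℂ} (hz₁ : z₁ ∈ U) (h₁ : IsUnit (1 + T z₁)) :
    ∀ z ∈ U, ∀ᶠ x in 𝓝[≠] z, IsUnit (1 + T x) := by
  -- The two local alternatives define disjoint open sets covering U. Connectedness leaves one of
  -- them, and z₁ decides which.
  set S₁ : Set ℂ := {z | z ∈ U ∧ ∀ᶠ x in 𝓝[≠] z, IsUnit (1 + T x)} with hS₁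
  set S₂ : Set ℂ := {z | z ∈ U ∧ ∀ᶠ x in 𝓝 z, ¬ IsUnit (1 + T x)} with hS₂
  have hunit : ∀ z ∈ U, IsUnit (1 + T z) → z ∈ S₁ := fun z hz hu =>
    ⟨hz, (eventually_isUnit_of_isUnit (hT z hz).continuousAt hu).filter_mono nhdsWithin_le_nhds⟩
  have o₁ : IsOpen S₁ := by
    rw [isOpen_iff_mem_nhds]
    rintro z ⟨hz, hz'⟩
    rw [eventually_nhdsWithin_iff] at hz'
    filter_upwards [hz', hU.mem_nhds hz] with x hx hxU
    by_cases hxz : x = z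
    · subst hxz
      exact ⟨hz, by rwa [eventually_nhdsWithin_iff]⟩
    · exact hunit x hxU (hx hxz)
  have o₂ : IsOpen S₂ := by
    rw [isOpen_iff_mem_nhds]
    rintro z ⟨hz, hz'⟩
    filter_upwards [hz'.eventually_nhds, hU.mem_nhds hz] with x hx hxU
    exact ⟨hxU, hx⟩
  have hcov : U ⊆ S₁ ∪ S₂ := fun z hz => by
    rcases eventually_isUnit_or_eventually_not (hT z hz) (hc z hz) with h | h
    · exact Or.inr ⟨hz, h⟩
    · exact Or.inl ⟨hz, h⟩
  have hdisj : U ∩ (S₁ ∩ S₂) = ∅ := by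
    ext z
    simp only [Set.mem_inter_iff, Set.mem_empty_iff_false, iff_false]
    rintro ⟨-, ⟨-, h⟩, ⟨-, h'⟩⟩
    obtain ⟨x, hx, hx'⟩ := (h.and (h'.filter_mono nhdsWithin_le_nhds)).exists
    exact hx' hx
  intro z hz
  rcases (isPreconnected_iff_subset_of_disjoint.1 hU') S₁ S₂ o₁ o₂ hcov hdisj with h | h
  · exact (h hz).2
  · exact absurd h₁ (h hz₁).2.self_of_nhds

/-! ### Logarithmic families near the origin -/

theorem tendsto_norm_log : Tendsto (fun w : ℂ => ‖Complex.log w‖) (𝓝[≠] 0) atTop := by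
  have h : Tendsto (fun w : ℂ => -Real.log ‖w‖) (𝓝[≠] 0) atTop :=
    tendsto_neg_atBot_atTop.comp (Real.tendsto_log_nhdsGT_zero.comp tendsto_norm_nhdsNE_zero)
  refine tendsto_atTop_mono (fun w => ?_) h
  calc -Real.log ‖w‖ ≤ |Real.log ‖w‖| := neg_le_abs _
    _ = |(Complex.log w).re| := by rw [Complex.log_re]
    _ ≤ _ := Complex.abs_re_le_norm _

theorem tendsto_mul_log_pow (p : ℕ) :
    Tendsto (fun w : ℂ => ‖w‖ * ‖Complex.log w‖ ^ p) (𝓝[≠] 0) (𝓝 0) := by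
  -- Since |log w| = O(|w|^(-t)), the p-th power costs at most |w|^(-tp), and this choice ensures tp
  -- ≤ 1/2.
  set t : ℝ := 1 / (2 * (p + 1)) with ht
  have ht0 : 0 < t := by positivity
  have hlim : Tendsto (fun w : ℂ => (1 / t + Real.pi) ^ p * ‖w‖ ^ (1 / 2 : ℝ)) (𝓝[≠] 0) (𝓝 0) := by
    have : Tendsto (fun w : ℂ => (1 / t + Real.pi) ^ p * ‖w‖ ^ (1 / 2 : ℝ)) (𝓝 0)
        (𝓝 ((1 / t + Real.pi) ^ p * ‖(0 : ℂ)‖ ^ (1 / 2 : ℝ))) :=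
      ((continuous_norm.rpow_const fun _ => Or.inr (by norm_num)).const_mul _).tendsto _
    rw [norm_zero, Real.zero_rpow (by norm_num), mul_zero] at this
    exact this.mono_left nhdsWithin_le_nhds
  refine squeeze_zero' (Eventually.of_forall fun w => by positivity) ?_ hlim
  have hsmall : ∀ᶠ w : ℂ in 𝓝[≠] 0, ‖w‖ < 1 :=
    (continuous_norm.tendsto' (0 : ℂ) 0 norm_zero).eventually_lt_const one_pos |>.filter_mono
      nhdsWithin_le_nhds
  filter_upwards [hsmall, self_mem_nhdsWithin] with w hw hw0
  have hx : 0 < ‖w‖ := norm_pos_iff.2 hw0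
  set x := ‖w‖
  have hxt : 1 ≤ x ^ (-t) := Real.one_le_rpow_of_pos_of_le_one_of_nonpos hx hw.le (by linarith)
  have h1 : |Real.log x| ≤ 1 / t * x ^ (-t) := by
    have := (Real.abs_log_mul_self_rpow_lt x t hx hw.le ht0).le
    rw [abs_mul, abs_of_pos (Real.rpow_pos_of_pos hx t)] at this
    rw [Real.rpow_neg hx.le, ← div_eq_mul_inv, le_div_iff₀ (Real.rpow_pos_of_pos hx t)]
    exact this
  have h2 : ‖Complex.log w‖ ≤ (1 / t + Real.pi) * x ^ (-t) := by
    calc ‖Complex.log w‖ ≤ |(Complex.log w).re| + |(Complex.log w).im| :=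
          Complex.norm_le_abs_re_add_abs_im _
      _ ≤ 1 / t * x ^ (-t) + Real.pi * x ^ (-t) := by
          rw [Complex.log_re, Complex.log_im]
          refine add_le_add h1 ((Complex.abs_arg_le_pi w).trans ?_)
          exact le_mul_of_one_le_right Real.pi_pos.le hxt
      _ = _ := by ring
  calc x * ‖Complex.log w‖ ^ p ≤ x * ((1 / t + Real.pi) * x ^ (-t)) ^ p := by gcongr
    _ = (1 / t + Real.pi) ^ p * (x ^ (1 : ℝ) * x ^ (-t * p)) := by
        rw [mul_pow, ← Real.rpow_mul_natCast hx.le, Real.rpow_one]; ring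
    _ = (1 / t + Real.pi) ^ p * x ^ (1 - t * p) := by
        rw [← Real.rpow_add hx]; ring_nf
    _ ≤ (1 / t + Real.pi) ^ p * x ^ (1 / 2 : ℝ) := by
        gcongr (1 / t + Real.pi) ^ p * ?_
        refine Real.rpow_le_rpow_of_exponent_ge hx hw.le ?_
        have : t * p ≤ 1 / 2 := by
          rw [ht, div_mul_eq_mul_div, div_le_div_iff₀ (by positivity) (by norm_num)]
          linarith
        linarith

/-- By homogeneity the k-th term of a power series at (w, w log w) is w^k times its value at (1, log
w). This identifies that value as a polynomial in log w. -/
theorem exists_polynomial_eval_eq {k : ℕ} (f : ContinuousMultilinearMap ℂ (fun _ : Fin k => ℂ × ℂ) ℂ) :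
    ∃ q : Polynomial ℂ, ∀ l : ℂ, f (fun _ => ((1 : ℂ), l)) = q.eval l := by
  refine ⟨∑ s : Finset (Fin k), Polynomial.C
    (f (s.piecewise (fun _ => ((1 : ℂ), (0 : ℂ))) fun _ => ((0 : ℂ), (1 : ℂ)))) *
      Polynomial.X ^ (sᶜ).card, fun l => ?_⟩
  have h1 : (fun _ : Fin k => ((1 : ℂ), l)) =
      (fun _ => ((1 : ℂ), (0 : ℂ))) + fun _ => l • ((0 : ℂ), (1 : ℂ)) := by
    ext <;> simp
  rw [h1, ContinuousMultilinearMap.map_add_univ, Polynomial.eval_finsetSum]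
  refine Finset.sum_congr rfl fun s _ => ?_
  rw [Polynomial.eval_mul, Polynomial.eval_C, Polynomial.eval_pow, Polynomial.eval_X]
  have h2 : s.piecewise (fun _ : Fin k => ((1 : ℂ), (0 : ℂ))) (fun _ => l • ((0 : ℂ), (1 : ℂ))) =
      fun i => (s.piecewise (fun _ => (1 : ℂ)) (fun _ => l)) i •
        (s.piecewise (fun _ : Fin k => ((1 : ℂ), (0 : ℂ))) fun _ => ((0 : ℂ), (1 : ℂ))) i := by
    ext i <;> by_cases hi : i ∈ s <;> simp [hi]
  rw [h2, ContinuousMultilinearMap.map_smul_univ, smul_eq_mul, mul_comm]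
  congr 1
  rw [Finset.prod_piecewise]
  simp [Finset.compl_eq_univ_sdiff]

theorem eventually_le_norm_eval {q : Polynomial ℂ} (hq : q ≠ 0) :
    ∃ c > 0, ∀ᶠ w : ℂ in 𝓝[≠] 0, c ≤ ‖q.eval (Complex.log w)‖ := by
  by_cases hd : 0 < q.degree
  · exact ⟨1, one_pos, (q.tendsto_norm_atTop hd tendsto_norm_log).eventually_ge_atTop 1⟩
  · rw [Polynomial.eq_C_of_degree_le_zero (not_lt.1 hd)] at hq ⊢
    refine ⟨‖q.coeff 0‖, norm_pos_iff.2 fun h => hq (by rw [h, map_zero]), ?_⟩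
    simp

/-- An analytic function of `(w, w log w)` vanishes identically near the origin, or not at all. -/
theorem eventually_eq_zero_or_ne_zero_log {H : ℂ × ℂ → ℂ} (hH : AnalyticAt ℂ H 0) :
    (∀ᶠ w in 𝓝[≠] (0 : ℂ), H (w, w * Complex.log w) = 0) ∨
      ∀ᶠ w in 𝓝[≠] (0 : ℂ), H (w, w * Complex.log w) ≠ 0 := by
  obtain ⟨p, hp⟩ := hH
  have hsmul (k : ℕ) (w l : ℂ) :
      p k (fun _ => (w, w * l)) = w ^ k * p k (fun _ => ((1 : ℂ), l)) := by
    have : (fun _ : Fin k => (w, w * l)) = fun _ => w • ((1 : ℂ), l) := by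
      ext <;> simp
    rw [this, ContinuousMultilinearMap.map_smul_univ]
    simp
  have hy : Tendsto (fun w : ℂ => (w, w * Complex.log w)) (𝓝[≠] 0) (𝓝 (0 : ℂ × ℂ)) := by
    rw [Prod.zero_eq_mk, nhds_prod_eq]
    refine Tendsto.prodMk (tendsto_id.mono_left nhdsWithin_le_nhds) ?_
    rw [tendsto_zero_iff_norm_tendsto_zero]
    simpa using tendsto_mul_log_pow 1
  -- Otherwise take the first k whose polynomial q is nonzero. The leading term w^k q(log w) is at
  -- least c|w|^k, while the remainder is O((|w||log w|)^(k+1)). The latter is smaller because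
  -- |w||log w|^(k+1) tends to 0.
  by_cases hall : ∀ k l, p k (fun _ => ((1 : ℂ), l)) = 0
  · left
    have hs := hy.eventually hp.eventually_hasSum
    filter_upwards [hs] with w hw
    simp only [hsmul, hall, mul_zero, zero_add] at hw
    exact hw.unique hasSum_zero
  · right
    push Not at hall
    classical
    set k := Nat.find hall with hk
    obtain ⟨l₀, hl₀⟩ := Nat.find_spec hall
    have hlt : ∀ j < k, ∀ l, p j (fun _ => ((1 : ℂ), l)) = 0 := fun j hj l => by
      by_contra h
      exact Nat.find_min hall hj ⟨l, h⟩
    obtain ⟨q, hq⟩ := exists_polynomial_eval_eq (p k)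
    have hq0 : q ≠ 0 := by
      rintro rfl
      exact hl₀ (by rw [hq]; simp)
    obtain ⟨c, hc, hcq⟩ := eventually_le_norm_eval hq0
    obtain ⟨C, hC⟩ := (hp.isBigO_sub_partialSum_pow (k + 1)).bound
    have hC' := hy.eventually hC
    have hsm : ∀ᶠ w : ℂ in 𝓝[≠] 0, |C| * (‖w‖ * ‖Complex.log w‖ ^ (k + 1)) < c := by
      have := (tendsto_mul_log_pow (k + 1)).const_mul |C|
      rw [mul_zero] at this
      exact this.eventually_lt_const hc
    filter_upwards [hcq, hC', hsm, tendsto_norm_log.eventually_ge_atTop 1, self_mem_nhdsWithin]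
      with w h1 h2 h3 h4 h5 h0
    have hw : 0 < ‖w‖ := norm_pos_iff.2 h5
    rw [zero_add, h0, FormalMultilinearSeries.partialSum, Finset.sum_range_succ,
      Finset.sum_eq_zero (fun j hj => by rw [hsmul, hlt j (Finset.mem_range.1 hj), mul_zero]),
      zero_add, hsmul, hq, zero_sub, norm_neg, norm_mul, norm_pow, norm_pow, norm_norm] at h2
    have h6 : ‖(w, w * Complex.log w)‖ = ‖w‖ * ‖Complex.log w‖ := by
      rw [Prod.norm_mk, norm_mul, max_eq_right]
      exact le_mul_of_one_le_right hw.le h4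
    rw [h6] at h2
    have h7 : ‖w‖ ^ k * c ≤ ‖w‖ ^ k * (|C| * (‖w‖ * ‖Complex.log w‖ ^ (k + 1))) := by
      calc ‖w‖ ^ k * c ≤ ‖w‖ ^ k * ‖q.eval (Complex.log w)‖ := by gcongr
        _ ≤ C * (‖w‖ * ‖Complex.log w‖) ^ (k + 1) := h2
        _ ≤ |C| * (‖w‖ * ‖Complex.log w‖) ^ (k + 1) := by gcongr; exact le_abs_self C
        _ = _ := by rw [mul_pow]; ring
    exact absurd (le_of_mul_le_mul_left h7 (by positivity)) (not_le.2 h3)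

/-- The family `1 + log w • A w + B w`, with `A`, `B` analytic at the origin, `A 0` of finite rank
and `B 0` a limit of operators of finite rank, is either never or always invertible near `0`. -/
theorem eventually_isUnit_or_eventually_not_log {A B : ℂ → E →L[ℂ] E} (hA : AnalyticAt ℂ A 0)
    (hB : AnalyticAt ℂ B 0) (hA0 : FiniteDimensional ℂ (A 0).range)
    (hB0 : B 0 ∈ finiteRankClosure E) :
    (∀ᶠ w in 𝓝[≠] (0 : ℂ), ¬ IsUnit (1 + (Complex.log w • A w + B w))) ∨
      ∀ᶠ w in 𝓝[≠] (0 : ℂ), IsUnit (1 + (Complex.log w • A w + B w)) := by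
  obtain ⟨P, hP, hPB⟩ := Metric.mem_closure_iff.1 hB0 1 one_pos
  rw [dist_eq_norm] at hPB
  -- The unbounded part log w · A 0 and the approximant P share the factor X, so both go into the
  -- finite rank term. With A = A 0 + w A₁, what is left is B - P + (w log w) A₁, which is analytic
  -- in (w, w log w) and small.
  obtain ⟨n, X, Y₀, Y₁, hXY₀, hXY₁⟩ := exists_common_factor P (A 0) hP hA0
  obtain ⟨A₁, hA₁, eA⟩ := exists_eq_add_sub_smul hA
  set S : ℂ × ℂ → E →L[ℂ] E := fun y => B y.1 - P + y.2 • A₁ y.1 with hS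
  have hfst : AnalyticAt ℂ (fun y : ℂ × ℂ => y.1) 0 := analyticAt_fst
  have hsnd : AnalyticAt ℂ (fun y : ℂ × ℂ => y.2) 0 := analyticAt_snd
  have hSa : AnalyticAt ℂ S 0 :=
    ((AnalyticAt.comp (g := B) (f := Prod.fst) hB hfst).sub analyticAt_const).add
      (hsnd.smul (AnalyticAt.comp (g := A₁) (f := Prod.fst) hA₁ hfst))
  have hS0 : ‖S 0‖ < 1 := by simpa [hS] using hPB
  have hW : AnalyticAt ℂ (fun y => Ring.inverse (1 + S y)) 0 :=
    analyticAt_inverse_comp (analyticAt_const.add hSa) (isUnit_one_add_of_norm_lt hS0)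
  -- This is the determinant multiplied by w^n. The scaling turns the coefficient log w of `Y₁` into
  -- w log w and does not affect vanishing for w ≠ 0.
  set H : ℂ × ℂ → ℂ := fun y => cdet (y.1 • (1 : (Fin n → ℂ) →L[ℂ] (Fin n → ℂ)) +
    (y.1 • Y₀ + y.2 • Y₁) ∘L Ring.inverse (1 + S y) ∘L X) with hH
  have hHa : AnalyticAt ℂ H 0 :=
    analyticAt_cdet ((hfst.smul analyticAt_const).add (analyticAt_clm_comp
      ((hfst.smul analyticAt_const).add (hsnd.smul analyticAt_const))
      (analyticAt_clm_comp hW analyticAt_const)))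
  have hy : Tendsto (fun w : ℂ => (w, w * Complex.log w)) (𝓝[≠] 0) (𝓝 (0 : ℂ × ℂ)) := by
    rw [Prod.zero_eq_mk, nhds_prod_eq]
    refine Tendsto.prodMk (tendsto_id.mono_left nhdsWithin_le_nhds) ?_
    rw [tendsto_zero_iff_norm_tendsto_zero]
    simpa using tendsto_mul_log_pow 1
  have hlt : ∀ᶠ w in 𝓝[≠] (0 : ℂ), ‖S (w, w * Complex.log w)‖ < 1 :=
    hy.eventually (hSa.continuousAt.norm.eventually_lt_const hS0)
  have key : ∀ᶠ w in 𝓝[≠] (0 : ℂ), (IsUnit (1 + (Complex.log w • A w + B w)) ↔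
      H (w, w * Complex.log w) ≠ 0) := by
    filter_upwards [hlt, self_mem_nhdsWithin] with w hw hw0
    have hw0 : w ≠ 0 := hw0
    set l := Complex.log w
    have e1 : l • A w + B w = S (w, w * l) + X ∘L (Y₀ + l • Y₁) := by
      rw [eA w, hS, ContinuousLinearMap.comp_add, ContinuousLinearMap.comp_smul, ← hXY₀, ← hXY₁,
        sub_zero, smul_add, smul_smul, mul_comm l w]
      simp only
      abel
    rw [e1, isUnit_one_add_small_add_comp_iff (isUnit_one_add_of_norm_lt hw)]
    have e2 : w • (1 : (Fin n → ℂ) →L[ℂ] (Fin n → ℂ)) +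
        (w • Y₀ + (w * l) • Y₁) ∘L Ring.inverse (1 + S (w, w * l)) ∘L X =
        w • (1 + (Y₀ + l • Y₁) ∘L Ring.inverse (1 + S (w, w * l)) ∘L X) := by
      rw [smul_add, ← ContinuousLinearMap.smul_comp, smul_add, smul_smul]
    rw [hH]
    simp only
    rw [e2, cdet_smul]
    simp [hw0]
  rcases eventually_eq_zero_or_ne_zero_log hHa with h | h
  · left
    filter_upwards [key, h] with w h1 h2
    rw [h1, not_not, h2]
  · right
    filter_upwards [key, h] with w h1 h2
    exact h1.2 h2

end Fredholm

/-! ### Hilbert-Schmidt operators with square integrable kernels -/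

section HilbertSchmidt

open scoped ComplexConjugate InnerProductSpace

variable {α : Type*} [MeasurableSpace α] {μ : Measure α}

theorem memLp_two_conj {f : α → ℂ} (hf : MemLp f 2 μ) : MemLp (fun x => conj (f x)) 2 μ :=
  hf.star

theorem memLp_two_mul_prod {f g : α → ℂ} (hf : MemLp f 2 μ) (hg : MemLp g 2 μ) :
    MemLp (fun p : α × α => f p.1 * g p.2) 2 (μ.prod μ) := by
  have hm : AEStronglyMeasurable (fun p : α × α => f p.1 * g p.2) (μ.prod μ) :=
    hf.1.comp_fst.mul hg.1.comp_snd
  rw [memLp_two_iff_integrable_sq_norm hm]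
  have := ((memLp_two_iff_integrable_sq_norm hf.1).1 hf).mul_prod
    ((memLp_two_iff_integrable_sq_norm hg.1).1 hg)
  simpa only [norm_mul, mul_pow] using this

/-- The tensor product `(x, y) ↦ g x * conj (f y)` of two `L²` functions. -/
def tensor (g f : Lp ℂ 2 μ) : Lp ℂ 2 (μ.prod μ) :=
  (memLp_two_mul_prod (Lp.memLp g) (memLp_two_conj (Lp.memLp f))).toLp _

theorem coeFn_tensor (g f : Lp ℂ 2 μ) :
    tensor g f =ᵐ[μ.prod μ] fun p => g p.1 * conj (f p.2) := MemLp.coeFn_toLp _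

theorem inner_tensor (g f : Lp ℂ 2 μ) (k : Lp ℂ 2 (μ.prod μ)) :
    ⟪tensor g f, k⟫_ℂ = ∫ p, conj (g p.1) * k p * f p.2 ∂(μ.prod μ) := by
  rw [L2.inner_def]
  refine integral_congr_ae ?_
  filter_upwards [coeFn_tensor g f] with p hp
  rw [hp, RCLike.inner_apply]
  simp only [map_mul, RingHomCompTriple.comp_apply, RingHom.id_apply]
  ring

theorem norm_tensor [SFinite μ] (g f : Lp ℂ 2 μ) : ‖tensor g f‖ = ‖g‖ * ‖f‖ := by
  have h : ‖tensor g f‖ ^ 2 = (‖g‖ * ‖f‖) ^ 2 := by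
    have e (β : Type _) [MeasurableSpace β] (ν : Measure β) (u : Lp ℂ 2 ν) :
        ‖u‖ ^ 2 = ∫ x, ‖u x‖ ^ 2 ∂ν := by
      rw [← inner_self_eq_norm_sq (𝕜 := ℂ) u, L2.inner_def]
      rw [← integral_re (L2.integrable_inner u u)]
      simp_rw [inner_self_eq_norm_sq]
    rw [e, mul_pow, e _ _ g, e _ _ f, ← integral_prod_mul]
    refine integral_congr_ae ?_
    filter_upwards [coeFn_tensor g f] with p hp
    rw [hp, norm_mul, RCLike.norm_conj, mul_pow]
  exact (sq_eq_sq₀ (norm_nonneg _) (by positivity)).1 h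

theorem tensor_add_left (g g' f : Lp ℂ 2 μ) : tensor (g + g') f = tensor g f + tensor g' f := by
  ext1
  filter_upwards [coeFn_tensor (g + g') f, coeFn_tensor g f, coeFn_tensor g' f,
    Lp.coeFn_add (tensor g f) (tensor g' f),
    Measure.quasiMeasurePreserving_fst.ae_eq_comp (Lp.coeFn_add g g')] with p h1 h2 h3 h4 h5
  simp only [Function.comp_apply] at h5
  rw [h1, h4, Pi.add_apply, h2, h3, h5, Pi.add_apply, add_mul]

theorem tensor_smul_left (c : ℂ) (g f : Lp ℂ 2 μ) : tensor (c • g) f = c • tensor g f := by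
  ext1
  filter_upwards [coeFn_tensor (c • g) f, coeFn_tensor g f, Lp.coeFn_smul c (tensor g f),
    Measure.quasiMeasurePreserving_fst.ae_eq_comp (Lp.coeFn_smul c g)] with p h1 h2 h3 h4
  simp only [Function.comp_apply] at h4
  rw [h1, h3, Pi.smul_apply, h2, h4, Pi.smul_apply, smul_eq_mul, smul_eq_mul, mul_assoc]

theorem tensor_add_right (g f f' : Lp ℂ 2 μ) : tensor g (f + f') = tensor g f + tensor g f' := by
  ext1
  filter_upwards [coeFn_tensor g (f + f'), coeFn_tensor g f, coeFn_tensor g f',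
    Lp.coeFn_add (tensor g f) (tensor g f'),
    Measure.quasiMeasurePreserving_snd.ae_eq_comp (Lp.coeFn_add f f')] with p h1 h2 h3 h4 h5
  simp only [Function.comp_apply] at h5
  rw [h1, h4, Pi.add_apply, h2, h3, h5, Pi.add_apply, map_add, mul_add]

theorem tensor_smul_right (c : ℂ) (g f : Lp ℂ 2 μ) :
    tensor g (c • f) = conj c • tensor g f := by
  ext1
  filter_upwards [coeFn_tensor g (c • f), coeFn_tensor g f, Lp.coeFn_smul (conj c) (tensor g f),
    Measure.quasiMeasurePreserving_snd.ae_eq_comp (Lp.coeFn_smul c f)] with p h1 h2 h3 h4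
  simp only [Function.comp_apply] at h4
  rw [h1, h3, Pi.smul_apply, h2, h4, Pi.smul_apply, smul_eq_mul, smul_eq_mul, map_mul]
  ring

variable [SigmaFinite μ]

/-- The functional `g ↦ ⟪k, g ⊗ conj f⟫`. -/
def kernelFunctional (k : Lp ℂ 2 (μ.prod μ)) (f : Lp ℂ 2 μ) : StrongDual ℂ (Lp ℂ 2 μ) :=
  LinearMap.mkContinuous
    { toFun := fun g => inner ℂ k (tensor g f)
      map_add' := fun g g' => by rw [tensor_add_left, inner_add_right]
      map_smul' := fun c g => by rw [tensor_smul_left, inner_smul_right]; rfl }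
    (‖k‖ * ‖f‖) fun g => by
      have := norm_inner_le_norm (𝕜 := ℂ) k (tensor g f)
      rw [norm_tensor] at this
      exact this.trans_eq (by ring)

/-- The Hilbert-Schmidt operator with a square integrable kernel. -/
def hilbertSchmidt : Lp ℂ 2 (μ.prod μ) →L[ℂ] (Lp ℂ 2 μ →L[ℂ] Lp ℂ 2 μ) :=
  LinearMap.mkContinuous₂
    (LinearMap.mk₂ ℂ
      -- The functional is conjugate linear in k and in f, and so is the inverse Riesz map, hence
      -- the composite is linear in both.
      (fun k f => (InnerProductSpace.toDual ℂ (Lp ℂ 2 μ)).symm (kernelFunctional k f))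
      (fun k k' f => by
        refine ext_inner_right ℂ fun g => ?_
        rw [inner_add_left]
        simp [kernelFunctional, inner_add_left])
      (fun c k f => by
        refine ext_inner_right ℂ fun g => ?_
        rw [inner_smul_left]
        simp [kernelFunctional, inner_smul_left])
      (fun k f f' => by
        refine ext_inner_right ℂ fun g => ?_
        rw [inner_add_left]
        simp [kernelFunctional, tensor_add_right, inner_add_right])
      (fun c k f => by
        refine ext_inner_right ℂ fun g => ?_
        rw [inner_smul_left]
        simp [kernelFunctional, tensor_smul_right, inner_smul_right]))
    1 fun k f => by
      rw [one_mul]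
      change ‖(InnerProductSpace.toDual ℂ (Lp ℂ 2 μ)).symm (kernelFunctional k f)‖ ≤ _
      rw [LinearIsometryEquiv.norm_map]
      exact LinearMap.mkContinuous_norm_le _ (by positivity) _

theorem inner_hilbertSchmidt (k : Lp ℂ 2 (μ.prod μ)) (f g : Lp ℂ 2 μ) :
    ⟪g, hilbertSchmidt k f⟫_ℂ = ⟪tensor g f, k⟫_ℂ := by
  have : ⟪hilbertSchmidt k f, g⟫_ℂ = ⟪k, tensor g f⟫_ℂ := by
    change ⟪(InnerProductSpace.toDual ℂ (Lp ℂ 2 μ)).symm (kernelFunctional k f), g⟫_ℂ = _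
    rw [InnerProductSpace.toDual_symm_apply]
    rfl
  rw [← inner_conj_symm, this, inner_conj_symm]

theorem inner_hilbertSchmidt_eq_integral (k : Lp ℂ 2 (μ.prod μ)) (f g : Lp ℂ 2 μ) :
    ⟪g, hilbertSchmidt k f⟫_ℂ = ∫ p, conj (g p.1) * k p * f p.2 ∂(μ.prod μ) := by
  rw [inner_hilbertSchmidt, inner_tensor]

theorem norm_hilbertSchmidt_le (k : Lp ℂ 2 (μ.prod μ)) : ‖hilbertSchmidt k‖ ≤ ‖k‖ := by
  have h : ‖(hilbertSchmidt : Lp ℂ 2 (μ.prod μ) →L[ℂ] _)‖ ≤ 1 :=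
    LinearMap.mkContinuous₂_norm_le _ zero_le_one _
  exact (hilbertSchmidt.le_of_opNorm_le h k).trans_eq (one_mul _)

theorem inner_tensor_tensor (g f h e : Lp ℂ 2 μ) :
    ⟪tensor g f, tensor h e⟫_ℂ = ⟪g, h⟫_ℂ * ⟪e, f⟫_ℂ := by
  rw [L2.inner_def, L2.inner_def, L2.inner_def, ← integral_prod_mul]
  refine integral_congr_ae ?_
  filter_upwards [coeFn_tensor g f, coeFn_tensor h e] with p h1 h2
  simp only [RCLike.inner_apply]
  rw [h1, h2]
  simp only [map_mul, Complex.conj_conj]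
  ring

theorem hilbertSchmidt_tensor (h e f : Lp ℂ 2 μ) :
    hilbertSchmidt (tensor h e) f = ⟪e, f⟫_ℂ • h := by
  refine ext_inner_left ℂ fun g => ?_
  rw [inner_hilbertSchmidt, inner_tensor_tensor, inner_smul_right, mul_comm]

theorem finiteDimensional_range_hilbertSchmidt_tensor (h e : Lp ℂ 2 μ) :
    FiniteDimensional ℂ (hilbertSchmidt (tensor h e)).range := by
  have : (hilbertSchmidt (tensor h e)).range ≤ Submodule.span ℂ {h} := by
    rintro x ⟨f, rfl⟩
    exact Submodule.mem_span_singleton.2 ⟨⟪e, f⟫_ℂ, (hilbertSchmidt_tensor h e f).symm⟩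
  exact Submodule.finiteDimensional_of_le this

/-- Hilbert-Schmidt operators are norm limits of operators of finite rank. -/
theorem hilbertSchmidt_mem_finiteRankClosure (k : Lp ℂ 2 (μ.prod μ)) :
    hilbertSchmidt k ∈ finiteRankClosure (Lp ℂ 2 μ) := by
  let S : Submodule ℂ (Lp ℂ 2 (μ.prod μ)) :=
    Submodule.span ℂ {t | ∃ g f : Lp ℂ 2 μ, t = tensor g f}
  let K := S.topologicalClosure
  have : CompleteSpace K := S.isClosed_topologicalClosure.completeSpace_coe
  have hfin : ∀ t ∈ S, FiniteDimensional ℂ (hilbertSchmidt t).range := by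
    intro t ht
    induction ht using Submodule.span_induction with
    | mem t ht =>
      obtain ⟨g, f, rfl⟩ := ht
      exact finiteDimensional_range_hilbertSchmidt_tensor g f
    | zero =>
      rw [map_zero, show (0 : Lp ℂ 2 μ →L[ℂ] Lp ℂ 2 μ).range = ⊥ from LinearMap.range_zero]
      infer_instance
    | add t t' _ _ h h' =>
      rw [map_add]; exact finiteDimensional_range_add h h'
    | smul c t _ h =>
      rw [map_smul]
      have : (c • hilbertSchmidt t).range ≤ (hilbertSchmidt t).range := by
        rintro x ⟨y, rfl⟩
        exact ⟨c • y, by simp⟩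
      exact Submodule.finiteDimensional_of_le this
  -- The operator sees k only through its pairings with tensors, so k may be projected onto their
  -- closed span. Density of the tensors in L² of the product is therefore not needed.
  have hk : hilbertSchmidt k = hilbertSchmidt (K.starProjection k) := by
    ext1 f
    refine ext_inner_left ℂ fun g => ?_
    rw [inner_hilbertSchmidt, inner_hilbertSchmidt, ← sub_eq_zero, ← inner_sub_right]
    refine (Submodule.mem_orthogonal _ _).1 (K.sub_starProjection_mem_orthogonal k) _ ?_
    exact S.le_topologicalClosure (Submodule.subset_span ⟨g, f, rfl⟩)
  rw [hk]
  have hmem : K.starProjection k ∈ closure (S : Set (Lp ℂ 2 (μ.prod μ))) :=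
    K.starProjection_apply_mem k
  exact map_mem_closure hilbertSchmidt.continuous hmem hfin

end HilbertSchmidt

/-! ### Holomorphic families with values in L² -/

section Analytic

variable {β : Type*} [MeasurableSpace β] {ν : Measure β}

/-- The Schwarz lemma is applied twice, to f and to its difference quotient, each time gaining a
factor 2/R. The constant is linear in M, so a pointwise majorant of a family passes to the Taylor
remainder. -/
theorem norm_sub_sub_smul_deriv_le {f : ℂ → ℂ} {c z : ℂ} {R M : ℝ}
    (hd : DifferentiableOn ℂ f (Metric.ball c R)) (hM : ∀ w ∈ Metric.ball c R, ‖f w‖ ≤ M)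
    (hz : z ∈ Metric.ball c R) :
    ‖f z - f c - (z - c) * deriv f c‖ ≤ 4 * M / R ^ 2 * ‖z - c‖ ^ 2 := by
  have hR : 0 < R := Metric.nonempty_ball.1 ⟨z, hz⟩
  have hc : c ∈ Metric.ball c R := Metric.mem_ball_self hR
  have hmaps : Set.MapsTo f (Metric.ball c R) (Metric.closedBall (f c) (2 * M)) := fun w hw => by
    rw [Metric.mem_closedBall, dist_eq_norm]
    linarith [norm_sub_le (f w) (f c), hM w hw, hM c hc]
  have hD := fun w (hw : w ∈ Metric.ball c R) => Complex.norm_dslope_le_div_of_mapsTo_ball hd hmaps hw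
  have hDd : DifferentiableOn ℂ (dslope f c) (Metric.ball c R) :=
    (Complex.differentiableOn_dslope (Metric.ball_mem_nhds c hR)).2 hd
  have hmaps' : Set.MapsTo (dslope f c) (Metric.ball c R)
      (Metric.closedBall (dslope f c c) (2 * (2 * M / R))) := fun w hw => by
    rw [Metric.mem_closedBall, dist_eq_norm]
    linarith [norm_sub_le (dslope f c w) (dslope f c c), hD w hw, hD c hc]
  have h2 := Complex.norm_dslope_le_div_of_mapsTo_ball hDd hmaps' hz
  have e : f z - f c - (z - c) * deriv f c = (z - c) ^ 2 * dslope (dslope f c) c z := by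
    have e1 := sub_smul_dslope f c z
    have e2 := sub_smul_dslope (dslope f c) c z
    rw [dslope_same] at e2
    rw [smul_eq_mul] at e1 e2
    rw [← e1, pow_two, mul_assoc, e2]
    ring
  rw [e, norm_mul, norm_pow, mul_comm]
  gcongr
  refine h2.trans_eq ?_
  field_simp
  ring

/-- A family of functions which is pointwise holomorphic and locally dominated by a square
integrable function is holomorphic with values in `L²`. -/
theorem analyticOnNhd_toLp {U : Set ℂ} (hU : IsOpen U) {k : ℂ → β → ℂ}
    (hm : ∀ w ∈ U, AEStronglyMeasurable (k w) ν) (hd : ∀ x, DifferentiableOn ℂ (fun w => k w x) U)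
    (hb : ∀ w₀ ∈ U, ∃ g : β → ℝ, MemLp g 2 ν ∧ ∀ᶠ w in 𝓝 w₀, ∀ x, ‖k w x‖ ≤ g x)
    {K : ℂ → Lp ℂ 2 ν} (hK : ∀ w ∈ U, K w =ᵐ[ν] k w) : AnalyticOnNhd ℂ K U := by
  refine DifferentiableOn.analyticOnNhd (fun w₀ hw₀ => ?_) hU
  obtain ⟨g, hg, hbd⟩ := hb w₀ hw₀
  obtain ⟨R, hR, hball⟩ := Metric.eventually_nhds_iff_ball.1 (hbd.and (hU.eventually_mem hw₀))
  have hd' (x : β) : DifferentiableOn ℂ (fun w => k w x) (Metric.ball w₀ R) :=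
    (hd x).mono fun w hw => (hball w hw).2
  have hest (x : β) (w : ℂ) (hw : w ∈ Metric.ball w₀ R) :=
    norm_sub_sub_smul_deriv_le (hd' x) (fun w hw => (hball w hw).1 x) hw
  have hder (x : β) : HasDerivAt (fun w => k w x) (deriv (fun w => k w x) w₀) w₀ :=
    ((hd x).differentiableAt (hU.mem_nhds hw₀)).hasDerivAt
  set d : β → ℂ := fun x => deriv (fun w => k w x) w₀ with hdd
  -- A sequence of increments tending to 0 exhibits the pointwise derivative d as a limit of
  -- measurable difference quotients.
  set u : ℕ → ℂ := fun n => (R / 2 * (1 / (n + 1 : ℝ)) : ℝ) with hu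
  have hu0 (n : ℕ) : 0 < R / 2 * (1 / (n + 1 : ℝ)) := by positivity
  have humem (n : ℕ) : w₀ + u n ∈ Metric.ball w₀ R := by
    rw [Metric.mem_ball, dist_eq_norm, add_sub_cancel_left, hu, Complex.norm_real,
      Real.norm_of_nonneg (hu0 n).le]
    have : 1 / (n + 1 : ℝ) ≤ 1 := by
      rw [div_le_one (by positivity)]; linarith [Nat.cast_nonneg (α := ℝ) n]
    nlinarith
  have hulim : Tendsto u atTop (𝓝[≠] 0) := by
    refine tendsto_nhdsWithin_iff.2 ⟨?_, Eventually.of_forall fun n => ?_⟩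
    · have := (tendsto_one_div_add_atTop_nhds_zero_nat (𝕜 := ℝ)).const_mul (R / 2)
      rw [mul_zero] at this
      exact (Complex.continuous_ofReal.tendsto' 0 0 Complex.ofReal_zero).comp this
    · exact Complex.ofReal_ne_zero.2 (hu0 n).ne'
  have hdm : AEStronglyMeasurable d ν := by
    refine aestronglyMeasurable_of_tendsto_ae atTop
      (f := fun n x => (u n)⁻¹ * (k (w₀ + u n) x - k w₀ x)) (fun n => ?_)
      (Eventually.of_forall fun x => ?_)
    · exact ((hm _ (hball _ (humem n)).2).sub (hm _ hw₀)).const_mul _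
    · have := (hasDerivAt_iff_tendsto_slope_zero.1 (hder x)).comp hulim
      simpa [Function.comp_def] using this
  have hdb (x : β) : ‖d x‖ ≤ 2 / R * g x := by
    have hc : w₀ ∈ Metric.ball w₀ R := Metric.mem_ball_self hR
    refine (Complex.norm_deriv_le_div_of_mapsTo_ball (R₂ := 2 * g x) (hd' x)
      (fun w hw => ?_) hR).trans_eq (by ring)
    rw [Metric.mem_closedBall, dist_eq_norm]
    linarith [norm_sub_le (k w x) (k w₀ x), (hball w hw).1 x, (hball w₀ hc).1 x]
  have hdL : MemLp d 2 ν := MemLp.of_le_mul hg hdm (c := 2 / R) (Eventually.of_forall fun x =>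
    (hdb x).trans (by gcongr; exact le_abs_self _))
  have hderiv : HasDerivAt K (hdL.toLp d) w₀ := by
    rw [hasDerivAt_iff_isLittleO]
    -- The pointwise remainder is at most 4 g(x)|w-w₀|²/R², and g is square integrable, so the same
    -- quadratic bound holds in the L² norm.
    have hO : (fun w => K w - K w₀ - (w - w₀) • hdL.toLp d) =O[𝓝 w₀] fun w => (w - w₀) ^ 2 := by
      refine Asymptotics.IsBigO.of_bound (4 / R ^ 2 * ‖hg.toLp g‖) ?_
      filter_upwards [Metric.ball_mem_nhds w₀ hR] with w hw
      have hle : ∀ᵐ x ∂ν, ‖(K w - K w₀ - (w - w₀) • hdL.toLp d) x‖ ≤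
          (4 / R ^ 2 * ‖w - w₀‖ ^ 2) * ‖hg.toLp g x‖ := by
        filter_upwards [hK w (hball w hw).2, hK w₀ hw₀, hdL.coeFn_toLp, hg.coeFn_toLp,
          Lp.coeFn_sub (K w - K w₀) ((w - w₀) • hdL.toLp d), Lp.coeFn_sub (K w) (K w₀),
          Lp.coeFn_smul (w - w₀) (hdL.toLp d)] with x h1 h2 h3 h4 h5 h6 h7
        rw [h5, Pi.sub_apply, h6, Pi.sub_apply, h7, Pi.smul_apply, h1, h2, h3, h4, smul_eq_mul]
        refine (hest x w hw).trans ?_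
        have : g x ≤ ‖g x‖ := le_abs_self _
        calc 4 * g x / R ^ 2 * ‖w - w₀‖ ^ 2 = (4 / R ^ 2 * ‖w - w₀‖ ^ 2) * g x := by ring
          _ ≤ _ := by gcongr
      refine (Lp.norm_le_mul_norm_of_ae_le_mul hle).trans_eq ?_
      rw [norm_pow]; ring
    refine hO.trans_isLittleO ?_
    have h1 : (fun w : ℂ => (w - w₀) ^ 2) =o[𝓝 w₀] fun w => w - w₀ := by
      have h2 : Tendsto (fun w : ℂ => w - w₀) (𝓝 w₀) (𝓝 0) := by
        have := (continuous_sub_right w₀).tendsto w₀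
        rwa [sub_self] at this
      simpa [Function.comp_def] using
        (Asymptotics.isLittleO_pow_id (𝕜 := ℂ) one_lt_two).comp_tendsto h2
    exact h1
  exact hderiv.differentiableAt.differentiableWithinAt

end Analytic

/-! ### The Bessel function K₀ on a cone: integral formula, bounds, differential equation -/

section Bessel

/-- An open cone around the right half plane. -/
def cone : Set ℂ := {w | -(4 / 5 * ‖w‖) < w.re}

theorem isOpen_cone : IsOpen cone :=
  isOpen_lt (by fun_prop) Complex.continuous_re

theorem ne_zero_of_mem_cone {w : ℂ} (hw : w ∈ cone) : w ≠ 0 := by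
  rintro rfl
  simp [cone] at hw

theorem norm_pos_of_mem_cone {w : ℂ} (hw : w ∈ cone) : 0 < ‖w‖ :=
  norm_pos_iff.2 (ne_zero_of_mem_cone hw)

theorem mem_cone_of_re_pos {w : ℂ} (hw : 0 < w.re) : w ∈ cone :=
  (neg_nonpos.2 (by positivity)).trans_lt hw

theorem mem_slitPlane_of_mem_cone {w : ℂ} (hw : w ∈ cone) : w ∈ Complex.slitPlane := by
  rw [Complex.mem_slitPlane_iff]
  by_contra! h
  have h1 : ‖w‖ = |w.re| := by
    rw [Complex.norm_def, Complex.normSq_apply, h.2, mul_zero, add_zero, Real.sqrt_mul_self_eq_abs]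
  have h2 : -(4 / 5 * ‖w‖) < w.re := hw
  rw [h1, abs_of_nonpos h.1] at h2
  linarith [h.1]

theorem add_ofReal_mem_cone {w : ℂ} (hw : w ∈ cone) {t : ℝ} (ht : 0 ≤ t) : w + t ∈ cone := by
  have h2 : -(4 / 5 * ‖w‖) < w.re := hw
  change -(4 / 5 * ‖w + t‖) < (w + t).re
  have h3 : ‖w‖ ≤ ‖w + t‖ + t := by
    have := norm_sub_le (w + t) (t : ℂ)
    rwa [add_sub_cancel_right, Complex.norm_of_nonneg ht] at this
  rw [Complex.add_re, Complex.ofReal_re]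
  linarith

theorem smul_mem_cone {w : ℂ} (hw : w ∈ cone) {r : ℝ} (hr : 0 < r) : w * r ∈ cone := by
  have h2 : -(4 / 5 * ‖w‖) < w.re := hw
  change -(4 / 5 * ‖w * r‖) < (w * r).re
  rw [norm_mul, Complex.norm_of_nonneg hr.le, Complex.re_mul_ofReal]
  nlinarith

/-- The cone is stable under positive dilations and under adding nonnegative reals. Star convexity
supplies the connectedness used for analytic continuation. -/
theorem starConvex_cone {x : ℝ} (hx : 0 < x) : StarConvex ℝ (x : ℂ) cone := by
  intro w hw a b ha hb hab
  rcases hb.eq_or_lt with rfl | hb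
  · rw [add_zero] at hab
    rw [hab, one_smul, zero_smul, add_zero]
    exact mem_cone_of_re_pos (by simpa using hx)
  · have := add_ofReal_mem_cone (smul_mem_cone hw hb) (t := a * x) (by positivity)
    convert this using 1
    simp only [Complex.real_smul]
    push_cast
    ring

/-- If Re w > -c|w|, then |2w+t|² ≥ 4(1-c²)|w|², which is at least |w|² for c ≤ √3/2. The double
sector needs c > 1/√2, and the constant 4/5 of `cone` lies between the two. -/
theorem norm_le_norm_two_mul_add {w : ℂ} (hw : w ∈ cone) {t : ℝ} (ht : 0 ≤ t) :
    ‖w‖ ≤ ‖2 * w + t‖ := by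
  have h2 : -(4 / 5 * ‖w‖) < w.re := hw
  refine le_of_sq_le_sq ?_ (norm_nonneg _)
  have e1 : ‖2 * w + t‖ ^ 2 = 4 * ‖w‖ ^ 2 + 4 * t * w.re + t ^ 2 := by
    rw [Complex.sq_norm, Complex.sq_norm, Complex.normSq_apply, Complex.normSq_apply]
    simp
    ring
  rw [e1]
  nlinarith [sq_nonneg (t - 8 / 5 * ‖w‖), norm_nonneg w, sq_nonneg ‖w‖]

theorem two_mul_add_mem_cone {w : ℂ} (hw : w ∈ cone) {t : ℝ} (ht : 0 ≤ t) :
    2 * w + t ∈ cone := by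
  have := add_ofReal_mem_cone (smul_mem_cone hw two_pos) ht
  rwa [Complex.ofReal_ofNat, mul_comm w 2] at this

theorem norm_cpow_neg_le {w : ℂ} (hw : w ∈ cone) {t s : ℝ} (ht : 0 ≤ t) (hs : 0 ≤ s) :
    ‖(2 * w + t) ^ (-(s : ℂ))‖ ≤ ‖w‖ ^ (-s) := by
  rw [← Complex.ofReal_neg, Complex.norm_cpow_real]
  exact Real.rpow_le_rpow_of_nonpos (norm_pos_of_mem_cone hw) (norm_le_norm_two_mul_add hw ht)
    (by linarith)

/-- The weight `e^{-t} t^{-1/2}`. -/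
def gammaWeight (t : ℝ) : ℝ := Real.exp (-t) * t ^ (1 / 2 - 1 : ℝ)

theorem integrableOn_gammaWeight : IntegrableOn gammaWeight (Set.Ioi 0) :=
  Real.GammaIntegral_convergent (by norm_num)

theorem gammaWeight_nonneg {t : ℝ} (ht : 0 ≤ t) : 0 ≤ gammaWeight t := by
  unfold gammaWeight; positivity

/-- The integral `∫₀^∞ e^{-t} t^{-1/2} (2 w + t)^{-s} dt`. -/
def besselInt (s : ℝ) (w : ℂ) : ℂ :=
  ∫ t in Set.Ioi (0 : ℝ), (gammaWeight t : ℂ) * (2 * w + t) ^ (-(s : ℂ))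

theorem continuousOn_besselIntegrand {w : ℂ} (hw : w ∈ cone) (s : ℝ) :
    ContinuousOn (fun t : ℝ => (gammaWeight t : ℂ) * (2 * w + t) ^ (-(s : ℂ))) (Set.Ioi 0) := by
  refine ContinuousOn.mul ?_ ?_
  · refine Complex.continuous_ofReal.comp_continuousOn (ContinuousOn.mul (by fun_prop) ?_)
    exact continuousOn_id.rpow_const fun t ht => Or.inl (ne_of_gt ht)
  · refine ContinuousOn.cpow_const (by fun_prop) fun t ht => ?_
    exact mem_slitPlane_of_mem_cone (two_mul_add_mem_cone hw (le_of_lt ht))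

theorem integrableOn_besselIntegrand {w : ℂ} (hw : w ∈ cone) {s : ℝ} (hs : 0 ≤ s) :
    IntegrableOn (fun t : ℝ => (gammaWeight t : ℂ) * (2 * w + t) ^ (-(s : ℂ))) (Set.Ioi 0) := by
  refine Integrable.mono' (integrableOn_gammaWeight.mul_const (‖w‖ ^ (-s)))
    ((continuousOn_besselIntegrand hw s).aestronglyMeasurable measurableSet_Ioi) ?_
  refine (ae_restrict_iff' measurableSet_Ioi).2 (Eventually.of_forall fun t ht => ?_)
  have ht : 0 ≤ t := le_of_lt ht
  rw [norm_mul, Complex.norm_of_nonneg (gammaWeight_nonneg ht)]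
  exact mul_le_mul_of_nonneg_left (norm_cpow_neg_le hw ht hs) (gammaWeight_nonneg ht)

theorem norm_besselInt_le {w : ℂ} (hw : w ∈ cone) {s : ℝ} (hs : 0 ≤ s) :
    ‖besselInt s w‖ ≤ Real.Gamma (1 / 2) * ‖w‖ ^ (-s) := by
  rw [Real.Gamma_eq_integral (by norm_num), ← integral_mul_const]
  refine norm_integral_le_of_norm_le (integrableOn_gammaWeight.mul_const (‖w‖ ^ (-s))) ?_
  refine (ae_restrict_iff' measurableSet_Ioi).2 (Eventually.of_forall fun t ht => ?_)
  have ht : 0 ≤ t := le_of_lt ht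
  rw [norm_mul, Complex.norm_of_nonneg (gammaWeight_nonneg ht)]
  exact mul_le_mul_of_nonneg_left (norm_cpow_neg_le hw ht hs) (gammaWeight_nonneg ht)

theorem hasDerivAt_besselInt {w : ℂ} (hw : w ∈ cone) {s : ℝ} (hs : 0 ≤ s) :
    HasDerivAt (besselInt s) (-(2 * s) * besselInt (s + 1) w) w := by
  set S : Set ℂ := {z | z ∈ cone ∧ ‖w‖ / 2 < ‖z‖} with hS
  -- Staying at distance more than |w|/2 from 0 makes the derivative of the integrand dominated
  -- uniformly near w.
  have hSn : S ∈ 𝓝 w := by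
    refine inter_mem (isOpen_cone.mem_nhds hw) ?_
    refine (isOpen_lt continuous_const continuous_norm).mem_nhds ?_
    change ‖w‖ / 2 < ‖w‖
    linarith [norm_pos_of_mem_cone hw]
  have key := hasDerivAt_integral_of_dominated_loc_of_deriv_le (𝕜 := ℂ)
    (μ := volume.restrict (Set.Ioi (0 : ℝ))) (x₀ := w) (s := S)
    (F := fun z t => (gammaWeight t : ℂ) * (2 * z + t) ^ (-(s : ℂ)))
    (F' := fun z t => -(2 * s) * ((gammaWeight t : ℂ) * (2 * z + t) ^ (-((s + 1 : ℝ) : ℂ))))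
    (bound := fun t => 2 * s * (gammaWeight t * (‖w‖ / 2) ^ (-(s + 1)))) hSn ?_
    (integrableOn_besselIntegrand hw hs) ?_ ?_ ?_ ?_
  · have := key.2
    rwa [integral_const_mul] at this
  · filter_upwards [isOpen_cone.mem_nhds hw] with z hz
    exact (continuousOn_besselIntegrand hz s).aestronglyMeasurable measurableSet_Ioi
  · exact ((continuousOn_besselIntegrand hw _).aestronglyMeasurable measurableSet_Ioi).const_mul _
  · refine (ae_restrict_iff' measurableSet_Ioi).2 (Eventually.of_forall fun t ht z hz => ?_)
    have ht : 0 ≤ t := le_of_lt ht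
    have h1 := norm_cpow_neg_le hz.1 ht (by linarith : 0 ≤ s + 1)
    have h2 : ‖z‖ ^ (-(s + 1)) ≤ (‖w‖ / 2) ^ (-(s + 1)) :=
      Real.rpow_le_rpow_of_nonpos (by linarith [norm_pos_of_mem_cone hw]) hz.2.le (by linarith)
    rw [norm_mul, norm_mul, Complex.norm_of_nonneg (gammaWeight_nonneg ht), norm_neg, norm_mul,
      Complex.norm_of_nonneg hs, Complex.norm_ofNat]
    have := gammaWeight_nonneg ht
    gcongr
    exact h1.trans h2
  · exact ((integrableOn_gammaWeight.mul_const _).const_mul _)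
  · refine (ae_restrict_iff' measurableSet_Ioi).2 (Eventually.of_forall fun t ht z hz => ?_)
    have hm := mem_slitPlane_of_mem_cone (two_mul_add_mem_cone hz.1 (le_of_lt ht))
    have h1 : HasDerivAt (fun z : ℂ => 2 * z + (t : ℂ)) 2 z := by
      simpa using ((hasDerivAt_id z).const_mul (2 : ℂ)).add_const (t : ℂ)
    have h2 := (h1.cpow_const (c := -(s : ℂ)) hm).const_mul (gammaWeight t : ℂ)
    refine h2.congr_deriv ?_
    push_cast
    rw [show -((s : ℂ) + 1) = -(s : ℂ) - 1 by ring]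
    ring

theorem tendsto_besselPrimitive {w : ℂ} (hw : w ∈ cone) :
    Tendsto (fun t : ℝ => ((Real.exp (-t) * t ^ (1 / 2 : ℝ) : ℝ) : ℂ) *
      (2 * w + t) ^ (-((3 / 2 : ℝ) : ℂ))) atTop (𝓝 0) := by
  have h1 := (tendsto_rpow_mul_exp_neg_mul_atTop_nhds_zero (1 / 2) 1 one_pos).const_mul
    (‖w‖ ^ (-(3 / 2) : ℝ))
  rw [mul_zero] at h1
  refine squeeze_zero_norm' ?_ h1
  filter_upwards [eventually_ge_atTop 0] with t ht
  rw [norm_mul, Complex.norm_of_nonneg (by positivity), mul_comm, neg_one_mul,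
    mul_comm (Real.exp (-t))]
  gcongr
  exact norm_cpow_neg_le hw ht (by norm_num)

/-- The differential equation `w g'' - 2 w g' + g' - g = 0` of `g w = e^w K₀ w`. -/
theorem besselInt_ode {w : ℂ} (hw : w ∈ cone) :
    3 * w * besselInt (5 / 2) w + (2 * w - 1) * besselInt (3 / 2) w - besselInt (1 / 2) w = 0 := by
  -- The required combination of integrands is exactly the t-derivative of this function, which
  -- vanishes at 0 and at infinity.
  set f : ℝ → ℂ := fun t => ((Real.exp (-t) * t ^ (1 / 2 : ℝ) : ℝ) : ℂ) *
      (2 * w + t) ^ (-((3 / 2 : ℝ) : ℂ)) with hf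
  set I : ℝ → ℝ → ℂ := fun s t => (gammaWeight t : ℂ) * (2 * w + t) ^ (-(s : ℂ)) with hI
  set f' : ℝ → ℂ := fun t => 3 * w * I (5 / 2) t + (2 * w - 1) * I (3 / 2) t - I (1 / 2) t
    with hf'
  have hint (s : ℝ) (hs : 0 ≤ s) : IntegrableOn (I s) (Set.Ioi 0) :=
    integrableOn_besselIntegrand hw hs
  have i5 := (hint (5 / 2) (by norm_num)).const_mul (3 * w)
  have i3 := (hint (3 / 2) (by norm_num)).const_mul (2 * w - 1)
  have i1 := hint (1 / 2) (by norm_num)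
  have hcont : ContinuousWithinAt f (Set.Ici 0) 0 := by
    refine ContinuousWithinAt.mul ?_ ?_
    · refine Continuous.continuousWithinAt ?_
      refine Complex.continuous_ofReal.comp (Continuous.mul (by fun_prop) ?_)
      exact continuous_id.rpow_const fun _ => Or.inr (by norm_num)
    · refine ContinuousAt.continuousWithinAt (ContinuousAt.comp (x := (0 : ℝ))
        (g := fun z : ℂ => (2 * w + z) ^ (-((3 / 2 : ℝ) : ℂ))) ?_ (by fun_prop))
      refine ContinuousAt.cpow (by fun_prop) continuousAt_const ?_
      exact mem_slitPlane_of_mem_cone (two_mul_add_mem_cone hw le_rfl)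
  have hder : ∀ t ∈ Set.Ioi (0 : ℝ), HasDerivAt f (f' t) t := by
    intro t ht
    have ht : 0 < t := ht
    set z : ℂ := 2 * w + t with hz
    have hz0 : z ∈ cone := two_mul_add_mem_cone hw ht.le
    have hm := mem_slitPlane_of_mem_cone hz0
    have hz' : z ≠ 0 := ne_zero_of_mem_cone hz0
    have h1 : HasDerivAt (fun z : ℂ => 2 * w + z) 1 (t : ℂ) :=
      (hasDerivAt_id _).const_add (2 * w)
    have h2 : HasDerivAt (fun z : ℝ => (2 * w + (z : ℂ)) ^ (-((3 / 2 : ℝ) : ℂ)))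
        ((-((3 / 2 : ℝ) : ℂ)) * z ^ (-((3 / 2 : ℝ) : ℂ) - 1) * 1) t :=
      (h1.cpow_const hm).comp_ofReal
    have h3 : HasDerivAt (fun t : ℝ => Real.exp (-t) * t ^ (1 / 2 : ℝ))
        (-Real.exp (-t) * t ^ (1 / 2 : ℝ) + Real.exp (-t) * (1 / 2 * t ^ (1 / 2 - 1 : ℝ))) t := by
      have e1 : HasDerivAt (fun t : ℝ => Real.exp (-t)) (-Real.exp (-t)) t := by
        simpa using (hasDerivAt_neg t).exp
      exact e1.mul (Real.hasDerivAt_rpow_const (Or.inl ht.ne'))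
    have h4 := h3.ofReal_comp.mul h2
    refine h4.congr_deriv ?_
    have et : t ^ (1 / 2 : ℝ) = t * t ^ (1 / 2 - 1 : ℝ) := by
      rw [Real.rpow_sub_one ht.ne']; field_simp
    have e3 : z ^ (-((3 / 2 : ℝ) : ℂ)) = z * z ^ (-((5 / 2 : ℝ) : ℂ)) := by
      rw [show -((3 / 2 : ℝ) : ℂ) = -((5 / 2 : ℝ) : ℂ) + 1 by push_cast; ring,
        Complex.cpow_add _ _ hz', Complex.cpow_one, mul_comm]
    have e1 : z ^ (-((1 / 2 : ℝ) : ℂ)) = z * z * z ^ (-((5 / 2 : ℝ) : ℂ)) := by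
      rw [mul_assoc, ← e3, show -((1 / 2 : ℝ) : ℂ) = -((3 / 2 : ℝ) : ℂ) + 1 by push_cast; ring,
        Complex.cpow_add _ _ hz', Complex.cpow_one, mul_comm]
    have e5 : z ^ (-((3 / 2 : ℝ) : ℂ) - 1) = z ^ (-((5 / 2 : ℝ) : ℂ)) := by
      congr 1; push_cast; ring
    simp only [hf', hI, gammaWeight]
    rw [← hz, e1, e3, e5, et, hz]
    push_cast
    ring
  have hres := integral_Ioi_of_hasDerivAt_of_tendsto hcont hder ((i5.add i3).sub i1)
    (tendsto_besselPrimitive hw)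
  have h0 : f 0 = 0 := by simp [hf]
  rw [h0, sub_zero] at hres
  rw [← hres]
  have e : (∫ t in Set.Ioi (0 : ℝ), f' t) = 3 * w * (∫ t in Set.Ioi (0 : ℝ), I (5 / 2) t) +
      (2 * w - 1) * (∫ t in Set.Ioi (0 : ℝ), I (3 / 2) t) -
      ∫ t in Set.Ioi (0 : ℝ), I (1 / 2) t := by
    rw [← integral_const_mul, ← integral_const_mul, ← integral_add i5 i3]
    exact integral_sub (i5.add i3) i1
  rw [e]
  rfl

/-- The modified Bessel function `K₀`. -/
def besselK (w : ℂ) : ℂ := Complex.exp (-w) * besselInt (1 / 2) w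

/-- Minus the derivative of `K₀`. -/
def besselK' (w : ℂ) : ℂ := Complex.exp (-w) * (besselInt (1 / 2) w + besselInt (3 / 2) w)

theorem hasDerivAt_besselK {w : ℂ} (hw : w ∈ cone) : HasDerivAt besselK (-besselK' w) w := by
  have h1 : HasDerivAt (fun w : ℂ => Complex.exp (-w)) (-Complex.exp (-w)) w := by
    simpa using (hasDerivAt_neg w).cexp
  have h2 := h1.mul (hasDerivAt_besselInt hw (s := 1 / 2) (by norm_num))
  rw [show (1 / 2 + 1 : ℝ) = 3 / 2 by norm_num] at h2
  refine h2.congr_deriv ?_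
  unfold besselK'
  push_cast
  ring

/-- Bessel's equation in divergence form, (w K₀')' = w K₀. This form makes the Wronskian with a
second solution constant. -/
theorem hasDerivAt_mul_besselK' {w : ℂ} (hw : w ∈ cone) :
    HasDerivAt (fun w => w * besselK' w) (-(w * besselK w)) w := by
  have h1 : HasDerivAt (fun w : ℂ => Complex.exp (-w)) (-Complex.exp (-w)) w := by
    simpa using (hasDerivAt_neg w).cexp
  have h2 := (hasDerivAt_besselInt hw (s := 1 / 2) (by norm_num)).add
    (hasDerivAt_besselInt hw (s := 3 / 2) (by norm_num))
  rw [show (1 / 2 + 1 : ℝ) = 3 / 2 by norm_num, show (3 / 2 + 1 : ℝ) = 5 / 2 by norm_num] at h2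
  have h3 := (hasDerivAt_id w).mul (h1.mul h2)
  refine h3.congr_deriv ?_
  have := besselInt_ode hw
  simp only [besselK, Pi.add_apply, id_eq, Pi.mul_apply]
  push_cast
  linear_combination (-Complex.exp (-w)) * this

theorem norm_besselK_le {w : ℂ} (hw : w ∈ cone) :
    ‖besselK w‖ ≤ Real.Gamma (1 / 2) * ‖w‖ ^ (-(1 / 2) : ℝ) * Real.exp (-w.re) := by
  rw [besselK, norm_mul, Complex.norm_exp, Complex.neg_re, mul_comm]
  gcongr
  exact norm_besselInt_le hw (by norm_num)

theorem differentiableOn_besselK : DifferentiableOn ℂ besselK cone := fun _ hw =>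
  (hasDerivAt_besselK hw).differentiableAt.differentiableWithinAt

end Bessel

/-! ### The regular solution I₀, the logarithm of K₀ at 0, and K₀ as a heat integral -/

section Bessel

/-- The integrals `∫₀^π cosⁿ θ e^{w cos θ} dθ`. -/
def besselI (n : ℕ) (w : ℂ) : ℂ :=
  ∫ θ in (0 : ℝ)..Real.pi, (Real.cos θ : ℂ) ^ n * Complex.exp (w * Real.cos θ)

theorem hasDerivAt_besselI (n : ℕ) (w : ℂ) : HasDerivAt (besselI n) (besselI (n + 1) w) w := by
  have hc (m : ℕ) (z : ℂ) :
      Continuous fun θ : ℝ => (Real.cos θ : ℂ) ^ m * Complex.exp (z * Real.cos θ) := by fun_prop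
  refine (intervalIntegral.hasDerivAt_integral_of_dominated_loc_of_deriv_le (𝕜 := ℂ)
    (μ := volume) (s := Metric.ball w 1)
    (F := fun z (θ : ℝ) => (Real.cos θ : ℂ) ^ n * Complex.exp (z * Real.cos θ))
    (F' := fun z (θ : ℝ) => (Real.cos θ : ℂ) ^ (n + 1) * Complex.exp (z * Real.cos θ))
    (bound := fun _ => Real.exp (‖w‖ + 1)) (Metric.ball_mem_nhds w one_pos)
    (Eventually.of_forall fun z => (hc n z).aestronglyMeasurable)
    ((hc n w).intervalIntegrable _ _) (hc (n + 1) w).aestronglyMeasurable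
    (Eventually.of_forall fun θ _ z hz => ?_) (by simp)
    (Eventually.of_forall fun θ _ z hz => ?_)).2
  · have hcos : ‖(Real.cos θ : ℂ)‖ ≤ 1 := by
      rw [Complex.norm_real]; exact Real.abs_cos_le_one θ
    have hz' : ‖z‖ ≤ ‖w‖ + 1 := by
      have := norm_sub_norm_le z w
      rw [Metric.mem_ball, dist_eq_norm] at hz
      linarith
    rw [norm_mul, norm_pow]
    refine (mul_le_of_le_one_left (norm_nonneg _) (pow_le_one₀ (norm_nonneg _) hcos)).trans ?_
    refine (Complex.norm_exp_le_exp_norm _).trans (Real.exp_le_exp.2 ?_)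
    rw [norm_mul]
    exact (mul_le_of_le_one_right (norm_nonneg _) hcos).trans hz'
  · have h1 : HasDerivAt (fun z : ℂ => z * (Real.cos θ : ℂ)) (Real.cos θ : ℂ) z := by
      simpa using (hasDerivAt_id z).mul_const (Real.cos θ : ℂ)
    refine (h1.cexp.const_mul ((Real.cos θ : ℂ) ^ n)).congr_deriv ?_
    ring

/-- Since `besselI n` is the n-th derivative of `besselI 0` = π I₀, this is again Bessel's equation.
It follows by integrating the θ-derivative of sin θ e^(w cos θ), whose boundary values vanish. -/
theorem besselI_ode (w : ℂ) : besselI 1 w + w * besselI 2 w = w * besselI 0 w := by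
  have hc (m : ℕ) : IntervalIntegrable
      (fun θ : ℝ => (Real.cos θ : ℂ) ^ m * Complex.exp (w * Real.cos θ)) volume 0 Real.pi := by
    refine Continuous.intervalIntegrable ?_ _ _
    fun_prop
  have hd : ∀ θ ∈ Set.uIcc (0 : ℝ) Real.pi, HasDerivAt
      (fun θ : ℝ => (Real.sin θ : ℂ) * Complex.exp (w * Real.cos θ))
      ((Real.cos θ : ℂ) ^ 1 * Complex.exp (w * Real.cos θ) +
        (w * ((Real.cos θ : ℂ) ^ 2 * Complex.exp (w * Real.cos θ)) -
        w * ((Real.cos θ : ℂ) ^ 0 * Complex.exp (w * Real.cos θ)))) θ := by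
    intro θ _
    have h1 := (Real.hasDerivAt_sin θ).ofReal_comp
    have h2 := ((Real.hasDerivAt_cos θ).ofReal_comp.const_mul w).cexp
    refine (h1.mul h2).congr_deriv ?_
    have : (Real.cos θ : ℂ) ^ 2 = 1 - (Real.sin θ : ℂ) ^ 2 := by
      rw [← Complex.ofReal_pow, Real.cos_sq']; push_cast; ring
    rw [this]
    push_cast
    ring
  have h := intervalIntegral.integral_eq_sub_of_hasDerivAt hd
    ((hc 1).add (((hc 2).const_mul w).sub ((hc 0).const_mul w)))
  rw [intervalIntegral.integral_add (hc 1) (((hc 2).const_mul w).sub ((hc 0).const_mul w)),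
    intervalIntegral.integral_sub ((hc 2).const_mul w) ((hc 0).const_mul w),
    intervalIntegral.integral_const_mul, intervalIntegral.integral_const_mul] at h
  simp only [Real.sin_pi, Real.sin_zero, Complex.ofReal_zero, zero_mul, sub_zero] at h
  have h' : besselI 1 w + (w * besselI 2 w - w * besselI 0 w) = 0 := h
  linear_combination h'

theorem differentiable_besselI (n : ℕ) : Differentiable ℂ (besselI n) := fun w =>
  (hasDerivAt_besselI n w).differentiableAt

theorem besselI_zero_zero : besselI 0 0 = Real.pi := by
  simp [besselI]

/-- The logarithmic singularity of `K₀` at the origin. -/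
theorem exists_besselK_eq_log : ∃ (ε : ℝ) (a b : ℂ → ℂ), 0 < ε ∧
    DifferentiableOn ℂ a (Metric.ball 0 ε) ∧ DifferentiableOn ℂ b (Metric.ball 0 ε) ∧
    ∀ w ∈ cone ∩ Metric.ball 0 ε, besselK w = Complex.log w * a w + b w := by
  have hI0 : besselI 0 0 ≠ 0 := by
    rw [besselI_zero_zero]; exact_mod_cast Real.pi_ne_zero
  obtain ⟨ε, hε, hball⟩ := Metric.eventually_nhds_iff_ball.1
    ((differentiable_besselI 0).continuous.continuousAt.eventually_ne hI0)
  have h0 : (0 : ℂ) ∈ Metric.ball (0 : ℂ) ε := Metric.mem_ball_self hε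
  -- This is w times the Wronskian of the two solutions, constant by the two differential equations.
  set Q : ℂ → ℂ := fun w => (w * besselK' w) * besselI 0 w + besselK w * (w * besselI 1 w) with hQ
  have hQd : ∀ w ∈ cone, HasDerivAt Q 0 w := by
    intro w hw
    have h1 : HasDerivAt (fun w => w * besselI 1 w) (w * besselI 0 w) w := by
      refine ((hasDerivAt_id w).mul (hasDerivAt_besselI 1 w)).congr_deriv ?_
      rw [← besselI_ode]; simp
    refine (((hasDerivAt_mul_besselK' hw).mul (hasDerivAt_besselI 0 w)).add
      ((hasDerivAt_besselK hw).mul h1)).congr_deriv ?_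
    rw [zero_add]
    ring
  have hpre : IsPreconnected (cone ∩ Metric.ball 0 ε) := by
    have hmem : ((ε / 2 : ℝ) : ℂ) ∈ Metric.ball (0 : ℂ) ε := by
      rw [Metric.mem_ball, dist_zero_right, Complex.norm_of_nonneg (by positivity)]
      linarith
    exact (StarConvex.isPathConnected
      ((starConvex_cone (by positivity)).inter ((convex_ball _ _).starConvex hmem))
      ⟨mem_cone_of_re_pos (by simpa using hε), hmem⟩).isConnected.isPreconnected
  have hopen : IsOpen (cone ∩ Metric.ball (0 : ℂ) ε) := isOpen_cone.inter Metric.isOpen_ball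
  have hconst {f : ℂ → ℂ} (hf : ∀ w ∈ cone ∩ Metric.ball 0 ε, HasDerivAt f 0 w) :
      ∃ c, ∀ w ∈ cone ∩ Metric.ball 0 ε, f w = c :=
    hopen.exists_is_const_of_deriv_eq_zero hpre
      (fun w hw => (hf w hw).differentiableAt.differentiableWithinAt) fun w hw => (hf w hw).deriv
  obtain ⟨c, hc⟩ := hconst fun w hw => hQd w hw.1
  -- Reduction of order: the quotient of K₀ by `besselI 0` has derivative -c h(w)/w. Splitting
  -- h(w)/w into h(0)/w and an analytic part with primitive P produces the logarithm.
  set h : ℂ → ℂ := fun w => (besselI 0 w ^ 2)⁻¹ with hh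
  have hhd : DifferentiableOn ℂ h (Metric.ball 0 ε) := fun w hw =>
    (((differentiable_besselI 0 w).pow 2).inv (pow_ne_zero 2 (hball w hw))).differentiableWithinAt
  have hh1 : DifferentiableOn ℂ (dslope h 0) (Metric.ball 0 ε) :=
    (Complex.differentiableOn_dslope (Metric.ball_mem_nhds 0 hε)).2 hhd
  obtain ⟨P, hP⟩ := hh1.isExactOn_ball
  have hD : ∀ w ∈ cone ∩ Metric.ball 0 ε, HasDerivAt
      (fun w => besselK w / besselI 0 w + (c * h 0) * Complex.log w + c * P w) 0 w := by
    intro w hw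
    have hw0 := ne_zero_of_mem_cone hw.1
    have hI := hball w hw.2
    refine ((((hasDerivAt_besselK hw.1).div (hasDerivAt_besselI 0 w) hI).add
      ((Complex.hasDerivAt_log (mem_slitPlane_of_mem_cone hw.1)).const_mul (c * h 0))).add
      ((hP w hw.2).const_mul c)).congr_deriv ?_
    have e1 := hc w hw
    have e2 := sub_smul_dslope h 0 w
    rw [sub_zero, smul_eq_mul] at e2
    have e3 : dslope h 0 w = (h w - h 0) / w := by rw [← e2]; field_simp
    rw [e3, zero_add, ← e1, hQ]
    simp only [hh]
    field_simp
    ring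
  obtain ⟨d, hd⟩ := hconst hD
  have hPd : DifferentiableOn ℂ P (Metric.ball 0 ε) := fun w hw =>
    (hP w hw).differentiableAt.differentiableWithinAt
  have hId : DifferentiableOn ℂ (besselI 0) (Metric.ball 0 ε) :=
    (differentiable_besselI 0).differentiableOn
  refine ⟨ε, fun w => -(c * h 0) * besselI 0 w, fun w => besselI 0 w * (d - c * P w), hε,
    hId.const_mul _, hId.mul ((hPd.const_mul c).const_sub d), fun w hw => ?_⟩
  have hI := hball w hw.2
  rw [← hd w hw]
  field_simp
  ring

theorem image_cosh_sub_one {x : ℝ} (hx : 0 < x) :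
    (fun u => x * (Real.cosh u - 1)) '' Set.Ioi 0 = Set.Ioi 0 := by
  ext t
  constructor
  · rintro ⟨u, hu, rfl⟩
    have : 1 < Real.cosh u := Real.one_lt_cosh.2 (ne_of_gt hu)
    exact mul_pos hx (by linarith)
  · intro ht
    have ht : 0 < t := ht
    -- Solves t = x(cosh u - 1) by means of cosh(2v) - 1 = 2 sinh² v.
    refine ⟨2 * Real.arsinh (Real.sqrt (t / (2 * x))), ?_, ?_⟩
    · have : 0 < Real.arsinh (Real.sqrt (t / (2 * x))) :=
        Real.arsinh_pos_iff.2 (Real.sqrt_pos.2 (by positivity))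
      exact mul_pos two_pos this
    · simp only
      rw [Real.cosh_two_mul, Real.cosh_sq, Real.sinh_arsinh, Real.sq_sqrt (by positivity)]
      field_simp
      ring

/-- Substitute t = x(cosh u - 1). Then t(2x+t) = (x sinh u)², so the algebraic factors cancel the
Jacobian x sinh u. -/
theorem integral_exp_neg_cosh {x : ℝ} (hx : 0 < x) :
    besselK x = ((∫ u in Set.Ioi (0 : ℝ), Real.exp (-(x * Real.cosh u)) : ℝ) : ℂ) := by
  have hreal : besselInt (1 / 2) x =
      ((∫ t in Set.Ioi (0 : ℝ), gammaWeight t * (2 * x + t) ^ (-(1 / 2) : ℝ) : ℝ) : ℂ) := by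
    rw [← integral_complex_ofReal]
    refine setIntegral_congr_fun measurableSet_Ioi fun t ht => ?_
    have ht : 0 < t := ht
    rw [Complex.ofReal_mul, Complex.ofReal_cpow (by positivity)]
    push_cast
    rfl
  have hsub := integral_image_eq_integral_abs_deriv_smul (s := Set.Ioi (0 : ℝ))
    (f := fun u => x * (Real.cosh u - 1)) (f' := fun u => x * Real.sinh u) measurableSet_Ioi
    (fun u _ => ((((Real.hasDerivAt_cosh u).sub_const 1).const_mul x).hasDerivWithinAt))
    (fun u hu v hv huv => by
      have h1 : Real.cosh u = Real.cosh v := by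
        have := mul_left_cancel₀ hx.ne' huv
        linarith
      exact Real.cosh_strictMonoOn.injOn (Set.Ioi_subset_Ici_self hu)
        (Set.Ioi_subset_Ici_self hv) h1)
    (fun t => gammaWeight t * (2 * x + t) ^ (-(1 / 2) : ℝ))
  rw [image_cosh_sub_one hx] at hsub
  rw [besselK, hreal, hsub, ← Complex.ofReal_neg, ← Complex.ofReal_exp, ← Complex.ofReal_mul,
    ← integral_const_mul]
  congr 1
  refine setIntegral_congr_fun measurableSet_Ioi fun u hu => ?_
  have hu : 0 < u := hu
  have hs : 0 < Real.sinh u := Real.sinh_pos_iff.2 hu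
  have hcosh : 1 < Real.cosh u := Real.one_lt_cosh.2 (ne_of_gt hu)
  have hp : 0 < x * (Real.cosh u - 1) := mul_pos hx (by linarith)
  simp only [smul_eq_mul, gammaWeight]
  rw [abs_of_pos (mul_pos hx hs), show (1 / 2 - 1 : ℝ) = -(1 / 2) by norm_num]
  have e1 : (x * (Real.cosh u - 1)) ^ (-(1 / 2) : ℝ) *
      (2 * x + x * (Real.cosh u - 1)) ^ (-(1 / 2) : ℝ) = (x * Real.sinh u)⁻¹ := by
    rw [← Real.mul_rpow hp.le (by linarith)]
    have : x * (Real.cosh u - 1) * (2 * x + x * (Real.cosh u - 1)) = (x * Real.sinh u) ^ 2 := by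
      have := Real.cosh_sq u
      linear_combination x ^ 2 * this
    rw [this, Real.rpow_neg (by positivity), ← Real.sqrt_eq_rpow, Real.sqrt_sq (by positivity)]
  calc Real.exp (-x) * (x * Real.sinh u * (Real.exp (-(x * (Real.cosh u - 1))) *
        (x * (Real.cosh u - 1)) ^ (-(1 / 2) : ℝ) * (2 * x + x * (Real.cosh u - 1)) ^ (-(1 / 2) : ℝ)))
      = (Real.exp (-x) * Real.exp (-(x * (Real.cosh u - 1)))) * (x * Real.sinh u *
        ((x * (Real.cosh u - 1)) ^ (-(1 / 2) : ℝ) *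
        (2 * x + x * (Real.cosh u - 1)) ^ (-(1 / 2) : ℝ))) := by ring
    _ = Real.exp (-(x * Real.cosh u)) := by
      rw [e1, mul_inv_cancel₀ (by positivity), mul_one, ← Real.exp_add]
      congr 1; ring

/-- `K₀` as an integral of heat kernels. -/
theorem integral_heat_eq_besselK {κ r : ℝ} (hκ : 0 < κ) (hr : 0 < r) :
    ((∫ t in Set.Ioi (0 : ℝ), t⁻¹ * Real.exp (-(κ ^ 2 * t) - r ^ 2 / (4 * t)) : ℝ) : ℂ) =
      2 * besselK (κ * r : ℝ) := by
  -- With t = c e^u the exponent κ²t + r²/(4t) becomes κ r cosh u and dt/t becomes du. The integral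
  -- then runs over all real u, whence the factor 2.
  set c : ℝ := r / (2 * κ) with hc
  have hc0 : 0 < c := by positivity
  have himg : (fun u => c * Real.exp u) '' Set.univ = Set.Ioi 0 := by
    ext t
    constructor
    · rintro ⟨u, -, rfl⟩
      exact mul_pos hc0 (Real.exp_pos u)
    · intro ht
      have ht : 0 < t := ht
      refine ⟨Real.log (t / c), trivial, ?_⟩
      simp only
      rw [Real.exp_log (by positivity)]
      field_simp
  have hsub := integral_image_eq_integral_abs_deriv_smul (s := Set.univ)
    (f := fun u => c * Real.exp u) (f' := fun u => c * Real.exp u) MeasurableSet.univ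
    (fun u _ => ((Real.hasDerivAt_exp u).const_mul c).hasDerivWithinAt)
    (fun u _ v _ huv => Real.exp_injective (mul_left_cancel₀ hc0.ne' huv))
    (fun t => t⁻¹ * Real.exp (-(κ ^ 2 * t) - r ^ 2 / (4 * t)))
  rw [himg, Measure.restrict_univ] at hsub
  rw [hsub, integral_exp_neg_cosh (by positivity)]
  have h2 := integral_comp_abs (f := fun u => Real.exp (-(κ * r * Real.cosh u)))
  rw [← Complex.ofReal_ofNat, ← Complex.ofReal_mul, ← h2]
  congr 2
  ext u
  have hpos : 0 < c * Real.exp u := by positivity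
  rw [smul_eq_mul, abs_of_pos hpos, ← mul_assoc, mul_inv_cancel₀ hpos.ne', one_mul, Real.cosh_abs,
    Real.cosh_eq, Real.exp_neg u]
  congr 1
  rw [hc]
  have := Real.exp_pos u
  field_simp
  ring

end Bessel

/-! ### Operators with weakly singular radial kernels -/

section Radial

open scoped ComplexConjugate InnerProductSpace

/-- The majorant `1 + r^{-1/2}` of radial kernels with a weak singularity at the diagonal. -/
def weakSing (r : ℝ) : ℝ := 1 + r ^ (-(1 / 2) : ℝ)

theorem weakSing_nonneg {r : ℝ} (hr : 0 ≤ r) : 0 ≤ weakSing r := by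
  unfold weakSing; positivity

theorem one_le_weakSing {r : ℝ} (hr : 0 ≤ r) : 1 ≤ weakSing r := by
  unfold weakSing
  have : 0 ≤ r ^ (-(1 / 2) : ℝ) := by positivity
  linarith

theorem rpow_le_weakSing (r : ℝ) : r ^ (-(1 / 2) : ℝ) ≤ weakSing r := by
  unfold weakSing; linarith

theorem measurable_weakSing : Measurable weakSing := by
  unfold weakSing; fun_prop

/-- The square is at most 2 + 2/|x|, and 1/|x| is locally integrable in dimension two. -/
theorem integrable_weakSing_sq (D : ℝ) :
    Integrable (fun x : Plane => (Metric.ball (0 : Plane) D).indicator (fun x => weakSing ‖x‖ ^ 2) x) := by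
  rw [integrable_indicator_iff measurableSet_ball]
  have h1 : IntegrableOn (fun x : Plane => ‖x‖ ^ (-1 : ℝ)) (Metric.ball 0 D) := by
    refine integrableOn_ball_of_norm_le_rpow (C := 1) (α := 1) (by simp) (by simp) ?_ ?_
    · exact Eventually.of_forall fun x => by
        rw [one_mul, Real.norm_of_nonneg (by positivity)]
    · exact (by fun_prop : Measurable fun x : Plane => ‖x‖ ^ (-1 : ℝ)).aestronglyMeasurable
  have h2 : IntegrableOn (fun _ : Plane => (2 : ℝ)) (Metric.ball 0 D) :=
    integrableOn_const (by exact measure_ball_lt_top.ne)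
  refine Integrable.mono' (h2.add (h1.const_mul 2)) ?_ (Eventually.of_forall fun x => ?_)
  · exact ((measurable_weakSing.comp measurable_norm).pow_const 2).aestronglyMeasurable
  · rw [Real.norm_of_nonneg (by positivity)]
    have e : ‖x‖ ^ (-1 : ℝ) = (‖x‖ ^ (-(1 / 2) : ℝ)) ^ 2 := by
      rw [← Real.rpow_mul_natCast (norm_nonneg x)]; norm_num
    simp only [Pi.add_apply]
    rw [e]
    unfold weakSing
    nlinarith [sq_nonneg (1 - ‖x‖ ^ (-(1 / 2) : ℝ))]

/-- The kernel `χ(x) φ(|x - y|) ρ(y)`. -/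
def radKernel (χ ρ : Plane → ℂ) (φ : ℝ → ℂ) (p : Plane × Plane) : ℂ :=
  χ p.1 * φ ‖p.1 - p.2‖ * ρ p.2

/-- The majorant of kernels with a weak singularity at the diagonal. -/
def radMajorant (χ ρ : Plane → ℂ) (p : Plane × Plane) : ℝ :=
  ‖χ p.1‖ * weakSing ‖p.1 - p.2‖ * ‖ρ p.2‖

theorem radMajorant_nonneg (χ ρ : Plane → ℂ) (p : Plane × Plane) : 0 ≤ radMajorant χ ρ p :=
  mul_nonneg (mul_nonneg (norm_nonneg _) (weakSing_nonneg (norm_nonneg _))) (norm_nonneg _)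

variable {χ ρ : Plane → ℂ}

theorem exists_norm_sub_lt (hχc : HasCompactSupport χ) (hρc : HasCompactSupport ρ) :
    ∃ D : ℝ, 0 < D ∧ ∀ x y, χ x ≠ 0 → ρ y ≠ 0 → ‖x - y‖ < D := by
  obtain ⟨R, hR⟩ := (hχc.isBounded.union hρc.isBounded).subset_ball 0
  refine ⟨max (2 * R) 1, by positivity, fun x y hx hy => ?_⟩
  have h1 := hR (Or.inl (subset_tsupport _ hx))
  have h2 := hR (Or.inr (subset_tsupport _ hy))
  rw [Metric.mem_ball, dist_zero_right] at h1 h2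
  exact (lt_of_le_of_lt (norm_sub_le x y) (by linarith)).trans_le (le_max_left _ _)

/-- The right-hand side has the form of a convolution integrand of two integrable functions, so its
integrability on the product space is immediate. -/
theorem radMajorant_sq_le {D M : ℝ} (hD : ∀ x y, χ x ≠ 0 → ρ y ≠ 0 → ‖x - y‖ < D)
    (hM : ∀ x, ‖χ x‖ ≤ M) (p : Plane × Plane) :
    radMajorant χ ρ p ^ 2 ≤ M ^ 2 * (‖ρ p.2‖ ^ 2 *
      (Metric.ball (0 : Plane) D).indicator (fun x => weakSing ‖x‖ ^ 2) (p.1 - p.2)) := by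
  have hi : 0 ≤ (Metric.ball (0 : Plane) D).indicator (fun x => weakSing ‖x‖ ^ 2) (p.1 - p.2) :=
    Set.indicator_nonneg (fun _ _ => sq_nonneg _) _
  rw [radMajorant]
  by_cases h1 : χ p.1 = 0
  · rw [h1, norm_zero, zero_mul, zero_mul, zero_pow two_ne_zero]
    positivity
  by_cases h2 : ρ p.2 = 0
  · rw [h2, norm_zero, mul_zero, zero_pow two_ne_zero, zero_mul, mul_zero]
  have hmem : p.1 - p.2 ∈ Metric.ball (0 : Plane) D := by
    rw [Metric.mem_ball, dist_zero_right]; exact hD _ _ h1 h2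
  rw [Set.indicator_of_mem hmem, mul_pow, mul_pow]
  have h3 : ‖χ p.1‖ ^ 2 ≤ M ^ 2 := pow_le_pow_left₀ (norm_nonneg _) (hM _) 2
  calc ‖χ p.1‖ ^ 2 * weakSing ‖p.1 - p.2‖ ^ 2 * ‖ρ p.2‖ ^ 2
      ≤ M ^ 2 * weakSing ‖p.1 - p.2‖ ^ 2 * ‖ρ p.2‖ ^ 2 := by gcongr
    _ = _ := by ring

theorem memLp_radMajorant (hχ : Continuous χ) (hχc : HasCompactSupport χ) (hρ : Continuous ρ)
    (hρc : HasCompactSupport ρ) :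
    MemLp (radMajorant χ ρ) 2 ((volume : Measure Plane).prod volume) := by
  obtain ⟨D, hD, hχρ⟩ := exists_norm_sub_lt hχc hρc
  obtain ⟨M, hM⟩ := hχ.bounded_above_of_compact_support hχc
  have hm : AEStronglyMeasurable (radMajorant χ ρ) ((volume : Measure Plane).prod volume) := by
    refine Measurable.aestronglyMeasurable ?_
    exact ((hχ.measurable.norm.comp measurable_fst).mul (measurable_weakSing.comp
      (measurable_fst.sub measurable_snd).norm)).mul (hρ.measurable.norm.comp measurable_snd)
  rw [memLp_two_iff_integrable_sq hm]
  have hρs : HasCompactSupport fun y => ‖ρ y‖ ^ 2 := by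
    refine hρc.mono fun y hy h => hy ?_
    simp [h]
  have hρi : Integrable (fun y => ‖ρ y‖ ^ 2) := (hρ.norm.pow 2).integrable_of_hasCompactSupport hρs
  have hconv := (hρi.convolution_integrand (ContinuousLinearMap.mul ℝ ℝ)
    (integrable_weakSing_sq D)).const_mul (M ^ 2)
  refine Integrable.mono' hconv (hm.pow 2) (Eventually.of_forall fun p => ?_)
  rw [Real.norm_of_nonneg (sq_nonneg _)]
  exact radMajorant_sq_le hχρ hM p

theorem norm_radKernel_le {D M : ℝ} (hD : ∀ x y, χ x ≠ 0 → ρ y ≠ 0 → ‖x - y‖ ≤ D) {φ : ℝ → ℂ}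
    (hφ : ∀ r, 0 ≤ r → r ≤ D → ‖φ r‖ ≤ M * weakSing r) (p : Plane × Plane) :
    ‖radKernel χ ρ φ p‖ ≤ M * radMajorant χ ρ p := by
  rw [radKernel, radMajorant, norm_mul, norm_mul]
  by_cases h1 : χ p.1 = 0
  · simp [h1]
  by_cases h2 : ρ p.2 = 0
  · simp [h2]
  have := hφ _ (norm_nonneg (p.1 - p.2)) (hD _ _ h1 h2)
  calc ‖χ p.1‖ * ‖φ ‖p.1 - p.2‖‖ * ‖ρ p.2‖
      ≤ ‖χ p.1‖ * (M * weakSing ‖p.1 - p.2‖) * ‖ρ p.2‖ := by gcongr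
    _ = _ := by ring

theorem measurable_radKernel (hχ : Continuous χ) (hρ : Continuous ρ) {φ : ℝ → ℂ}
    (hφ : Measurable φ) : Measurable (radKernel χ ρ φ) :=
  ((hχ.measurable.comp measurable_fst).mul (hφ.comp
    (measurable_fst.sub measurable_snd).norm)).mul (hρ.measurable.comp measurable_snd)

theorem memLp_radKernel (hχ : Continuous χ) (hχc : HasCompactSupport χ) (hρ : Continuous ρ)
    (hρc : HasCompactSupport ρ) {D M : ℝ} (hD : ∀ x y, χ x ≠ 0 → ρ y ≠ 0 → ‖x - y‖ ≤ D)
    {φ : ℝ → ℂ} (hφm : Measurable φ) (hφ : ∀ r, 0 ≤ r → r ≤ D → ‖φ r‖ ≤ M * weakSing r) :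
    MemLp (radKernel χ ρ φ) 2 ((volume : Measure Plane).prod volume) :=
  (memLp_radMajorant hχ hχc hρ hρc).of_le_mul
    (measurable_radKernel hχ hρ hφm).aestronglyMeasurable (c := M) (Eventually.of_forall fun p => by
      rw [Real.norm_of_nonneg (radMajorant_nonneg _ _ _)]
      exact norm_radKernel_le hD hφ p)

open scoped Classical in
/-- The operator with kernel `χ(x) φ(|x - y|) ρ(y)`. -/
def radOp (χ ρ : Plane → ℂ) (φ : ℝ → ℂ) : L2 →L[ℂ] L2 :=
  -- The default value 0 still satisfies the norm bound and the approximation by finite rank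
  -- operators, so those statements need no integrability hypothesis.
  if h : MemLp (radKernel χ ρ φ) 2 ((volume : Measure Plane).prod volume) then
    hilbertSchmidt (h.toLp _) else 0

theorem radOp_eq {φ : ℝ → ℂ}
    (h : MemLp (radKernel χ ρ φ) 2 ((volume : Measure Plane).prod volume)) :
    radOp χ ρ φ = hilbertSchmidt (h.toLp _) := dif_pos h

theorem inner_radOp {φ : ℝ → ℂ}
    (h : MemLp (radKernel χ ρ φ) 2 ((volume : Measure Plane).prod volume)) (f g : L2) :
    ⟪g, radOp χ ρ φ f⟫_ℂ = ∫ p, conj (g p.1) * radKernel χ ρ φ p * f p.2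
      ∂((volume : Measure Plane).prod volume) := by
  rw [radOp_eq h, inner_hilbertSchmidt_eq_integral]
  refine integral_congr_ae ?_
  filter_upwards [h.coeFn_toLp] with p hp
  rw [hp]

theorem radOp_mem_finiteRankClosure (φ : ℝ → ℂ) : radOp χ ρ φ ∈ finiteRankClosure L2 := by
  unfold radOp
  split_ifs with h
  · exact hilbertSchmidt_mem_finiteRankClosure _
  · rw [← map_zero (hilbertSchmidt (μ := (volume : Measure Plane)))]
    exact hilbertSchmidt_mem_finiteRankClosure _

theorem norm_radOp_le (hχ : Continuous χ) (hχc : HasCompactSupport χ) (hρ : Continuous ρ)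
    (hρc : HasCompactSupport ρ) {D M : ℝ} (hM : 0 ≤ M)
    (hD : ∀ x y, χ x ≠ 0 → ρ y ≠ 0 → ‖x - y‖ ≤ D)
    {φ : ℝ → ℂ} (hφ : ∀ r, 0 ≤ r → r ≤ D → ‖φ r‖ ≤ M * weakSing r) :
    ‖radOp χ ρ φ‖ ≤ M * ‖(memLp_radMajorant hχ hχc hρ hρc).toLp _‖ := by
  unfold radOp
  split_ifs with h
  · refine (norm_hilbertSchmidt_le _).trans (Lp.norm_le_mul_norm_of_ae_le_mul ?_)
    filter_upwards [h.coeFn_toLp, (memLp_radMajorant hχ hχc hρ hρc).coeFn_toLp] with p h1 h2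
    rw [h1, h2, Real.norm_of_nonneg (radMajorant_nonneg _ _ _)]
    exact norm_radKernel_le hD hφ p
  · rw [norm_zero]; positivity

/-- A holomorphic family of weakly singular radial kernels gives a holomorphic family of
operators. -/
theorem analyticOnNhd_radOp (hχ : Continuous χ) (hχc : HasCompactSupport χ) (hρ : Continuous ρ)
    (hρc : HasCompactSupport ρ) {D : ℝ} (hD : ∀ x y, χ x ≠ 0 → ρ y ≠ 0 → ‖x - y‖ ≤ D)
    {U : Set ℂ} (hU : IsOpen U) {φ : ℂ → ℝ → ℂ} (hφm : ∀ w ∈ U, Measurable (φ w))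
    (hφd : ∀ r, 0 ≤ r → r ≤ D → DifferentiableOn ℂ (fun w => φ w r) U)
    (hφ : ∀ w₀ ∈ U, ∃ M, ∀ᶠ w in 𝓝 w₀, ∀ r, 0 ≤ r → r ≤ D → ‖φ w r‖ ≤ M * weakSing r) :
    AnalyticOnNhd ℂ (fun w => radOp χ ρ (φ w)) U := by
  have hmem : ∀ w ∈ U, MemLp (radKernel χ ρ (φ w)) 2 ((volume : Measure Plane).prod volume) := by
    intro w hw
    obtain ⟨M, hM⟩ := hφ w hw
    exact memLp_radKernel hχ hχc hρ hρc hD (hφm w hw) hM.self_of_nhds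
  classical
  set K : ℂ → Lp ℂ 2 ((volume : Measure Plane).prod volume) := fun w =>
    if h : MemLp (radKernel χ ρ (φ w)) 2 ((volume : Measure Plane).prod volume) then h.toLp _ else 0
    with hK
  have hKa : AnalyticOnNhd ℂ K U := by
    refine analyticOnNhd_toLp hU (k := fun w => radKernel χ ρ (φ w))
      (fun w hw => (hmem w hw).1) (fun p => ?_) (fun w₀ hw₀ => ?_) fun w hw => ?_
    · unfold radKernel
      by_cases h1 : χ p.1 = 0
      · simp only [h1, zero_mul]; exact differentiableOn_const _
      by_cases h2 : ρ p.2 = 0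
      · simp only [h2, mul_zero]; exact differentiableOn_const _
      exact ((hφd _ (norm_nonneg _) (hD _ _ h1 h2)).const_mul _).mul_const _
    · obtain ⟨M, hM⟩ := hφ w₀ hw₀
      exact ⟨fun p => M * radMajorant χ ρ p, (memLp_radMajorant hχ hχc hρ hρc).const_mul M,
        hM.mono fun w hw p => norm_radKernel_le hD hw p⟩
    · simp only [hK]
      rw [dif_pos (hmem w hw)]
      exact (hmem w hw).coeFn_toLp
  have h := (ContinuousLinearMap.analyticOnNhd hilbertSchmidt Set.univ).comp hKa
    (fun _ _ => Set.mem_univ _)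
  refine h.congr hU fun w hw => ?_
  simp only [Function.comp_apply, hK]
  rw [dif_pos (hmem w hw), radOp_eq (hmem w hw)]

theorem radOp_smul_add {φ ψ : ℝ → ℂ} (c : ℂ)
    (hφ : MemLp (radKernel χ ρ φ) 2 ((volume : Measure Plane).prod volume))
    (hψ : MemLp (radKernel χ ρ ψ) 2 ((volume : Measure Plane).prod volume)) :
    radOp χ ρ (fun r => c * φ r + ψ r) = c • radOp χ ρ φ + radOp χ ρ ψ := by
  have e : radKernel χ ρ (fun r => c * φ r + ψ r) =
      c • radKernel χ ρ φ + radKernel χ ρ ψ := by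
    ext p
    simp only [radKernel, Pi.add_apply, Pi.smul_apply, smul_eq_mul]
    ring
  have h : MemLp (radKernel χ ρ (fun r => c * φ r + ψ r)) 2
      ((volume : Measure Plane).prod volume) := by
    rw [e]; exact (hφ.const_smul c).add hψ
  rw [radOp_eq h, radOp_eq hφ, radOp_eq hψ, ← map_smul, ← map_add]
  congr 1
  rw [← MemLp.toLp_const_smul, ← MemLp.toLp_add]
  exact MemLp.toLp_congr _ _ (Eventually.of_forall fun p => congrFun e p)

/-- For a constant profile the kernel is a product of a function of x and a function of y, so the
rank is at most one. -/
theorem finiteDimensional_range_radOp_const (hχ : Continuous χ) (hχc : HasCompactSupport χ)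
    (hρ : Continuous ρ) (hρc : HasCompactSupport ρ) (c : ℂ) :
    FiniteDimensional ℂ (radOp χ ρ fun _ => c).range := by
  by_cases h : MemLp (radKernel χ ρ fun _ => c) 2 ((volume : Measure Plane).prod volume)
  · have hχ2 : MemLp (fun x => χ x * c) 2 (volume : Measure Plane) :=
      (hχ.mul continuous_const).memLp_of_hasCompactSupport hχc.mul_right
    have hρ2 : MemLp (fun x => conj (ρ x)) 2 (volume : Measure Plane) :=
      memLp_two_conj (hρ.memLp_of_hasCompactSupport hρc)
    have e : h.toLp _ = tensor (hχ2.toLp _) (hρ2.toLp _) := by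
      ext1
      filter_upwards [h.coeFn_toLp, coeFn_tensor (hχ2.toLp _) (hρ2.toLp _),
        Measure.quasiMeasurePreserving_fst.ae_eq_comp hχ2.coeFn_toLp,
        Measure.quasiMeasurePreserving_snd.ae_eq_comp hρ2.coeFn_toLp] with p h1 h2 h3 h4
      simp only [Function.comp_apply] at h3 h4
      rw [h1, h2, h3, h4, Complex.conj_conj, radKernel]
    rw [radOp_eq h, e]
    exact finiteDimensional_range_hilbertSchmidt_tensor _ _
  · have h0 : radOp χ ρ (fun _ => c) = 0 := dif_neg h
    rw [h0, show (0 : L2 →L[ℂ] L2).range = ⊥ from LinearMap.range_zero]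
    infer_instance

end Radial

/-! ### The cutoff free resolvent as an integral operator, and its behaviour at zero energy -/

section Green

open scoped ComplexConjugate InnerProductSpace

variable {χ ρ : Plane → ℂ}

theorem ae_fst_ne_snd : ∀ᵐ p : Plane × Plane ∂((volume : Measure Plane).prod volume),
    p.1 ≠ p.2 := by
  have hs : MeasurableSet {p : Plane × Plane | p.1 = p.2} :=
    measurableSet_eq_fun measurable_fst measurable_snd
  have h : ((volume : Measure Plane).prod volume) {p : Plane × Plane | p.1 = p.2} = 0 := by
    rw [Measure.measure_prod_null hs]
    refine Eventually.of_forall fun x => ?_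
    have : Prod.mk x ⁻¹' {p : Plane × Plane | p.1 = p.2} = {x} := by
      ext y; simp [eq_comm]
    simp only [this, measure_singleton, Pi.zero_apply]
  exact compl_mem_ae_iff.2 h

/-- The diagonal is a null set, so the value of the profile at distance 0 is irrelevant. -/
theorem radOp_congr {D : ℝ} (hD : ∀ x y, χ x ≠ 0 → ρ y ≠ 0 → ‖x - y‖ ≤ D) {φ ψ : ℝ → ℂ}
    (h : ∀ r, 0 < r → r ≤ D → φ r = ψ r) : radOp χ ρ φ = radOp χ ρ ψ := by
  have hae : radKernel χ ρ φ =ᵐ[(volume : Measure Plane).prod volume] radKernel χ ρ ψ := by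
    filter_upwards [ae_fst_ne_snd] with p hp
    simp only [radKernel]
    by_cases h1 : χ p.1 = 0
    · simp [h1]
    by_cases h2 : ρ p.2 = 0
    · simp [h2]
    rw [h _ (norm_pos_iff.2 (sub_ne_zero.2 hp)) (hD _ _ h1 h2)]
  by_cases hm : MemLp (radKernel χ ρ φ) 2 ((volume : Measure Plane).prod volume)
  · have hm' := (memLp_congr_ae hae).1 hm
    rw [radOp_eq hm, radOp_eq hm', MemLp.toLp_congr hm hm' hae]
  · have hm' := fun h' => hm ((memLp_congr_ae hae).2 h')
    unfold radOp
    rw [dif_neg hm, dif_neg hm']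

open scoped Classical in
/-- The outgoing fundamental solution of `-Δ + w²`, as a function of the distance. -/
def green (w : ℂ) : ℝ → ℂ :=
  (Set.Ioi (0 : ℝ)).piecewise (fun r => besselK (w * r) / (2 * Real.pi)) 0

theorem green_of_pos (w : ℂ) {r : ℝ} (hr : 0 < r) : green w r = besselK (w * r) / (2 * Real.pi) :=
  Set.piecewise_eq_of_mem _ _ _ hr

theorem green_zero (w : ℂ) : green w 0 = 0 :=
  Set.piecewise_eq_of_notMem _ _ _ (by simp)

theorem measurable_green {w : ℂ} (hw : w ∈ cone) : Measurable (green w) := by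
  classical
  refine ContinuousOn.measurable_piecewise (ContinuousOn.div_const ?_ _)
    continuousOn_const measurableSet_Ioi
  exact differentiableOn_besselK.continuousOn.comp (by fun_prop) fun r hr => smul_mem_cone hw hr

/-- The size of the free resolvent kernel at distances at most `D`. -/
def greenBound (D : ℝ) (w : ℂ) : ℝ :=
  Real.Gamma (1 / 2) / (2 * Real.pi) * (‖w‖ ^ (-(1 / 2) : ℝ) * Real.exp (D * max (-w.re) 0))

theorem greenBound_nonneg (D : ℝ) (w : ℂ) : 0 ≤ greenBound D w := by
  have := Real.Gamma_pos_of_pos (s := 1 / 2) (by norm_num)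
  have := Real.pi_pos
  unfold greenBound; positivity

/-- The bound on K₀(wr) separates into |w|^(-1/2), an r^(-1/2) absorbed by `weakSing`, and an
exponential that grows only when Re w < 0 and then at most with rate D. -/
theorem norm_green_le {w : ℂ} (hw : w ∈ cone) {D r : ℝ} (hr : 0 ≤ r) (hrD : r ≤ D) :
    ‖green w r‖ ≤ greenBound D w * weakSing r := by
  rcases hr.eq_or_lt with rfl | hr
  · rw [green_zero, norm_zero]
    exact mul_nonneg (greenBound_nonneg _ _) (weakSing_nonneg le_rfl)
  rw [green_of_pos w hr, norm_div]
  have h2 : ‖(2 * Real.pi : ℂ)‖ = 2 * Real.pi := by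
    rw [norm_mul, Complex.norm_of_nonneg Real.pi_pos.le]; simp
  rw [h2, div_le_iff₀ (by positivity)]
  have h := norm_besselK_le (smul_mem_cone hw hr)
  rw [norm_mul, Complex.norm_of_nonneg hr.le, Real.mul_rpow (norm_nonneg _) hr.le,
    Complex.re_mul_ofReal] at h
  have he : Real.exp (-(w.re * r)) ≤ Real.exp (D * max (-w.re) 0) := by
    refine Real.exp_le_exp.2 ?_
    calc -(w.re * r) = r * -w.re := by ring
      _ ≤ r * max (-w.re) 0 := by gcongr; exact le_max_left _ _
      _ ≤ _ := by gcongr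
  have hG := Real.Gamma_pos_of_pos (s := 1 / 2) (by norm_num)
  refine h.trans ?_
  rw [greenBound]
  have := Real.pi_pos
  calc _ ≤ Real.Gamma (1 / 2) * (‖w‖ ^ (-(1 / 2) : ℝ) * weakSing r) *
        Real.exp (D * max (-w.re) 0) := by
        refine mul_le_mul ?_ he (Real.exp_pos _).le
          (mul_nonneg hG.le (mul_nonneg (by positivity) (weakSing_nonneg hr.le)))
        exact mul_le_mul_of_nonneg_left (mul_le_mul_of_nonneg_left (rpow_le_weakSing r)
          (by positivity)) hG.le
    _ = _ := by field_simp

/-- The cutoff free resolvent `χ (-Δ + w²)⁻¹ ρ` and its continuation to the cone. -/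
def KOp (χ ρ : Plane → ℂ) (w : ℂ) : L2 →L[ℂ] L2 := radOp χ ρ (green w)

theorem KOp_mem_finiteRankClosure (w : ℂ) : KOp χ ρ w ∈ finiteRankClosure L2 :=
  radOp_mem_finiteRankClosure _

theorem memLp_radKernel_green (hχ : Continuous χ) (hχc : HasCompactSupport χ) (hρ : Continuous ρ)
    (hρc : HasCompactSupport ρ) {w : ℂ} (hw : w ∈ cone) :
    MemLp (radKernel χ ρ (green w)) 2 ((volume : Measure Plane).prod volume) := by
  obtain ⟨D, -, hD⟩ := exists_norm_sub_lt hχc hρc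
  exact memLp_radKernel hχ hχc hρ hρc (fun x y hx hy => (hD x y hx hy).le) (measurable_green hw)
    fun r hr hrD => norm_green_le hw hr hrD

theorem continuousAt_greenBound (D : ℝ) {w : ℂ} (hw : w ≠ 0) : ContinuousAt (greenBound D) w := by
  unfold greenBound
  refine continuousAt_const.mul (ContinuousAt.mul ?_ (by fun_prop))
  exact continuous_norm.continuousAt.rpow_const (Or.inl (norm_ne_zero_iff.2 hw))

theorem analyticOnNhd_KOp (hχ : Continuous χ) (hχc : HasCompactSupport χ) (hρ : Continuous ρ)
    (hρc : HasCompactSupport ρ) : AnalyticOnNhd ℂ (KOp χ ρ) cone := by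
  obtain ⟨D, -, hD⟩ := exists_norm_sub_lt hχc hρc
  refine analyticOnNhd_radOp hχ hχc hρ hρc (fun x y hx hy => (hD x y hx hy).le) isOpen_cone
    (fun w hw => measurable_green hw) (fun r hr _ => ?_) fun w₀ hw₀ => ?_
  · rcases hr.eq_or_lt with rfl | hr
    · simp_rw [green_zero]; exact differentiableOn_const _
    · simp_rw [green_of_pos _ hr]
      refine DifferentiableOn.div_const ?_ _
      exact differentiableOn_besselK.comp (by fun_prop) fun w hw => smul_mem_cone hw hr
  · refine ⟨greenBound D w₀ + 1, ?_⟩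
    filter_upwards [(continuousAt_greenBound D (ne_zero_of_mem_cone hw₀)).eventually_lt_const
      (lt_add_one _), isOpen_cone.mem_nhds hw₀] with w h1 hw r hr hrD
    refine (norm_green_le hw hr hrD).trans ?_
    gcongr
    exact weakSing_nonneg hr

/-- The source of the rate in the final estimate: the Hilbert-Schmidt norm is bounded by the scalar
size of the kernel times the norm of a majorant independent of w. -/
theorem exists_norm_KOp_le (hχ : Continuous χ) (hχc : HasCompactSupport χ) (hρ : Continuous ρ)
    (hρc : HasCompactSupport ρ) {L : ℝ} (hL : ∀ x y, χ x ≠ 0 → ρ y ≠ 0 → ‖x - y‖ ≤ L) :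
    ∃ C : ℝ, 0 ≤ C ∧ ∀ w ∈ cone, ‖KOp χ ρ w‖ ≤
      C * (‖w‖ ^ (-(1 / 2) : ℝ) * Real.exp (L * max (-w.re) 0)) := by
  have hG := Real.Gamma_pos_of_pos (s := 1 / 2) (by norm_num)
  have := Real.pi_pos
  refine ⟨Real.Gamma (1 / 2) / (2 * Real.pi) * ‖(memLp_radMajorant hχ hχc hρ hρc).toLp _‖,
    by positivity, fun w hw => ?_⟩
  refine (norm_radOp_le hχ hχc hρ hρc (greenBound_nonneg L w) hL
    fun r hr hrD => norm_green_le hw hr hrD).trans_eq ?_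
  rw [greenBound]; ring

theorem abs_log_le_weakSing {D r : ℝ} (hr : 0 ≤ r) (hrD : r ≤ D) :
    |Real.log r| ≤ (2 + D) * weakSing r := by
  have hD : 0 ≤ D := hr.trans hrD
  have h1 := one_le_weakSing hr
  rcases hr.eq_or_lt with rfl | hr
  · simp only [Real.log_zero, abs_zero]; positivity
  have h2 := rpow_le_weakSing r
  have h3 : -Real.log r ≤ 2 * r ^ (-(1 / 2) : ℝ) := by
    have := Real.log_le_rpow_div (x := r⁻¹) (by positivity) (ε := 1 / 2) (by norm_num)
    rw [Real.log_inv, Real.inv_rpow hr.le, ← Real.rpow_neg hr.le] at this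
    linarith
  have h4 : Real.log r ≤ r := (Real.log_le_sub_one_of_pos hr).trans (by linarith)
  rw [abs_le]
  constructor <;> nlinarith

/-- Outside a smaller disc the function is replaced by 0, so that it can serve as a radial profile
defined, measurable and bounded everywhere. -/
theorem exists_bounded_measurable_extension {f : ℂ → ℂ} {ε : ℝ} (hε : 0 < ε)
    (hf : DifferentiableOn ℂ f (Metric.ball 0 ε)) :
    ∃ (g : ℂ → ℂ) (M : ℝ), 0 ≤ M ∧ Measurable g ∧ DifferentiableOn ℂ g (Metric.ball 0 (ε / 2)) ∧
      (∀ z, ‖g z‖ ≤ M) ∧ ∀ z ∈ Metric.ball (0 : ℂ) (ε / 2), f z = g z := by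
  classical
  have hsub : Metric.closedBall (0 : ℂ) (ε / 2) ⊆ Metric.ball 0 ε :=
    Metric.closedBall_subset_ball (by linarith)
  have hc := hf.continuousOn.mono hsub
  obtain ⟨M, hM⟩ := (isCompact_closedBall (0 : ℂ) (ε / 2)).exists_bound_of_continuousOn hc
  have he : ∀ z ∈ Metric.ball (0 : ℂ) (ε / 2),
      f z = (Metric.closedBall (0 : ℂ) (ε / 2)).piecewise f 0 z := fun z hz =>
    (Set.piecewise_eq_of_mem _ _ _ (Metric.ball_subset_closedBall hz)).symm
  have hM0 : 0 ≤ M := (norm_nonneg _).trans (hM 0 (Metric.mem_closedBall_self (by linarith)))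
  refine ⟨(Metric.closedBall (0 : ℂ) (ε / 2)).piecewise f 0, M, hM0, ?_, ?_, fun z => ?_, he⟩
  · exact hc.measurable_piecewise continuousOn_const Metric.isClosed_closedBall.measurableSet
  · exact (hf.mono (Metric.ball_subset_ball (by linarith))).congr fun z hz => (he z hz).symm
  · by_cases hz : z ∈ Metric.closedBall (0 : ℂ) (ε / 2)
    · rw [Set.piecewise_eq_of_mem _ _ _ hz]; exact hM z hz
    · rw [Set.piecewise_eq_of_notMem _ _ _ hz]; simpa using hM0

/-- The logarithmic singularity of the cutoff free resolvent at zero energy. -/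
theorem exists_KOp_eq_log (hχ : Continuous χ) (hχc : HasCompactSupport χ) (hρ : Continuous ρ)
    (hρc : HasCompactSupport ρ) : ∃ A B : ℂ → L2 →L[ℂ] L2, AnalyticAt ℂ A 0 ∧ AnalyticAt ℂ B 0 ∧
      FiniteDimensional ℂ (A 0).range ∧ B 0 ∈ finiteRankClosure L2 ∧
      ∀ᶠ w in 𝓝 (0 : ℂ), w ∈ cone → KOp χ ρ w = Complex.log w • A w + B w := by
  obtain ⟨D, hD0, hD'⟩ := exists_norm_sub_lt hχc hρc
  have hD : ∀ x y, χ x ≠ 0 → ρ y ≠ 0 → ‖x - y‖ ≤ D := fun x y hx hy => (hD' x y hx hy).le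
  obtain ⟨ε, a₀, b₀, hε, ha₀, hb₀, hab₀⟩ := exists_besselK_eq_log
  obtain ⟨a, Ma, hMa0, ham, had, hMa, ha⟩ := exists_bounded_measurable_extension hε ha₀
  obtain ⟨b, Mb, hMb0, hbm, hbd, hMb, hb⟩ := exists_bounded_measurable_extension hε hb₀
  set η : ℝ := ε / 2 / D with hη
  have hη0 : 0 < η := by positivity
  have hmaps : ∀ w ∈ Metric.ball (0 : ℂ) η, ∀ r : ℝ, 0 ≤ r → r ≤ D →
      w * r ∈ Metric.ball (0 : ℂ) (ε / 2) := by
    intro w hw r hr hrD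
    rw [mem_ball_zero_iff] at hw ⊢
    rw [norm_mul, Complex.norm_of_nonneg hr]
    calc ‖w‖ * r ≤ ‖w‖ * D := by gcongr
      _ < η * D := by gcongr
      _ = ε / 2 := by rw [hη]; field_simp
  -- As log(wr) = log w + log r for r > 0, the kernel splits into log w times an analytic family and
  -- a second analytic family carrying the integrable singularity log r.
  set φ : ℂ → ℝ → ℂ := fun w r => a (w * r) / (2 * Real.pi) with hφ
  set ψ : ℂ → ℝ → ℂ := fun w r => (Real.log r * a (w * r) + b (w * r)) / (2 * Real.pi) with hψ
  have hpi : ‖(2 * Real.pi : ℂ)‖ = 2 * Real.pi := by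
    rw [norm_mul, Complex.norm_of_nonneg Real.pi_pos.le]; simp
  have hpi1 : 1 ≤ 2 * Real.pi := by nlinarith [Real.pi_gt_three]
  have hφm (w : ℂ) : Measurable (φ w) := by simp only [hφ]; fun_prop
  have hψm (w : ℂ) : Measurable (ψ w) := by simp only [hψ]; fun_prop
  have hφb (w : ℂ) (r : ℝ) (hr : 0 ≤ r) (hrD : r ≤ D) : ‖φ w r‖ ≤ Ma * weakSing r := by
    simp only [hφ]
    rw [norm_div, hpi]
    refine (div_le_self (norm_nonneg _) hpi1).trans ((hMa _).trans ?_)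
    exact le_mul_of_one_le_right hMa0 (one_le_weakSing hr)
  have hψb (w : ℂ) (r : ℝ) (hr : 0 ≤ r) (hrD : r ≤ D) :
      ‖ψ w r‖ ≤ ((2 + D) * Ma + Mb) * weakSing r := by
    simp only [hψ]
    rw [norm_div, hpi]
    refine (div_le_self (norm_nonneg _) hpi1).trans ((norm_add_le _ _).trans ?_)
    rw [norm_mul, Complex.norm_real, Real.norm_eq_abs, add_mul]
    refine add_le_add ?_ ((hMb _).trans (le_mul_of_one_le_right hMb0 (one_le_weakSing hr)))
    calc |Real.log r| * ‖a (w * r)‖ ≤ ((2 + D) * weakSing r) * Ma := by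
          gcongr
          · exact mul_nonneg (by positivity) (weakSing_nonneg hr)
          · exact abs_log_le_weakSing hr hrD
          · exact hMa _
      _ = _ := by ring
  have hda (r : ℝ) (hr : 0 ≤ r) (hrD : r ≤ D) :
      DifferentiableOn ℂ (fun w : ℂ => a (w * r)) (Metric.ball 0 η) :=
    had.comp (by fun_prop) fun w hw => hmaps w hw r hr hrD
  have hdb (r : ℝ) (hr : 0 ≤ r) (hrD : r ≤ D) :
      DifferentiableOn ℂ (fun w : ℂ => b (w * r)) (Metric.ball 0 η) :=
    hbd.comp (by fun_prop) fun w hw => hmaps w hw r hr hrD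
  refine ⟨fun w => radOp χ ρ (φ w), fun w => radOp χ ρ (ψ w), ?_, ?_, ?_,
    radOp_mem_finiteRankClosure _, ?_⟩
  · exact analyticOnNhd_radOp hχ hχc hρ hρc hD Metric.isOpen_ball (fun w _ => hφm w)
      (fun r hr hrD => (hda r hr hrD).div_const _)
      (fun w _ => ⟨Ma, Eventually.of_forall fun w r hr hrD => hφb w r hr hrD⟩) 0
      (Metric.mem_ball_self hη0)
  · exact analyticOnNhd_radOp hχ hχc hρ hρc hD Metric.isOpen_ball (fun w _ => hψm w)
      (fun r hr hrD => (((hda r hr hrD).const_mul _).add (hdb r hr hrD)).div_const _)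
      (fun w _ => ⟨_, Eventually.of_forall fun w r hr hrD => hψb w r hr hrD⟩) 0
      (Metric.mem_ball_self hη0)
  -- At w = 0 the coefficient of the logarithm no longer depends on r, so it has rank at most one.
  · have e : φ 0 = fun _ => a 0 / (2 * Real.pi) := by
      ext r; simp only [hφ, zero_mul]
    change FiniteDimensional ℂ (radOp χ ρ (φ 0)).range
    rw [e]
    exact finiteDimensional_range_radOp_const hχ hχc hρ hρc _
  · filter_upwards [Metric.ball_mem_nhds (0 : ℂ) hη0] with w hw hwc
    rw [← radOp_smul_add _ (memLp_radKernel hχ hχc hρ hρc hD (hφm w) (hφb w))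
      (memLp_radKernel hχ hχc hρ hρc hD (hψm w) (hψb w))]
    refine radOp_congr hD fun r hr hrD => ?_
    have hm := hmaps w hw r hr.le hrD
    rw [green_of_pos w hr, hab₀ _ ⟨smul_mem_cone hwc hr,
      Metric.ball_subset_ball (by linarith) hm⟩, ha _ hm, hb _ hm,
      Complex.log_mul_ofReal r hr w (ne_zero_of_mem_cone hwc)]
    simp only [hφ, hψ]
    ring

end Green

/-! ### Fourier transform of the fundamental solution through the heat kernel -/

section HeatKernel

/-- Up to a factor `4 π`, the heat kernel on the plane with the damping factor `exp (-κ² t)`. -/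
def heatKernel (κ : ℝ) (p : Plane × ℝ) : ℝ :=
  p.2⁻¹ * Real.exp (-(κ ^ 2 * p.2) - ‖p.1‖ ^ 2 / (4 * p.2))

theorem heatKernel_eq (κ : ℝ) (x : Plane) (t : ℝ) : heatKernel κ (x, t) =
    t⁻¹ * Real.exp (-(κ ^ 2 * t)) * Real.exp (-(4 * t)⁻¹ * ‖x‖ ^ 2) := by
  rw [heatKernel, mul_assoc, ← Real.exp_add]
  congr 3
  ring

theorem measurable_heatKernel (κ : ℝ) : Measurable (heatKernel κ) := by
  unfold heatKernel; fun_prop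

theorem heatKernel_nonneg (κ : ℝ) (x : Plane) {t : ℝ} (ht : 0 ≤ t) : 0 ≤ heatKernel κ (x, t) := by
  rw [heatKernel_eq]; positivity

theorem integrable_gaussian_plane {b : ℝ} (hb : 0 < b) :
    Integrable fun x : Plane => Real.exp (-b * ‖x‖ ^ 2) := by
  have h := (GaussianFourier.integrable_cexp_neg_mul_sq_norm_add (b := (b : ℂ)) (by simpa using hb)
    0 (0 : Plane)).norm
  refine h.congr (Eventually.of_forall fun x => ?_)
  simp only [zero_mul, add_zero]
  rw [← Complex.ofReal_neg, ← Complex.ofReal_pow, ← Complex.ofReal_mul, ← Complex.ofReal_exp,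
    Complex.norm_real, Real.norm_of_nonneg (Real.exp_pos _).le]

theorem integral_gaussian_plane {b : ℝ} (hb : 0 < b) :
    ∫ x : Plane, Real.exp (-b * ‖x‖ ^ 2) = Real.pi / b := by
  rw [GaussianFourier.integral_rexp_neg_mul_sq_norm hb]
  simp

/-- Integrating in x first, the Gaussian mass 4πt cancels the factor 1/t and leaves a multiple of
e^(-κ²t). -/
theorem integrable_heatKernel {κ : ℝ} (hκ : 0 < κ) : Integrable (heatKernel κ)
    ((volume : Measure Plane).prod (volume.restrict (Set.Ioi 0))) := by
  rw [integrable_prod_iff' (measurable_heatKernel κ).aestronglyMeasurable]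
  constructor
  · refine (ae_restrict_iff' measurableSet_Ioi).2 (Eventually.of_forall fun t ht => ?_)
    have ht : 0 < t := ht
    simp_rw [heatKernel_eq]
    exact (integrable_gaussian_plane (by positivity)).const_mul _
  · have h : IntegrableOn (fun t : ℝ => 4 * Real.pi * Real.exp (-κ ^ 2 * t)) (Set.Ioi 0) :=
      (exp_neg_integrableOn_Ioi 0 (by positivity)).const_mul _
    refine Integrable.congr h ?_
    refine (ae_restrict_iff' measurableSet_Ioi).2 (Eventually.of_forall fun t ht => ?_)
    have ht : 0 < t := ht
    have e (x : Plane) : ‖heatKernel κ (x, t)‖ =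
        t⁻¹ * Real.exp (-(κ ^ 2 * t)) * Real.exp (-(4 * t)⁻¹ * ‖x‖ ^ 2) := by
      rw [Real.norm_of_nonneg (heatKernel_nonneg κ x ht.le), heatKernel_eq]
    simp only [e]
    rw [integral_const_mul, integral_gaussian_plane (by positivity), neg_mul]
    field_simp

theorem green_eq_integral {κ : ℝ} (hκ : 0 < κ) {x : Plane} (hx : x ≠ 0) :
    green κ ‖x‖ = (4 * Real.pi : ℂ)⁻¹ * ((∫ t in Set.Ioi (0 : ℝ), heatKernel κ (x, t) : ℝ) : ℂ) := by
  have hx' : 0 < ‖x‖ := norm_pos_iff.2 hx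
  have := integral_heat_eq_besselK hκ hx'
  simp only [heatKernel]
  rw [this, green_of_pos _ hx']
  have : (Real.pi : ℂ) ≠ 0 := by exact_mod_cast Real.pi_ne_zero
  push_cast
  field_simp
  norm_num

theorem ae_green_eq_integral {κ : ℝ} (hκ : 0 < κ) : ∀ᵐ x : Plane,
    green κ ‖x‖ = (4 * Real.pi : ℂ)⁻¹ * ((∫ t in Set.Ioi (0 : ℝ), heatKernel κ (x, t) : ℝ) : ℂ) := by
  have : ∀ᵐ x : Plane, x ≠ 0 := by
    rw [ae_iff]; simp
  filter_upwards [this] with x hx using green_eq_integral hκ hx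

theorem integrable_green {κ : ℝ} (hκ : 0 < κ) : Integrable fun x : Plane => green κ ‖x‖ := by
  have h := ((integrable_heatKernel hκ).integral_prod_left.ofReal (𝕜 := ℂ)).const_mul
    (4 * Real.pi : ℂ)⁻¹
  exact h.congr ((ae_green_eq_integral hκ).mono fun x hx => hx.symm)

/-- The Fourier transform of the fundamental solution. -/
theorem fourier_green {κ : ℝ} (hκ : 0 < κ) (ξ : Plane) :
    𝓕 (fun x : Plane => green κ ‖x‖) ξ = (((κ ^ 2 + (2 * Real.pi * ‖ξ‖) ^ 2)⁻¹ : ℝ) : ℂ) := by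
  have hpi : (Real.pi : ℂ) ≠ 0 := by exact_mod_cast Real.pi_ne_zero
  set c : ℂ := (4 * Real.pi : ℂ)⁻¹ with hc
  set e : Plane → ℂ := fun x => Complex.exp (↑(-2 * Real.pi * inner ℝ x ξ) * Complex.I) with he
  have he1 (x : Plane) : ‖e x‖ = 1 := Complex.norm_exp_ofReal_mul_I _
  have hem : Measurable e := by simp only [he]; fun_prop
  have hint : Integrable (fun p : Plane × ℝ => e p.1 * (c * (heatKernel κ p : ℂ)))
      ((volume : Measure Plane).prod (volume.restrict (Set.Ioi 0))) := by
    refine (((integrable_heatKernel hκ).ofReal (𝕜 := ℂ)).const_mul c).bdd_mul (c := 1)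
      (hem.comp measurable_fst).aestronglyMeasurable (Eventually.of_forall fun p => (he1 _).le)
  calc 𝓕 (fun x : Plane => green κ ‖x‖) ξ
      = ∫ x : Plane, e x * green κ ‖x‖ := by
        rw [Real.fourier_eq']; rfl
    _ = ∫ x : Plane, ∫ t in Set.Ioi (0 : ℝ), e x * (c * (heatKernel κ (x, t) : ℂ)) := by
        refine integral_congr_ae ?_
        filter_upwards [ae_green_eq_integral hκ] with x hx
        rw [integral_const_mul, integral_const_mul, integral_complex_ofReal, hx]
    _ = ∫ t in Set.Ioi (0 : ℝ), ∫ x : Plane, e x * (c * (heatKernel κ (x, t) : ℂ)) :=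
        integral_integral_swap hint
    _ = ∫ t in Set.Ioi (0 : ℝ), ((Real.exp (-(κ ^ 2 + (2 * Real.pi * ‖ξ‖) ^ 2) * t) : ℝ) : ℂ) := by
        refine setIntegral_congr_fun measurableSet_Ioi fun t ht => ?_
        have ht : 0 < t := ht
        have ht' : (t : ℂ) ≠ 0 := by exact_mod_cast ht.ne'
        -- In dimension two the Gaussian transform carries the factor π/b = 4πt, which cancels both
        -- 1/t and the constant c.
        have hg := fourier_gaussian_innerProductSpace (V := Plane) (b := (((4 * t)⁻¹ : ℝ) : ℂ))
          (by rw [Complex.ofReal_re]; positivity) ξ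
        rw [Real.fourier_eq'] at hg
        have h1 (x : Plane) : e x * (c * (heatKernel κ (x, t) : ℂ)) =
            (c * (t⁻¹ * Real.exp (-(κ ^ 2 * t)) : ℝ)) *
            (e x • Complex.exp (-(((4 * t)⁻¹ : ℝ) : ℂ) * ‖x‖ ^ 2)) := by
          rw [heatKernel_eq, smul_eq_mul]
          push_cast
          ring
        simp only [h1]
        rw [integral_const_mul, hg]
        simp only [finrank_euclideanSpace, Fintype.card_fin, Nat.cast_ofNat]
        rw [div_self two_ne_zero, Complex.cpow_one, Complex.ofReal_mul, Complex.ofReal_exp]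
        have h2 : ((Real.exp (-(κ ^ 2 + (2 * Real.pi * ‖ξ‖) ^ 2) * t) : ℝ) : ℂ) =
            Complex.exp ((-(κ ^ 2 * t) : ℝ)) *
            Complex.exp (-Real.pi ^ 2 * ‖ξ‖ ^ 2 / (((4 * t)⁻¹ : ℝ) : ℂ)) := by
          rw [← Complex.exp_add, Complex.ofReal_exp]
          congr 1
          push_cast
          field_simp
          ring
        rw [h2, hc]
        push_cast
        field_simp
    _ = _ := by
        rw [integral_complex_ofReal, integral_exp_mul_Ioi (by
          have := sq_nonneg (2 * Real.pi * ‖ξ‖); nlinarith [pow_pos hκ 2])]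
        rw [mul_zero, Real.exp_zero, neg_div_neg_eq, one_div]

end HeatKernel

/-! ### The free resolvent as a Fourier multiplier, and the Schrödinger equation -/

section FreeResolvent

open scoped InnerProductSpace

theorem coeFn_mulL2 (g : Plane → ℂ) (hg : MemLp g ∞ (volume : Measure Plane)) (u : L2) :
    mulL2 g hg u =ᵐ[volume] fun x => g x * u x := by
  refine (ContinuousLinearMap.coeFn_holder (r := 2) (ContinuousLinearMap.mul ℂ ℂ) (hg.toLp g) u).trans ?_
  filter_upwards [hg.coeFn_toLp] with x hx
  rw [hx]; rfl

theorem norm_mulL2_le {g : Plane → ℂ} (hg : MemLp g ∞ (volume : Measure Plane)) {M : ℝ}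
    (hM0 : 0 ≤ M) (hM : ∀ x, ‖g x‖ ≤ M) : ‖mulL2 g hg‖ ≤ M := by
  refine ContinuousLinearMap.opNorm_le_bound _ hM0 fun u => ?_
  refine Lp.norm_le_mul_norm_of_ae_le_mul ?_
  filter_upwards [coeFn_mulL2 g hg u] with x hx
  rw [hx, norm_mul]
  gcongr
  exact hM x

open scoped Classical in
/-- The Fourier multiplier with the bounded symbol `m`. -/
def fourierMul (m : Plane → ℂ) : L2 →L[ℂ] L2 :=
  if h : MemLp m ∞ (volume : Measure Plane) then
    ((Lp.fourierTransformₗᵢ Plane ℂ).symm.toContinuousLinearEquiv : L2 →L[ℂ] L2) ∘L mulL2 m h ∘L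
      ((Lp.fourierTransformₗᵢ Plane ℂ).toContinuousLinearEquiv : L2 →L[ℂ] L2)
  else 0

theorem fourierMul_apply {m : Plane → ℂ} (h : MemLp m ∞ (volume : Measure Plane)) (u : L2) :
    fourierMul m u = 𝓕⁻ (mulL2 m h (𝓕 u)) := by
  rw [fourierMul, dif_pos h]; rfl

theorem coeFn_fourier_fourierMul {m : Plane → ℂ} (h : MemLp m ∞ (volume : Measure Plane))
    (u : L2) : (𝓕 (fourierMul m u) : L2) =ᵐ[volume] fun ξ => m ξ * (𝓕 u : L2) ξ := by
  rw [fourierMul_apply h, FourierTransform.fourier_fourierInv_eq]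
  exact coeFn_mulL2 m h _

theorem norm_fourierMul_le {m : Plane → ℂ} (h : MemLp m ∞ (volume : Measure Plane)) {M : ℝ}
    (hM0 : 0 ≤ M) (hM : ∀ x, ‖m x‖ ≤ M) : ‖fourierMul m‖ ≤ M := by
  refine ContinuousLinearMap.opNorm_le_bound _ hM0 fun u => ?_
  rw [fourierMul_apply h]
  have h1 : ‖(𝓕⁻ (mulL2 m h (𝓕 u)) : L2)‖ = ‖mulL2 m h (𝓕 u)‖ :=
    (Lp.fourierTransformₗᵢ Plane ℂ).symm.norm_map _
  rw [h1]
  refine ((mulL2 m h).le_of_opNorm_le (norm_mulL2_le h hM0 hM) _).trans_eq ?_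
  rw [Lp.norm_fourier_eq]

theorem eq_of_fourier_ae_eq {u v : L2} (h : (𝓕 u : L2) =ᵐ[volume] (𝓕 v : L2)) : u = v :=
  (Lp.fourierTransformₗᵢ Plane ℂ).injective (Lp.ext h)

/-- The symbol of `(-Δ + w²)⁻¹`. -/
def resSymbol (w : ℂ) (ξ : Plane) : ℂ := (w ^ 2 + (((2 * Real.pi * ‖ξ‖) ^ 2 : ℝ) : ℂ))⁻¹

/-- Factor w² + s² as (w + is)(w - is). Both factors have real part Re w. -/
theorem sq_re_le_norm_sq_add (w : ℂ) (s : ℝ) : w.re ^ 2 ≤ ‖w ^ 2 + ((s ^ 2 : ℝ) : ℂ)‖ := by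
  have e : w ^ 2 + ((s ^ 2 : ℝ) : ℂ) = (w + s * Complex.I) * (w - s * Complex.I) := by
    push_cast
    linear_combination (s : ℂ) ^ 2 * Complex.I_sq
  have h1 : |w.re| ≤ ‖w + s * Complex.I‖ := by
    simpa using Complex.abs_re_le_norm (w + s * Complex.I)
  have h2 : |w.re| ≤ ‖w - s * Complex.I‖ := by
    simpa using Complex.abs_re_le_norm (w - s * Complex.I)
  rw [e, norm_mul, ← sq_abs, sq]
  gcongr

theorem sq_add_ne_zero {w : ℂ} (hw : 0 < w.re) (s : ℝ) : w ^ 2 + ((s ^ 2 : ℝ) : ℂ) ≠ 0 :=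
  norm_pos_iff.1 ((pow_pos hw 2).trans_le (sq_re_le_norm_sq_add w s))

theorem norm_resSymbol_le {w : ℂ} (hw : 0 < w.re) (ξ : Plane) :
    ‖resSymbol w ξ‖ ≤ (w.re ^ 2)⁻¹ := by
  rw [resSymbol, norm_inv]
  exact inv_anti₀ (pow_pos hw 2) (sq_re_le_norm_sq_add w _)

theorem memLp_resSymbol {w : ℂ} (hw : 0 < w.re) : MemLp (resSymbol w) ∞ (volume : Measure Plane) :=
  memLp_top_of_bound (by unfold resSymbol; fun_prop : Measurable (resSymbol w)).aestronglyMeasurable _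
    (Eventually.of_forall (norm_resSymbol_le hw))

/-- The free resolvent `(-Δ + w²)⁻¹`, for `Re w > 0`. -/
def freeRes (w : ℂ) : L2 →L[ℂ] L2 := fourierMul (resSymbol w)

theorem norm_freeRes_le {w : ℂ} (hw : 0 < w.re) : ‖freeRes w‖ ≤ (w.re ^ 2)⁻¹ :=
  norm_fourierMul_le (memLp_resSymbol hw) (by positivity) (norm_resSymbol_le hw)

theorem coeFn_fourier_freeRes {w : ℂ} (hw : 0 < w.re) (u : L2) :
    (𝓕 (freeRes w u) : L2) =ᵐ[volume] fun ξ => resSymbol w ξ * (𝓕 u : L2) ξ :=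
  coeFn_fourier_fourierMul (memLp_resSymbol hw) u

theorem freeRes_eq_iff {w : ℂ} (hw : 0 < w.re) (u f : L2) :
    freeRes w f = u ↔
      (𝓕 f : L2) =ᵐ[volume] fun ξ => (w ^ 2 + (((2 * Real.pi * ‖ξ‖) ^ 2 : ℝ) : ℂ)) * (𝓕 u : L2) ξ := by
  constructor
  · rintro rfl
    filter_upwards [coeFn_fourier_freeRes hw f] with ξ hξ
    rw [hξ, resSymbol, mul_inv_cancel_left₀ (sq_add_ne_zero hw _)]
  · intro h
    refine eq_of_fourier_ae_eq ?_
    filter_upwards [coeFn_fourier_freeRes hw f, h] with ξ h1 h2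
    rw [h1, h2, resSymbol, inv_mul_cancel_left₀ (sq_add_ne_zero hw _)]

/-- The resolvent identity, read off on the Fourier side. It transfers the distributional equation
and the analyticity in w to the fixed operator `freeRes 1`. -/
theorem freeRes_one_eq_iff {w : ℂ} (hw : 0 < w.re) (u f : L2) :
    freeRes 1 (f + (1 - w ^ 2) • u) = u ↔ freeRes w f = u := by
  rw [freeRes_eq_iff hw, freeRes_eq_iff (by simp)]
  have h : (𝓕 (f + (1 - w ^ 2) • u) : L2) =ᵐ[volume]
      fun ξ => (𝓕 f : L2) ξ + (1 - w ^ 2) * (𝓕 u : L2) ξ := by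
    rw [FourierTransform.fourier_add, FourierTransform.fourier_smul]
    filter_upwards [Lp.coeFn_add (𝓕 f : L2) ((1 - w ^ 2) • 𝓕 u : L2),
      Lp.coeFn_smul (1 - w ^ 2) (𝓕 u : L2)] with ξ h1 h2
    rw [h1, Pi.add_apply, h2, Pi.smul_apply, smul_eq_mul]
  constructor
  · intro h'
    filter_upwards [h, h'] with ξ h1 h2
    rw [h1] at h2
    linear_combination h2
  · intro h'
    filter_upwards [h, h'] with ξ h1 h2
    rw [h1, h2]
    ring

theorem isUnit_one_add_smul_freeRes_one {w : ℂ} (hw : 0 < w.re) :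
    (1 + (w ^ 2 - 1) • freeRes 1) * (1 - (w ^ 2 - 1) • freeRes w) = 1 ∧
      (1 - (w ^ 2 - 1) • freeRes w) * (1 + (w ^ 2 - 1) • freeRes 1) = 1 := by
  have h1 (f : L2) : freeRes 1 (f + (1 - w ^ 2) • freeRes w f) = freeRes w f :=
    (freeRes_one_eq_iff hw _ _).2 rfl
  have h2 (f : L2) : freeRes w (f + (w ^ 2 - 1) • freeRes 1 f) = freeRes 1 f := by
    rw [← freeRes_one_eq_iff hw]
    congr 1
    module
  simp only [map_add, map_smul] at h1 h2
  constructor <;> ext1 f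
  · have := h1 f
    simp only [mul_apply_eq_comp, add_apply, sub_apply, smul_apply, one_apply_eq_self, map_sub,
      map_smul]
    linear_combination (norm := module) (w ^ 2 - 1) • this
  · have := h2 f
    simp only [mul_apply_eq_comp, add_apply, sub_apply, smul_apply, one_apply_eq_self, map_add,
      map_smul]
    linear_combination (norm := module) -(w ^ 2 - 1) • this

/-- Here w enters only through w² inside an inverse, so analyticity follows from that of inversion.
-/
theorem freeRes_eq_inverse_mul {w : ℂ} (hw : 0 < w.re) :
    freeRes w = Ring.inverse (1 + (w ^ 2 - 1) • freeRes 1) * freeRes 1 := by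
  obtain ⟨h1, h2⟩ := isUnit_one_add_smul_freeRes_one hw
  have hu : IsUnit (1 + (w ^ 2 - 1) • freeRes 1) := ⟨⟨_, _, h1, h2⟩, rfl⟩
  have h3 : (1 + (w ^ 2 - 1) • freeRes 1) * freeRes w = freeRes 1 := by
    ext1 f
    have := (freeRes_one_eq_iff hw (freeRes w f) f).2 rfl
    simp only [mul_apply_eq_comp, add_apply, smul_apply, one_apply_eq_self, map_add,
      map_smul] at this ⊢
    linear_combination (norm := module) -this
  calc freeRes w = Ring.inverse (1 + (w ^ 2 - 1) • freeRes 1) *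
        ((1 + (w ^ 2 - 1) • freeRes 1) * freeRes w) := by
        rw [← mul_assoc, Ring.inverse_mul_cancel _ hu, one_mul]
    _ = _ := by rw [h3]

theorem analyticOnNhd_freeRes : AnalyticOnNhd ℂ freeRes {w | 0 < w.re} := by
  have hopen : IsOpen {w : ℂ | 0 < w.re} := isOpen_lt continuous_const Complex.continuous_re
  have : AnalyticOnNhd ℂ (fun w : ℂ => Ring.inverse (1 + (w ^ 2 - 1) • freeRes 1) * freeRes 1)
      {w | 0 < w.re} := by
    intro w hw
    obtain ⟨h1, h2⟩ := isUnit_one_add_smul_freeRes_one hw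
    have hu : IsUnit (1 + (w ^ 2 - 1) • freeRes 1) := ⟨⟨_, _, h1, h2⟩, rfl⟩
    have ha : AnalyticAt ℂ (fun w : ℂ => 1 + (w ^ 2 - 1) • freeRes 1) w := by fun_prop
    exact (analyticAt_inverse_comp ha hu).mul analyticAt_const
  exact this.congr hopen fun w hw => (freeRes_eq_inverse_mul hw).symm

/-! ### The free resolvent and the distributional Laplacian -/

theorem hasTemperateGrowth_resSymbol {κ : ℝ} (hκ : 0 < κ) :
    (resSymbol κ).HasTemperateGrowth := by
  have h1 : (fun x : Plane => (1 + ‖x‖ ^ 2) ^ (-1 : ℝ)).HasTemperateGrowth := by fun_prop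
  have h2 : (fun x : Plane => (1 + ‖(2 * Real.pi / κ) • x‖ ^ 2) ^ (-1 : ℝ)).HasTemperateGrowth :=
    h1.comp ((2 * Real.pi / κ) • ContinuousLinearMap.id ℝ Plane).hasTemperateGrowth
  have h3 : (fun x : Plane => ((((1 + ‖(2 * Real.pi / κ) • x‖ ^ 2) ^ (-1 : ℝ) : ℝ) : ℂ))
      ).HasTemperateGrowth := Function.Complex.hasTemperateGrowth_ofReal.comp h2
  have h4 := (Function.HasTemperateGrowth.const (E := Plane) ((κ : ℂ) ^ 2)⁻¹).mul h3
  refine (?_ : (resSymbol κ : Plane → ℂ) = _) ▸ h4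
  ext x
  have hx : (1 + ‖(2 * Real.pi / κ) • x‖ ^ 2) ≠ 0 := by positivity
  simp only [Pi.mul_apply]
  rw [Real.rpow_neg_one, resSymbol, Complex.ofReal_inv, ← mul_inv]
  congr 1
  rw [norm_smul, Real.norm_of_nonneg (by positivity)]
  have : (κ : ℂ) ≠ 0 := by exact_mod_cast hκ.ne'
  push_cast
  field_simp

theorem hasTemperateGrowth_inv_resSymbol (w : ℂ) :
    (fun ξ : Plane => w ^ 2 + (((2 * Real.pi * ‖ξ‖) ^ 2 : ℝ) : ℂ)).HasTemperateGrowth := by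
  have : (fun ξ : Plane => w ^ 2 + (((2 * Real.pi * ‖ξ‖) ^ 2 : ℝ) : ℂ)) =
      fun ξ : Plane => w ^ 2 + ((2 * Real.pi) ^ 2 : ℂ) * (((‖ξ‖) ^ 2 : ℝ) : ℂ) := by
    ext ξ; push_cast; ring
  rw [this]
  fun_prop

theorem toTemperedDistribution_fourierMul {m : Plane → ℂ} (h : MemLp m ∞ (volume : Measure Plane))
    (hm : m.HasTemperateGrowth) (u : L2) : ((fourierMul m u : L2) : 𝓢'(Plane, ℂ)) =
      TemperedDistribution.fourierMultiplierCLM ℂ m (u : 𝓢'(Plane, ℂ)) := by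
  rw [TemperedDistribution.fourierMultiplierCLM_apply, Lp.fourier_toTemperedDistribution_eq,
    fourierMul_apply h, ← Lp.fourierInv_toTemperedDistribution_eq]
  congr 1
  rw [← Lp.toTemperedDistribution_smul_eq (p := ∞) (q := 2) (r := 2) hm h]
  congr 1

theorem neg_laplacian_add_self_eq (T : 𝓢'(Plane, ℂ)) : -Δ T + T =
    TemperedDistribution.fourierMultiplierCLM ℂ
      (fun ξ : Plane => (1 : ℂ) ^ 2 + (((2 * Real.pi * ‖ξ‖) ^ 2 : ℝ) : ℂ)) T := by
  have h1 : (fun ξ : Plane => (1 : ℂ) ^ 2 + (((2 * Real.pi * ‖ξ‖) ^ 2 : ℝ) : ℂ)) =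
      (fun _ => (1 : ℂ)) + ((2 * Real.pi) ^ 2 : ℂ) • fun ξ : Plane => ((‖ξ‖ ^ 2 : ℝ) : ℂ) := by
    ext ξ
    simp only [Pi.add_apply, Pi.smul_apply, smul_eq_mul]
    push_cast; ring
  have hg : (fun ξ : Plane => ((‖ξ‖ ^ 2 : ℝ) : ℂ)).HasTemperateGrowth := by fun_prop
  have hg' : (((2 * Real.pi) ^ 2 : ℂ) • fun ξ : Plane => ((‖ξ‖ ^ 2 : ℝ) : ℂ)).HasTemperateGrowth :=
    (Function.HasTemperateGrowth.const _).mul hg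
  rw [h1, TemperedDistribution.fourierMultiplierCLM_apply,
    TemperedDistribution.smulLeftCLM_add (by fun_prop) hg',
    TemperedDistribution.smulLeftCLM_smul hg, add_apply,
    TemperedDistribution.smulLeftCLM_const, one_smul, smul_apply, FourierTransform.fourierInv_add,
    FourierTransform.fourierInv_smul, FourierTransform.fourierInv_fourier_eq,
    ← TemperedDistribution.fourierMultiplierCLM_apply,
    TemperedDistribution.laplacian_eq_fourierMultiplierCLM, neg_smul, neg_neg, add_comm]
  congr 1
  rw [← Complex.coe_smul]
  push_cast
  rfl

theorem toTemperedDistribution_injective {u v : L2} (h : (u : 𝓢'(Plane, ℂ)) = v) : u = v :=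
  LinearMap.ker_eq_bot.1 (Lp.ker_toTemperedDistributionCLM_eq_bot (F := ℂ)
    (μ := (volume : Measure Plane)) (p := 2)) h

theorem neg_laplacian_add_self_eq_iff (u g : L2) :
    -Δ (u : 𝓢'(Plane, ℂ)) + (u : 𝓢'(Plane, ℂ)) = (g : 𝓢'(Plane, ℂ)) ↔ freeRes 1 g = u := by
  have hm := hasTemperateGrowth_resSymbol one_pos
  rw [Complex.ofReal_one] at hm
  have hp := hasTemperateGrowth_inv_resSymbol 1
  have e : (fun ξ : Plane => (1 : ℂ) ^ 2 + (((2 * Real.pi * ‖ξ‖) ^ 2 : ℝ) : ℂ)) * resSymbol 1 =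
      fun _ => (1 : ℂ) := by
    ext ξ
    exact mul_inv_cancel₀ (sq_add_ne_zero (by simp) _)
  have hd := toTemperedDistribution_fourierMul (memLp_resSymbol (w := 1) (by simp)) hm g
  rw [neg_laplacian_add_self_eq]
  constructor
  · intro h
    apply toTemperedDistribution_injective
    rw [freeRes, hd, ← h,
      TemperedDistribution.fourierMultiplierCLM_fourierMultiplierCLM_apply hp hm, e]
    simp
  · rintro rfl
    rw [freeRes, hd, TemperedDistribution.fourierMultiplierCLM_fourierMultiplierCLM_apply hm hp,
      mul_comm, e]
    simp

theorem memSobolev_freeRes_one (g : L2) :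
    TemperedDistribution.MemSobolev 2 2 ((freeRes 1 g : L2) : 𝓢'(Plane, ℂ)) := by
  have hm := hasTemperateGrowth_resSymbol one_pos
  rw [Complex.ofReal_one] at hm
  rw [freeRes, toTemperedDistribution_fourierMul (memLp_resSymbol (w := 1) (by simp)) hm]
  rw [← add_zero (2 : ℝ), ← TemperedDistribution.memSobolev_besselPotential_iff,
    TemperedDistribution.besselPotential,
    TemperedDistribution.fourierMultiplierCLM_fourierMultiplierCLM_apply hm (by fun_prop)]
  refine TemperedDistribution.MemSobolev.fourierMultiplierCLM_of_bounded
    (TemperedDistribution.memSobolev_zero_iff.2 ⟨g, rfl⟩) (by fun_prop) ⟨1, fun ξ => ?_⟩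
  rw [Pi.mul_apply, norm_mul, resSymbol, norm_inv]
  have e : (1 : ℂ) ^ 2 + (((2 * Real.pi * ‖ξ‖) ^ 2 : ℝ) : ℂ) =
    ((1 + (2 * Real.pi * ‖ξ‖) ^ 2 : ℝ) : ℂ) := by push_cast; ring
  rw [e, Complex.norm_of_nonneg (by positivity), Complex.norm_of_nonneg (by positivity),
    inv_mul_le_one₀ (by positivity), div_self two_ne_zero, Real.rpow_one, mul_pow]
  -- The Bessel potential has symbol 1 + |ξ|² and the resolvent has 1/(1 + (2π|ξ|)²), so their
  -- product is at most 1.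
  have : 1 ≤ (2 * Real.pi) ^ 2 := by nlinarith [Real.pi_gt_three]
  nlinarith [sq_nonneg ‖ξ‖]

/-- With w = -iλ one has w² = -λ² and Re w = Im λ. The H² condition is automatic, because any L²
solution lies in the range of `freeRes 1`. -/
theorem solvesSchrodinger_iff {V : Plane → ℂ} (hV : MemLp V ∞ (volume : Measure Plane)) {l : ℂ}
    (hl : 0 < l.im) (u f : L2) :
    SolvesSchrodinger V hV l u f ↔ freeRes (-Complex.I * l) (f - mulL2 V hV u) = u := by
  have hre : 0 < (-Complex.I * l).re := by simpa using hl
  have hsq : (-Complex.I * l) ^ 2 = -l ^ 2 := by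
    rw [mul_pow, neg_sq, Complex.I_sq]; ring
  rw [← freeRes_one_eq_iff hre, hsq, ← neg_laplacian_add_self_eq_iff]
  have e : -Δ (u : 𝓢'(Plane, ℂ)) - l ^ 2 • (u : 𝓢'(Plane, ℂ)) + (mulL2 V hV u : 𝓢'(Plane, ℂ))
      = (f : 𝓢'(Plane, ℂ)) ↔ -Δ (u : 𝓢'(Plane, ℂ)) + (u : 𝓢'(Plane, ℂ)) =
        ((f - mulL2 V hV u + (1 - -l ^ 2) • u : L2) : 𝓢'(Plane, ℂ)) := by
    have : ((f - mulL2 V hV u + (1 - -l ^ 2) • u : L2) : 𝓢'(Plane, ℂ)) =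
        (f : 𝓢'(Plane, ℂ)) - (mulL2 V hV u : 𝓢'(Plane, ℂ)) +
          (1 - -l ^ 2) • (u : 𝓢'(Plane, ℂ)) := by
      simp only [← Lp.toTemperedDistributionCLM_apply, map_add, map_sub, map_smul]
    rw [this, sub_neg_eq_add, add_smul, one_smul]
    constructor <;> intro h
    · linear_combination (norm := module) h
    · linear_combination (norm := module) h
  rw [SolvesSchrodinger, e]
  refine ⟨fun h => h.2, fun h => ⟨?_, h⟩⟩
  rw [neg_laplacian_add_self_eq_iff] at h
  rw [← h]
  exact memSobolev_freeRes_one _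

end FreeResolvent

/-! ### Identification of the cutoff multiplier with the integral operator -/

section FreeKernel

open scoped InnerProductSpace ComplexConjugate Convolution

theorem mulL2_toLp {m : Plane → ℂ} (h : MemLp m ∞ (volume : Measure Plane))
    (hm : m.HasTemperateGrowth) (φ : 𝓢(Plane, ℂ)) :
    mulL2 m h (φ.toLp 2) = (SchwartzMap.smulLeftCLM ℂ m φ).toLp 2 := by
  ext1
  filter_upwards [coeFn_mulL2 m h (φ.toLp 2), φ.coeFn_toLp 2,
    (SchwartzMap.smulLeftCLM ℂ m φ).coeFn_toLp 2] with x h1 h2 h3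
  rw [h1, h2, h3, SchwartzMap.smulLeftCLM_apply_apply hm, smul_eq_mul]

theorem fourierMul_toLp {m : Plane → ℂ} (h : MemLp m ∞ (volume : Measure Plane))
    (hm : m.HasTemperateGrowth) (φ : 𝓢(Plane, ℂ)) :
    fourierMul m (φ.toLp 2) = (SchwartzMap.fourierMultiplierCLM ℂ m φ).toLp 2 := by
  rw [fourierMul_apply h, SchwartzMap.toLp_fourier_eq, mulL2_toLp h hm,
    SchwartzMap.toLp_fourierInv_eq, SchwartzMap.fourierMultiplierCLM_apply]

theorem ofReal_re_pos {κ : ℝ} (hκ : 0 < κ) : 0 < (κ : ℂ).re := by simpa using hκ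

theorem freeRes_toLp {κ : ℝ} (hκ : 0 < κ) (φ : 𝓢(Plane, ℂ)) :
    freeRes κ (φ.toLp 2) = (SchwartzMap.fourierMultiplierCLM ℂ (resSymbol κ) φ).toLp 2 :=
  fourierMul_toLp (memLp_resSymbol (ofReal_re_pos hκ)) (hasTemperateGrowth_resSymbol hκ) φ

/-- The free resolvent is the convolution with the fundamental solution. -/
theorem fourierMultiplier_resSymbol_apply {κ : ℝ} (hκ : 0 < κ) (φ : 𝓢(Plane, ℂ)) (x : Plane) :
    SchwartzMap.fourierMultiplierCLM ℂ (resSymbol κ) φ x = ∫ y, green κ ‖x - y‖ * φ y := by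
  have hG := integrable_green hκ
  have hm := hasTemperateGrowth_resSymbol hκ
  set G : Plane → ℂ := fun x => green κ ‖x‖ with hGdef
  have hF : 𝓕 (G ⋆[ContinuousLinearMap.mul ℂ ℂ] (φ : Plane → ℂ)) =
      (SchwartzMap.smulLeftCLM ℂ (resSymbol κ) (𝓕 φ) : Plane → ℂ) := by
    ext ξ
    rw [Real.fourier_mul_convolution_eq hG φ.integrable, fourier_green hκ,
      SchwartzMap.smulLeftCLM_apply_apply hm, SchwartzMap.fourier_coe, smul_eq_mul, resSymbol]
    push_cast
    rfl
  have hinv : 𝓕⁻ (𝓕 (G ⋆[ContinuousLinearMap.mul ℂ ℂ] (φ : Plane → ℂ))) =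
      G ⋆[ContinuousLinearMap.mul ℂ ℂ] (φ : Plane → ℂ) := by
    refine Continuous.fourierInv_fourier_eq ?_ ?_ ?_
    · refine BddAbove.continuous_convolution_right_of_integrable _ ?_ hG φ.continuous
      exact ⟨SchwartzMap.seminorm ℝ 0 0 φ, fun x ⟨y, hy⟩ ↦ hy ▸ SchwartzMap.norm_le_seminorm ℝ φ y⟩
    · exact hG.integrable_convolution _ φ.integrable
    · rw [hF]; exact SchwartzMap.integrable _
  rw [SchwartzMap.fourierMultiplierCLM_apply, SchwartzMap.fourierInv_coe, ← hF, hinv,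
    convolution_eq_swap]
  rfl

variable {χ ρ : 𝓢(Plane, ℂ)}

theorem cutoff_freeRes_toLp (hχ : HasCompactSupport χ) (hρ : HasCompactSupport ρ) {κ : ℝ}
    (hκ : 0 < κ) (f : 𝓢(Plane, ℂ)) :
    mulL2 χ (χ.memLp_top) (freeRes κ (mulL2 ρ ρ.memLp_top (f.toLp 2))) = KOp χ ρ κ (f.toLp 2) := by
  have hwc : (κ : ℂ) ∈ cone := mem_cone_of_re_pos (ofReal_re_pos hκ)
  have hk := memLp_radKernel_green χ.continuous hχ ρ.continuous hρ hwc
  refine ext_inner_left ℂ fun g => ?_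
  rw [mulL2_toLp _ ρ.hasTemperateGrowth, freeRes_toLp hκ, KOp, inner_radOp hk, L2.inner_def]
  set φ := SchwartzMap.smulLeftCLM ℂ ρ f with hφ
  set ψ := SchwartzMap.fourierMultiplierCLM ℂ (resSymbol κ) φ with hψ
  have hint : Integrable (fun p : Plane × Plane =>
      conj (g p.1) * radKernel χ ρ (green κ) p * f.toLp 2 volume p.2)
      ((volume : Measure Plane).prod volume) := by
    have := (memLp_two_mul_prod (memLp_two_conj (Lp.memLp g)) (Lp.memLp (f.toLp 2))).integrable_mul hk
    refine this.congr (Eventually.of_forall fun p => ?_)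
    simp only [Pi.mul_apply]
    ring
  rw [integral_prod _ hint]
  refine integral_congr_ae ?_
  filter_upwards [coeFn_mulL2 χ χ.memLp_top (ψ.toLp 2), ψ.coeFn_toLp 2] with x h1 h2
  rw [h1, h2, hψ, fourierMultiplier_resSymbol_apply hκ, RCLike.inner_apply, ← integral_const_mul,
    mul_comm, ← integral_const_mul]
  refine integral_congr_ae ?_
  filter_upwards [f.coeFn_toLp 2] with y h3
  rw [h3, hφ, SchwartzMap.smulLeftCLM_apply_apply ρ.hasTemperateGrowth, radKernel, smul_eq_mul]
  ring

theorem cutoff_freeRes_ofReal (hχ : HasCompactSupport χ) (hρ : HasCompactSupport ρ) {κ : ℝ}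
    (hκ : 0 < κ) : mulL2 χ χ.memLp_top ∘L freeRes κ ∘L mulL2 ρ ρ.memLp_top = KOp χ ρ κ := by
  ext1 f
  refine (SchwartzMap.denseRange_toLpCLM (E := Plane) (F := ℂ) (μ := volume) (p := 2)
    ENNReal.ofNat_ne_top).induction_on f (isClosed_eq (by fun_prop) (by fun_prop)) fun φ => ?_
  exact cutoff_freeRes_toLp hχ hρ hκ φ

/-- The identity theorem at the accumulation point 1. Formulas for the free resolvent are proved for
real positive w and then continued. -/
theorem eqOn_of_eq_ofReal {G : Type*} [NormedAddCommGroup G] [NormedSpace ℂ G] {F₁ F₂ : ℂ → G}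
    {U : Set ℂ} (hU : IsPreconnected U) (h1 : (1 : ℂ) ∈ U)
    (hF₁ : AnalyticOnNhd ℂ F₁ U) (hF₂ : AnalyticOnNhd ℂ F₂ U)
    (h : ∀ κ : ℝ, 0 < κ → F₁ κ = F₂ κ) : Set.EqOn F₁ F₂ U := by
  refine hF₁.eqOn_of_preconnected_of_frequently_eq hF₂ hU h1 ?_
  have ht : Tendsto (fun n : ℕ => ((1 + 1 / ((n : ℝ) + 1) : ℝ) : ℂ)) atTop (𝓝[≠] 1) := by
    refine tendsto_nhdsWithin_iff.2 ⟨?_, Eventually.of_forall fun n => ?_⟩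
    · have := (tendsto_one_div_add_atTop_nhds_zero_nat (𝕜 := ℝ)).const_add 1
      rw [add_zero] at this
      exact (Complex.continuous_ofReal.tendsto' (1 : ℝ) (1 : ℂ) (by simp)).comp this
    · simp only [Set.mem_compl_iff, Set.mem_singleton_iff]
      intro h
      have h' : (1 + 1 / ((n : ℝ) + 1) : ℝ) = 1 := by exact_mod_cast h
      have : 0 < 1 / ((n : ℝ) + 1) := by positivity
      linarith
  exact ht.frequently (Frequently.of_forall fun n => h _ (by positivity))

/-- The cutoff free resolvent is an integral operator. -/
theorem cutoff_freeRes (hχ : HasCompactSupport χ) (hρ : HasCompactSupport ρ) {w : ℂ}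
    (hw : 0 < w.re) : mulL2 χ χ.memLp_top ∘L freeRes w ∘L mulL2 ρ ρ.memLp_top = KOp χ ρ w := by
  refine eqOn_of_eq_ofReal (U := {w : ℂ | 0 < w.re})
    (F₁ := fun w => mulL2 χ χ.memLp_top ∘L freeRes w ∘L mulL2 ρ ρ.memLp_top)
    (convex_halfSpace_re_gt 0).isPreconnected (by simp) (fun w hw => ?_) (fun w hw => ?_)
    (fun κ hκ => cutoff_freeRes_ofReal hχ hρ hκ) hw
  · exact analyticAt_clm_comp analyticAt_const
      (analyticAt_clm_comp (analyticOnNhd_freeRes w hw) analyticAt_const)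
  · exact analyticOnNhd_KOp χ.continuous hχ ρ.continuous hρ w (mem_cone_of_re_pos hw)

end FreeKernel

/-! ### Commutation with the cutoff, and a second order equation for the cutoff resolvent -/

section Commutator

open scoped InnerProductSpace LineDeriv

/-- The standard basis of the plane. -/
def stdBasis : OrthonormalBasis (Fin 2) ℝ Plane := EuclideanSpace.basisFun (Fin 2) ℝ

/-- The partial derivatives of a Schwartz function. -/
def pderiv (j : Fin 2) (u : 𝓢(Plane, ℂ)) : 𝓢(Plane, ℂ) := ∂_{stdBasis j} u

/-- The product of Schwartz functions. -/
def smulS (χ u : 𝓢(Plane, ℂ)) : 𝓢(Plane, ℂ) := SchwartzMap.smulLeftCLM ℂ χ u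

theorem smulS_apply (χ u : 𝓢(Plane, ℂ)) (x : Plane) : smulS χ u x = χ x * u x :=
  SchwartzMap.smulLeftCLM_apply_apply χ.hasTemperateGrowth u x

theorem pderiv_smulS (j : Fin 2) (χ u : 𝓢(Plane, ℂ)) :
    pderiv j (smulS χ u) = smulS (pderiv j χ) u + smulS χ (pderiv j u) := by
  ext x
  have e : (smulS χ u : Plane → ℂ) = fun x => χ x * u x := funext (smulS_apply χ u)
  rw [add_apply, smulS_apply, smulS_apply]
  simp only [pderiv, SchwartzMap.lineDerivOp_apply_eq_fderiv]
  rw [e, fderiv_fun_mul χ.differentiableAt u.differentiableAt]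
  simp only [add_apply, smul_apply, smul_eq_mul]
  ring

theorem pderiv_add (j : Fin 2) (u v : 𝓢(Plane, ℂ)) : pderiv j (u + v) = pderiv j u + pderiv j v :=
  LineDeriv.lineDerivOp_add _ _ _

theorem laplacian_eq_sum_pderiv (u : 𝓢(Plane, ℂ)) : Δ u = ∑ j, pderiv j (pderiv j u) :=
  SchwartzMap.laplacian_eq_sum stdBasis u

/-- The commutator is put in divergence form, with every derivative outside the product (∂ⱼχ)u. Then
(1-Δ)⁻¹∂ⱼ is a bounded multiplier and no derivative of u has to be estimated. -/
theorem sub_laplacian_smulS (χ u : 𝓢(Plane, ℂ)) : smulS χ u - Δ (smulS χ u) =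
    smulS χ (u - Δ u) + smulS (Δ χ) u - (2 : ℂ) • ∑ j, pderiv j (smulS (pderiv j χ) u) := by
  have h (j : Fin 2) : pderiv j (pderiv j (smulS χ u)) =
      (2 : ℂ) • pderiv j (smulS (pderiv j χ) u) - smulS (pderiv j (pderiv j χ)) u +
        smulS χ (pderiv j (pderiv j u)) := by
    rw [pderiv_smulS, pderiv_add, pderiv_smulS j χ (pderiv j u), pderiv_smulS j (pderiv j χ) u]
    module
  simp only [laplacian_eq_sum_pderiv, Fin.sum_univ_two, h]
  ext x
  simp only [sub_apply, add_apply, smul_apply, smulS_apply,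
    smul_eq_mul]
  ring

theorem freeRes_one_sub_laplacian (v : 𝓢(Plane, ℂ)) : freeRes 1 ((v - Δ v).toLp 2) = v.toLp 2 := by
  rw [← neg_laplacian_add_self_eq_iff, Lp.toTemperedDistribution_toLp_eq,
    Lp.toTemperedDistribution_toLp_eq, TemperedDistribution.laplacian_toTemperedDistributionCLM_eq,
    map_sub]
  abel

theorem sub_laplacian_eq_of_freeRes {w : ℂ} (hw : 0 < w.re) {u φ : 𝓢(Plane, ℂ)}
    (h : freeRes w (φ.toLp 2) = u.toLp 2) : u - Δ u = φ + (1 - w ^ 2) • u := by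
  rw [← freeRes_one_eq_iff hw, ← neg_laplacian_add_self_eq_iff, Lp.toTemperedDistribution_toLp_eq,
    TemperedDistribution.laplacian_toTemperedDistributionCLM_eq] at h
  refine SchwartzMap.injective_toLp 2 volume (toTemperedDistribution_injective ?_)
  have e : (φ + (1 - w ^ 2) • u).toLp 2 volume = φ.toLp 2 volume + (1 - w ^ 2) • u.toLp 2 volume :=
    ((SchwartzMap.toLpCLM ℂ (E := Plane) ℂ 2 volume).map_add _ _).trans
      (congrArg _ ((SchwartzMap.toLpCLM ℂ (E := Plane) ℂ 2 volume).map_smul _ _))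
  beta_reduce
  rw [e, ← h, Lp.toTemperedDistribution_toLp_eq, map_sub]
  abel

/-- The symbol of `∂_j (1 - Δ)⁻¹`. -/
def derivSymbol (j : Fin 2) (ξ : Plane) : ℂ :=
  2 * Real.pi * Complex.I * (inner ℝ ξ (stdBasis j) : ℝ) * resSymbol 1 ξ

theorem abs_inner_stdBasis_le (j : Fin 2) (ξ : Plane) : |inner ℝ ξ (stdBasis j)| ≤ ‖ξ‖ := by
  simpa using abs_real_inner_le_norm ξ (stdBasis j)

theorem resSymbol_one (ξ : Plane) :
    resSymbol 1 ξ = (((1 + (2 * Real.pi * ‖ξ‖) ^ 2)⁻¹ : ℝ) : ℂ) := by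
  rw [resSymbol]; push_cast; rw [one_pow]

theorem norm_derivSymbol_le (j : Fin 2) (ξ : Plane) :
    ‖derivSymbol j ξ‖ ≤ (2 * Real.pi * ‖ξ‖) * (1 + (2 * Real.pi * ‖ξ‖) ^ 2)⁻¹ := by
  rw [derivSymbol, norm_mul, resSymbol_one, Complex.norm_of_nonneg (by positivity)]
  gcongr
  simp only [norm_mul, Complex.norm_I, Complex.norm_real, Complex.norm_ofNat, mul_one,
    Real.norm_eq_abs, abs_of_pos Real.pi_pos]
  gcongr
  exact abs_inner_stdBasis_le j ξ

theorem memLp_derivSymbol (j : Fin 2) : MemLp (derivSymbol j) ∞ (volume : Measure Plane) := by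
  refine memLp_top_of_bound (C := 1) ?_ (Eventually.of_forall fun ξ => ?_)
  · exact (by unfold derivSymbol resSymbol; fun_prop : Measurable (derivSymbol j)).aestronglyMeasurable
  · refine (norm_derivSymbol_le j ξ).trans ?_
    rw [← div_eq_mul_inv, div_le_one (by positivity)]
    nlinarith [sq_nonneg (2 * Real.pi * ‖ξ‖ - 1), sq_nonneg (2 * Real.pi * ‖ξ‖)]

theorem freeRes_one_pderiv (j : Fin 2) (u : 𝓢(Plane, ℂ)) :
    freeRes 1 ((pderiv j u).toLp 2) = fourierMul (derivSymbol j) (u.toLp 2) := by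
  refine eq_of_fourier_ae_eq ?_
  have hi : (fun x : Plane => inner ℝ x (stdBasis j)).HasTemperateGrowth := by fun_prop
  have h4 : 𝓕 ((pderiv j u).toLp 2 volume) = (𝓕 (pderiv j u)).toLp 2 :=
    SchwartzMap.toLp_fourier_eq _
  have h5 : 𝓕 (u.toLp 2 volume) = (𝓕 u).toLp 2 := SchwartzMap.toLp_fourier_eq _
  filter_upwards [coeFn_fourier_freeRes (w := 1) (by simp) ((pderiv j u).toLp 2),
    coeFn_fourier_fourierMul (memLp_derivSymbol j) (u.toLp 2), (𝓕 (pderiv j u)).coeFn_toLp 2,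
    (𝓕 u).coeFn_toLp 2] with ξ h1 h2 h3 h6
  rw [h1, h2, h4, h5, h3, h6, pderiv, SchwartzMap.fourier_lineDerivOp_eq, smul_apply,
    SchwartzMap.smulLeftCLM_apply_apply hi, derivSymbol, smul_eq_mul, Complex.real_smul]
  ring

theorem hasCompactSupport_pderiv {χ : 𝓢(Plane, ℂ)} (hχ : HasCompactSupport χ) (j : Fin 2) :
    HasCompactSupport (pderiv j χ) :=
  hχ.of_isClosed_subset (isClosed_tsupport _) (SchwartzMap.tsupport_lineDerivOp_subset _ χ)

theorem hasCompactSupport_laplacian {χ : 𝓢(Plane, ℂ)} (hχ : HasCompactSupport χ) :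
    HasCompactSupport (Δ χ : 𝓢(Plane, ℂ)) := by
  rw [laplacian_eq_sum_pderiv, Fin.sum_univ_two]
  exact (hasCompactSupport_pderiv (hasCompactSupport_pderiv hχ 0) 0).add
    (hasCompactSupport_pderiv (hasCompactSupport_pderiv hχ 1) 1)

variable {χ ρ : 𝓢(Plane, ℂ)}

theorem mulL2_toLp_smulS (χ u : 𝓢(Plane, ℂ)) :
    mulL2 χ χ.memLp_top (u.toLp 2) = (smulS χ u).toLp 2 :=
  mulL2_toLp _ χ.hasTemperateGrowth u

/-- For u = (-Δ+κ²)⁻¹ρf one has u - Δu = ρf + (1-κ²)u. Applying (1-Δ)⁻¹ to the commutator formula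
for χu expresses it through cutoff resolvents with cutoffs χ, Δχ and ∂ⱼχ. -/
theorem KOp_ofReal_eq (hχ : HasCompactSupport χ) (hρ : HasCompactSupport ρ) {κ : ℝ} (hκ : 0 < κ) :
    KOp χ ρ κ = freeRes 1 ∘L ((1 - (κ : ℂ) ^ 2) • KOp χ ρ κ +
        mulL2 χ χ.memLp_top ∘L mulL2 ρ ρ.memLp_top + KOp (Δ χ : 𝓢(Plane, ℂ)) ρ κ) -
      (2 : ℂ) • ∑ j, fourierMul (derivSymbol j) ∘L KOp (pderiv j χ) ρ κ := by
  ext1 f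
  refine (SchwartzMap.denseRange_toLpCLM (E := Plane) (F := ℂ) (μ := volume) (p := 2)
    ENNReal.ofNat_ne_top).induction_on f (isClosed_eq (by fun_prop) (by fun_prop)) fun f => ?_
  rw [SchwartzMap.toLpCLM_apply]
  set φ := smulS ρ f with hφ
  set u := SchwartzMap.fourierMultiplierCLM ℂ (resSymbol κ) φ with hu
  have hR : freeRes κ (φ.toLp 2) = u.toLp 2 := freeRes_toLp hκ φ
  have hK {ζ : 𝓢(Plane, ℂ)} (hζ : HasCompactSupport ζ) :
      KOp ζ ρ κ (f.toLp 2) = (smulS ζ u).toLp 2 := by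
    rw [← cutoff_freeRes_toLp hζ hρ hκ, mulL2_toLp_smulS, hR, mulL2_toLp_smulS]
  have hlin := sub_laplacian_eq_of_freeRes (ofReal_re_pos hκ) hR
  have hcomm := sub_laplacian_smulS χ u
  have hs : smulS χ (φ + (1 - (κ : ℂ) ^ 2) • u) = smulS χ φ + (1 - (κ : ℂ) ^ 2) • smulS χ u := by
    ext x
    simp only [add_apply, smul_apply, smulS_apply, smul_eq_mul]
    ring
  rw [hlin, hs] at hcomm
  have hmain := freeRes_one_sub_laplacian (smulS χ u)
  rw [hcomm] at hmain
  have hmain' : (smulS χ u).toLp 2 volume = freeRes 1 ((smulS χ φ).toLp 2 volume +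
      (1 - (κ : ℂ) ^ 2) • (smulS χ u).toLp 2 volume + (smulS (Δ χ) u).toLp 2 volume -
        (2 : ℂ) • ∑ j, (pderiv j (smulS (pderiv j χ) u)).toLp 2 volume) := by
    refine hmain.symm.trans (congrArg (freeRes 1) ?_)
    simp only [← SchwartzMap.toLpCLM_apply (𝕜 := ℂ), map_add, map_sub, map_smul, map_sum]
  simp only [sub_apply, add_apply, smul_apply, ContinuousLinearMap.comp_apply, sum_apply]
  rw [hK hχ, hK (hasCompactSupport_laplacian hχ), mulL2_toLp_smulS, ← hφ, mulL2_toLp_smulS]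
  simp only [hK (hasCompactSupport_pderiv hχ _), ← freeRes_one_pderiv]
  conv_lhs => rw [hmain']
  simp only [map_add, map_sub, map_smul, map_sum]
  abel

/-- The second order equation satisfied by the cutoff free resolvent, on the whole cone. -/
theorem KOp_eq (hχ : HasCompactSupport χ) (hρ : HasCompactSupport ρ) {w : ℂ} (hw : w ∈ cone) :
    KOp χ ρ w = freeRes 1 ∘L ((1 - w ^ 2) • KOp χ ρ w +
        mulL2 χ χ.memLp_top ∘L mulL2 ρ ρ.memLp_top + KOp (Δ χ : 𝓢(Plane, ℂ)) ρ w) -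
      (2 : ℂ) • ∑ j, fourierMul (derivSymbol j) ∘L KOp (pderiv j χ) ρ w := by
  have hA {ζ : 𝓢(Plane, ℂ)} (hζ : HasCompactSupport ζ) (z : ℂ) (hz : z ∈ cone) :
      AnalyticAt ℂ (KOp ζ ρ) z := analyticOnNhd_KOp ζ.continuous hζ ρ.continuous hρ z hz
  refine eqOn_of_eq_ofReal (F₁ := KOp χ ρ) (F₂ := fun w => freeRes 1 ∘L ((1 - w ^ 2) • KOp χ ρ w +
        mulL2 χ χ.memLp_top ∘L mulL2 ρ ρ.memLp_top + KOp (Δ χ : 𝓢(Plane, ℂ)) ρ w) -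
      (2 : ℂ) • ∑ j, fourierMul (derivSymbol j) ∘L KOp (pderiv j χ) ρ w)
    ((starConvex_cone one_pos).isPathConnected ?_).isConnected.isPreconnected
    (mem_cone_of_re_pos (by simp)) (fun z hz => hA hχ z hz) (fun z hz => ?_)
    (fun κ hκ => KOp_ofReal_eq hχ hρ hκ) hw
  · exact mem_cone_of_re_pos (by simp)
  · have h1 : AnalyticAt ℂ (fun z : ℂ => 1 - z ^ 2) z := by fun_prop
    have h2 : AnalyticAt ℂ (fun z => (1 - z ^ 2) • KOp χ ρ z) z := h1.smul (hA hχ z hz)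
    have h3 : AnalyticAt ℂ (fun z => (1 - z ^ 2) • KOp χ ρ z +
        mulL2 χ χ.memLp_top ∘L mulL2 ρ ρ.memLp_top + KOp (Δ χ : 𝓢(Plane, ℂ)) ρ z) z :=
      (h2.add analyticAt_const).add (hA (hasCompactSupport_laplacian hχ) z hz)
    have h4 : AnalyticAt ℂ (fun z => ∑ j, fourierMul (derivSymbol j) ∘L KOp (pderiv j χ) ρ z) z :=
      Finset.analyticAt_fun_sum _ fun j _ =>
        analyticAt_clm_comp analyticAt_const (hA (hasCompactSupport_pderiv hχ j) z hz)
    exact (analyticAt_clm_comp (analyticAt_const (v := freeRes 1)) h3).sub (h4.fun_const_smul (c := (2 : ℂ)))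

end Commutator

/-! ### Bounds from L² to the Sobolev spaces H¹ and H² -/

section SobolevBounds

open scoped InnerProductSpace LineDeriv

theorem eLpNorm_fourier (u : L2) : eLpNorm (𝓕 u : L2) 2 volume = ‖u‖ₑ := by
  rw [← Lp.enorm_def, ← ofReal_norm, Lp.norm_fourier_eq, ofReal_norm]

theorem sobolevENorm_zero (u : L2) : sobolevENorm 0 u = ‖u‖ₑ := by
  rw [← eLpNorm_fourier, sobolevENorm]
  simp

theorem aestronglyMeasurable_sobolev (s : ℝ) (u : L2) : AEStronglyMeasurable
    (fun ξ : Plane ↦ (1 + (2 * Real.pi * ‖ξ‖) ^ 2) ^ (s / 2) • (𝓕 u : L2) ξ) volume :=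
  AEStronglyMeasurable.smul (by fun_prop : Measurable fun ξ : Plane ↦
    (1 + (2 * Real.pi * ‖ξ‖) ^ 2) ^ (s / 2)).aestronglyMeasurable (Lp.aestronglyMeasurable _)

theorem eLpNorm_le_of_norm_le_add {f g h k : Plane → ℂ} (hg : AEStronglyMeasurable g)
    (hh : AEStronglyMeasurable h) (hk : AEStronglyMeasurable k)
    (H : ∀ᵐ x, ‖f x‖ ≤ ‖g x‖ + (2 * ‖h x‖ + 2 * ‖k x‖)) : eLpNorm f 2 volume ≤
      eLpNorm g 2 volume + (2 * eLpNorm h 2 volume + 2 * eLpNorm k 2 volume) := by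
  have e (q : Plane → ℂ) : eLpNorm (fun x => 2 * ‖q x‖) 2 volume = 2 * eLpNorm q 2 volume := by
    have := eLpNorm_const_smul (2 : ℝ) (fun x => ‖q x‖) 2 (volume : Measure Plane)
    rw [eLpNorm_norm] at this
    rw [show (fun x => 2 * ‖q x‖) = (2 : ℝ) • fun x => ‖q x‖ from rfl, this,
      Real.enorm_of_nonneg zero_le_two, ENNReal.ofReal_ofNat]
  calc eLpNorm f 2 volume
      ≤ eLpNorm (fun x => ‖g x‖ + (2 * ‖h x‖ + 2 * ‖k x‖)) 2 volume := by
        refine eLpNorm_mono_ae (H.mono fun x hx => hx.trans (le_abs_self _))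
    _ ≤ eLpNorm (fun x => ‖g x‖) 2 volume + eLpNorm (fun x => 2 * ‖h x‖ + 2 * ‖k x‖) 2 volume :=
        eLpNorm_add_le hg.norm ((hh.norm.const_mul _).add (hk.norm.const_mul _)) one_le_two
    _ ≤ eLpNorm (fun x => ‖g x‖) 2 volume + (eLpNorm (fun x => 2 * ‖h x‖) 2 volume +
          eLpNorm (fun x => 2 * ‖k x‖) 2 volume) := by
        gcongr
        exact eLpNorm_add_le (hh.norm.const_mul _) (hk.norm.const_mul _) one_le_two
    _ = _ := by rw [e, e, eLpNorm_norm]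

theorem coeFn_fourier_second_order (g : L2) (v : Fin 2 → L2) :
    ∀ᵐ ξ : Plane, ‖(𝓕 (freeRes 1 g - (2 : ℂ) • ∑ j, fourierMul (derivSymbol j) (v j)) : L2) ξ‖ ≤
      (1 + (2 * Real.pi * ‖ξ‖) ^ 2)⁻¹ * (‖(𝓕 g : L2) ξ‖ +
        (2 * ((2 * Real.pi * ‖ξ‖) * ‖(𝓕 (v 0) : L2) ξ‖) +
          2 * ((2 * Real.pi * ‖ξ‖) * ‖(𝓕 (v 1) : L2) ξ‖))) := by
  have e : (𝓕 (freeRes 1 g - (2 : ℂ) • ∑ j, fourierMul (derivSymbol j) (v j)) : L2) =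
      𝓕 (freeRes 1 g) - (2 : ℂ) • (𝓕 (fourierMul (derivSymbol 0) (v 0)) +
        𝓕 (fourierMul (derivSymbol 1) (v 1))) := by
    rw [Fin.sum_univ_two, ← FourierTransform.fourier_add, ← FourierTransform.fourier_smul]
    exact map_sub (Lp.fourierTransformₗᵢ Plane ℂ) _ _
  rw [e]
  filter_upwards [coeFn_fourier_freeRes (w := 1) (by simp) g,
    coeFn_fourier_fourierMul (memLp_derivSymbol 0) (v 0),
    coeFn_fourier_fourierMul (memLp_derivSymbol 1) (v 1),
    Lp.coeFn_sub (𝓕 (freeRes 1 g)) ((2 : ℂ) • (𝓕 (fourierMul (derivSymbol 0) (v 0)) +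
        𝓕 (fourierMul (derivSymbol 1) (v 1)))),
    Lp.coeFn_smul (2 : ℂ) (𝓕 (fourierMul (derivSymbol 0) (v 0)) +
        𝓕 (fourierMul (derivSymbol 1) (v 1))),
    Lp.coeFn_add (𝓕 (fourierMul (derivSymbol 0) (v 0)))
        (𝓕 (fourierMul (derivSymbol 1) (v 1)))] with ξ h1 h2 h3 h4 h5 h6
  rw [h4, Pi.sub_apply, h5, Pi.smul_apply, h6, Pi.add_apply, h1, h2, h3]
  have hr : ‖resSymbol 1 ξ‖ = (1 + (2 * Real.pi * ‖ξ‖) ^ 2)⁻¹ := by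
    rw [resSymbol_one, Complex.norm_of_nonneg (by positivity)]
  have hd0 := norm_derivSymbol_le 0 ξ
  have hd1 := norm_derivSymbol_le 1 ξ
  set p := (1 + (2 * Real.pi * ‖ξ‖) ^ 2)⁻¹
  set s := 2 * Real.pi * ‖ξ‖
  calc ‖resSymbol 1 ξ * (𝓕 g : L2) ξ - (2 : ℂ) • (derivSymbol 0 ξ * (𝓕 (v 0) : L2) ξ +
        derivSymbol 1 ξ * (𝓕 (v 1) : L2) ξ)‖
      ≤ ‖resSymbol 1 ξ‖ * ‖(𝓕 g : L2) ξ‖ + 2 * (‖derivSymbol 0 ξ‖ * ‖(𝓕 (v 0) : L2) ξ‖ +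
        ‖derivSymbol 1 ξ‖ * ‖(𝓕 (v 1) : L2) ξ‖) := by
        refine (norm_sub_le _ _).trans ?_
        rw [norm_smul, norm_mul, Complex.norm_ofNat]
        gcongr
        exact (norm_add_le _ _).trans_eq (by rw [norm_mul, norm_mul])
    _ ≤ p * ‖(𝓕 g : L2) ξ‖ + 2 * ((s * p) * ‖(𝓕 (v 0) : L2) ξ‖ +
        (s * p) * ‖(𝓕 (v 1) : L2) ξ‖) := by rw [hr]; gcongr
    _ = _ := by ring

theorem sobolevENorm_one_le (g : L2) (v : Fin 2 → L2) :
    sobolevENorm 1 (freeRes 1 g - (2 : ℂ) • ∑ j, fourierMul (derivSymbol j) (v j)) ≤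
      ‖g‖ₑ + (2 * ‖v 0‖ₑ + 2 * ‖v 1‖ₑ) := by
  rw [← eLpNorm_fourier g, ← eLpNorm_fourier (v 0), ← eLpNorm_fourier (v 1)]
  refine eLpNorm_le_of_norm_le_add (Lp.aestronglyMeasurable _) (Lp.aestronglyMeasurable _)
    (Lp.aestronglyMeasurable _) ?_
  filter_upwards [coeFn_fourier_second_order g v] with ξ hξ
  rw [norm_smul, Real.norm_of_nonneg (by positivity)]
  set q := (1 + (2 * Real.pi * ‖ξ‖) ^ 2) ^ ((1 : ℝ) / 2) with hq
  have hq1 : 1 ≤ q := Real.one_le_rpow (by nlinarith [sq_nonneg (2 * Real.pi * ‖ξ‖)]) (by norm_num)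
  have hqq : q * q = 1 + (2 * Real.pi * ‖ξ‖) ^ 2 := by
    rw [hq, ← Real.rpow_add (by positivity)]; norm_num
  have hs : 2 * Real.pi * ‖ξ‖ ≤ q := by
    refine le_of_sq_le_sq ?_ (by positivity)
    nlinarith
  rw [← hqq] at hξ
  set s := 2 * Real.pi * ‖ξ‖ with hs'
  have hs0 : 0 ≤ s := by positivity
  have hq0 : 0 < q := by positivity
  calc q * _ ≤ q * ((q * q)⁻¹ * (‖(𝓕 g : L2) ξ‖ +
        (2 * (s * ‖(𝓕 (v 0) : L2) ξ‖) + 2 * (s * ‖(𝓕 (v 1) : L2) ξ‖)))) := by gcongr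
    _ ≤ q * ((q * q)⁻¹ * (q * ‖(𝓕 g : L2) ξ‖ +
        (2 * (q * ‖(𝓕 (v 0) : L2) ξ‖) + 2 * (q * ‖(𝓕 (v 1) : L2) ξ‖)))) := by
        gcongr
        exact le_mul_of_one_le_left (norm_nonneg _) hq1
    _ = _ := by field_simp

/-- The bootstrap step: (1-Δ)⁻¹∂ⱼ gains one derivative, so H¹ control of the commutator terms gives
H² control of the whole. -/
theorem sobolevENorm_two_le (g : L2) (v : Fin 2 → L2) :
    sobolevENorm 2 (freeRes 1 g - (2 : ℂ) • ∑ j, fourierMul (derivSymbol j) (v j)) ≤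
      ‖g‖ₑ + (2 * sobolevENorm 1 (v 0) + 2 * sobolevENorm 1 (v 1)) := by
  rw [← eLpNorm_fourier g]
  refine eLpNorm_le_of_norm_le_add (Lp.aestronglyMeasurable _) (aestronglyMeasurable_sobolev 1 _)
    (aestronglyMeasurable_sobolev 1 _) ?_
  filter_upwards [coeFn_fourier_second_order g v] with ξ hξ
  rw [norm_smul, norm_smul, norm_smul, Real.norm_of_nonneg (by positivity),
    Real.norm_of_nonneg (by positivity), div_self two_ne_zero, Real.rpow_one]
  set q := (1 + (2 * Real.pi * ‖ξ‖) ^ 2) ^ ((1 : ℝ) / 2) with hq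
  have hqq : q * q = 1 + (2 * Real.pi * ‖ξ‖) ^ 2 := by
    rw [hq, ← Real.rpow_add (by positivity)]; norm_num
  have hq0 : 0 < q := by positivity
  have hs : 2 * Real.pi * ‖ξ‖ ≤ q := by
    refine le_of_sq_le_sq ?_ (by positivity)
    nlinarith
  set s := 2 * Real.pi * ‖ξ‖ with hs'
  have hs0 : 0 ≤ s := by positivity
  have hp : 0 < 1 + s ^ 2 := by positivity
  calc (1 + s ^ 2) * _ ≤ (1 + s ^ 2) * ((1 + s ^ 2)⁻¹ * (‖(𝓕 g : L2) ξ‖ +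
        (2 * (s * ‖(𝓕 (v 0) : L2) ξ‖) + 2 * (s * ‖(𝓕 (v 1) : L2) ξ‖)))) := by gcongr
    _ = ‖(𝓕 g : L2) ξ‖ + (2 * (s * ‖(𝓕 (v 0) : L2) ξ‖) + 2 * (s * ‖(𝓕 (v 1) : L2) ξ‖)) := by
        rw [mul_inv_cancel_left₀ hp.ne']
    _ ≤ _ := by gcongr

/-- Interpolation between `L²` and `H²`. -/
theorem sobolevENorm_one_le_two {t : ℝ} (ht : 0 < t) (u : L2) : sobolevENorm 1 u ≤
    ENNReal.ofReal t⁻¹ * sobolevENorm 2 u + ENNReal.ofReal t * ‖u‖ₑ := by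
  have h1 : ENNReal.ofReal t⁻¹ * sobolevENorm 2 u = eLpNorm (t⁻¹ • fun ξ : Plane ↦
      (1 + (2 * Real.pi * ‖ξ‖) ^ 2) ^ ((2 : ℝ) / 2) • (𝓕 u : L2) ξ) 2 volume := by
    rw [eLpNorm_const_smul, sobolevENorm, Real.enorm_of_nonneg (by positivity)]
  have h2 : ENNReal.ofReal t * ‖u‖ₑ = eLpNorm (t • ((𝓕 u : L2) : Plane → ℂ)) 2 volume := by
    rw [eLpNorm_const_smul, eLpNorm_fourier,
      Real.enorm_of_nonneg ht.le]
  rw [h1, h2]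
  have hm := (aestronglyMeasurable_sobolev 2 u).const_smul t⁻¹
  have hadd := eLpNorm_add_le hm.norm ((Lp.aestronglyMeasurable (𝓕 u : L2)).const_smul t).norm
    one_le_two
  rw [eLpNorm_norm, eLpNorm_norm] at hadd
  refine le_trans (eLpNorm_mono_ae ?_) hadd
  refine Eventually.of_forall fun ξ => ?_
  simp only [Pi.add_apply, Pi.smul_apply]
  refine le_trans ?_ (le_abs_self _)
  simp only [norm_smul, Real.norm_eq_abs, div_self (two_ne_zero' ℝ), Real.rpow_one]
  rw [abs_of_nonneg (by positivity), abs_of_nonneg (by positivity), abs_of_nonneg (by positivity),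
    abs_of_nonneg ht.le, ← mul_assoc, ← add_mul]
  gcongr
  set q := (1 + (2 * Real.pi * ‖ξ‖) ^ 2) ^ ((1 : ℝ) / 2) with hq
  have hqq : q * q = 1 + (2 * Real.pi * ‖ξ‖) ^ 2 := by
    rw [hq, ← Real.rpow_add (by positivity)]; norm_num
  have hq0 : 0 < q := by positivity
  rw [← hqq, inv_mul_eq_div, ← sub_le_iff_le_add, le_div_iff₀ ht]
  -- With q = (1 + (2π|ξ|)²)^(1/2), the claim is the elementary inequality q ≤ q²/t + t.
  nlinarith [sq_nonneg (q - t)]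

/-- The size of the cutoff free resolvent on `L²`. -/
def decay (L : ℝ) (w : ℂ) : ℝ := ‖w‖ ^ (-(1 / 2) : ℝ) * Real.exp (L * max (-w.re) 0)

theorem decay_nonneg (L : ℝ) (w : ℂ) : 0 ≤ decay L w := by unfold decay; positivity

/-- Allows the term χρ, which does not depend on w, to be absorbed into the bound of order |w|²
times the decay. -/
theorem one_le_decay_mul {L : ℝ} (hL : 0 ≤ L) {w : ℂ} (hw : 1 ≤ ‖w‖) :
    1 ≤ decay L w * (1 + ‖w‖ ^ 2) := by
  have h1 : 1 ≤ Real.exp (L * max (-w.re) 0) := Real.one_le_exp (by positivity)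
  have h2 : ‖w‖ ^ (-1 : ℝ) ≤ ‖w‖ ^ (-(1 / 2) : ℝ) :=
    Real.rpow_le_rpow_of_exponent_le hw (by norm_num)
  rw [Real.rpow_neg_one] at h2
  have h0 : 0 < ‖w‖ := by linarith
  calc (1 : ℝ) ≤ (‖w‖⁻¹ * 1) * (‖w‖ * ‖w‖) := by field_simp; exact hw
    _ ≤ decay L w * (1 + ‖w‖ ^ 2) := by
      unfold decay
      gcongr
      nlinarith

variable {χ ρ : 𝓢(Plane, ℂ)}

theorem enorm_apply_le {T : L2 →L[ℂ] L2} {C : ℝ} (h : ‖T‖ ≤ C) (f : L2) :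
    ‖T f‖ₑ ≤ ENNReal.ofReal C * ‖f‖ₑ := by
  rw [← ofReal_norm, ← ofReal_norm, ← ENNReal.ofReal_mul ((norm_nonneg _).trans h)]
  exact ENNReal.ofReal_le_ofReal (T.le_of_opNorm_le h f)

theorem exists_norm_KOp_le_decay (hχ : HasCompactSupport χ) (hρ : HasCompactSupport ρ) {L : ℝ}
    (hL : ∀ x ∈ tsupport χ, ∀ y ∈ tsupport ρ, ‖x - y‖ ≤ L) :
    ∃ C : ℝ, 0 ≤ C ∧ ∀ w ∈ cone, ‖KOp χ ρ w‖ ≤ C * decay L w :=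
  exists_norm_KOp_le χ.continuous hχ ρ.continuous hρ fun x y hx hy =>
    hL x (subset_tsupport _ hx) y (subset_tsupport _ hy)

theorem exists_norm_source_le (hχ : HasCompactSupport χ) (hρ : HasCompactSupport ρ) {L : ℝ}
    (hL0 : 0 ≤ L) (hL : ∀ x ∈ tsupport χ, ∀ y ∈ tsupport ρ, ‖x - y‖ ≤ L) :
    ∃ C : ℝ, 0 ≤ C ∧ ∀ w ∈ cone, 1 ≤ ‖w‖ → ‖(1 - w ^ 2) • KOp χ ρ w +
      mulL2 χ χ.memLp_top ∘L mulL2 ρ ρ.memLp_top + KOp (Δ χ : 𝓢(Plane, ℂ)) ρ w‖ ≤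
        C * (decay L w * (1 + ‖w‖ ^ 2)) := by
  have hsupp : tsupport (Δ χ : 𝓢(Plane, ℂ)) ⊆ tsupport χ := by
    rw [laplacian_eq_sum_pderiv, Fin.sum_univ_two]
    refine (tsupport_add _ _).trans (Set.union_subset ?_ ?_) <;>
    exact (SchwartzMap.tsupport_lineDerivOp_subset _ _).trans
      (SchwartzMap.tsupport_lineDerivOp_subset _ _)
  obtain ⟨C₀, hC₀, h₀⟩ := exists_norm_KOp_le_decay hχ hρ hL
  obtain ⟨C₂, hC₂, h₂⟩ := exists_norm_KOp_le_decay (hasCompactSupport_laplacian hχ) hρ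
    fun x hx y hy => hL x (hsupp hx) y hy
  set M := ‖mulL2 χ χ.memLp_top ∘L mulL2 ρ ρ.memLp_top‖ with hM
  refine ⟨C₀ + M + C₂, by positivity, fun w hw hw1 => ?_⟩
  have hE := decay_nonneg L w
  have h1 := one_le_decay_mul hL0 hw1
  refine (norm_add₃_le).trans ?_
  rw [norm_smul, add_mul, add_mul]
  have h3 : ‖1 - w ^ 2‖ ≤ 1 + ‖w‖ ^ 2 := (norm_sub_le _ _).trans_eq (by simp)
  gcongr ?_ + ?_ + ?_
  · calc ‖1 - w ^ 2‖ * ‖KOp χ ρ w‖ ≤ (1 + ‖w‖ ^ 2) * (C₀ * decay L w) := by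
          gcongr; exact h₀ w hw
      _ = _ := by ring
  · exact le_mul_of_one_le_right (norm_nonneg _) h1
  · refine (h₂ w hw).trans ?_
    gcongr
    nlinarith [sq_nonneg ‖w‖]

theorem KOp_apply_eq (hχ : HasCompactSupport χ) (hρ : HasCompactSupport ρ) {w : ℂ}
    (hw : w ∈ cone) (f : L2) : KOp χ ρ w f = freeRes 1 (((1 - w ^ 2) • KOp χ ρ w +
        mulL2 χ χ.memLp_top ∘L mulL2 ρ ρ.memLp_top + KOp (Δ χ : 𝓢(Plane, ℂ)) ρ w) f) -
      (2 : ℂ) • ∑ j, fourierMul (derivSymbol j) (KOp (pderiv j χ) ρ w f) := by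
  conv_lhs => rw [KOp_eq hχ hρ hw]
  simp only [sub_apply, smul_apply, sum_apply, ContinuousLinearMap.comp_apply]

theorem sum_ofReal_mul_le {a b c D : ℝ} (ha : 0 ≤ a) (hb : 0 ≤ b) (hc : 0 ≤ c) (hD : 0 ≤ D)
    (f : L2) : ENNReal.ofReal (a * D) * ‖f‖ₑ + (2 * (ENNReal.ofReal (b * D) * ‖f‖ₑ) +
      2 * (ENNReal.ofReal (c * D) * ‖f‖ₑ)) = ENNReal.ofReal ((a + (2 * b + 2 * c)) * D) * ‖f‖ₑ := by
  generalize ‖f‖ₑ = F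
  have h2 : (2 : ℝ≥0∞) = ENNReal.ofReal 2 := by simp
  rw [h2, ← mul_assoc, ← mul_assoc, ← ENNReal.ofReal_mul zero_le_two,
    ← ENNReal.ofReal_mul zero_le_two, ← add_mul, ← add_mul,
    ← ENNReal.ofReal_add (by positivity) (by positivity),
    ← ENNReal.ofReal_add (by positivity) (by positivity)]
  congr 2
  ring

/-- A crude bound, with the H² power of |w|. It suffices as input to the H² estimate, while the
sharp H¹ bound comes later by interpolation. -/
theorem exists_sobolevENorm_one_KOp_le (hχ : HasCompactSupport χ) (hρ : HasCompactSupport ρ)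
    {L : ℝ} (hL0 : 0 ≤ L) (hL : ∀ x ∈ tsupport χ, ∀ y ∈ tsupport ρ, ‖x - y‖ ≤ L) :
    ∃ C : ℝ, 0 ≤ C ∧ ∀ w ∈ cone, 1 ≤ ‖w‖ → ∀ f, sobolevENorm 1 (KOp χ ρ w f) ≤
      ENNReal.ofReal (C * (decay L w * (1 + ‖w‖ ^ 2))) * ‖f‖ₑ := by
  have hsupp (j : Fin 2) : tsupport (pderiv j χ) ⊆ tsupport χ :=
    SchwartzMap.tsupport_lineDerivOp_subset _ _
  obtain ⟨C, hC, h⟩ := exists_norm_source_le hχ hρ hL0 hL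
  have hd (j : Fin 2) := exists_norm_KOp_le_decay (hasCompactSupport_pderiv hχ j) hρ
    fun x hx y hy => hL x (hsupp j hx) y hy
  choose c hc hcw using hd
  refine ⟨C + (2 * c 0 + 2 * c 1), by have := hc 0; have := hc 1; positivity,
    fun w hw hw1 f => ?_⟩
  have hE := decay_nonneg L w
  have hle (j : Fin 2) : ‖KOp (pderiv j χ) ρ w‖ ≤ c j * (decay L w * (1 + ‖w‖ ^ 2)) := by
    refine (hcw j w hw).trans (mul_le_mul_of_nonneg_left ?_ (hc j))
    nlinarith [sq_nonneg ‖w‖]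
  rw [KOp_apply_eq hχ hρ hw, ← sum_ofReal_mul_le hC (hc 0) (hc 1) (by positivity)]
  refine (sobolevENorm_one_le _ _).trans ?_
  gcongr
  · exact enorm_apply_le (h w hw hw1) f
  · exact enorm_apply_le (hle 0) f
  · exact enorm_apply_le (hle 1) f

theorem exists_sobolevENorm_two_KOp_le (hχ : HasCompactSupport χ) (hρ : HasCompactSupport ρ)
    {L : ℝ} (hL0 : 0 ≤ L) (hL : ∀ x ∈ tsupport χ, ∀ y ∈ tsupport ρ, ‖x - y‖ ≤ L) :
    ∃ C : ℝ, 0 ≤ C ∧ ∀ w ∈ cone, 1 ≤ ‖w‖ → ∀ f, sobolevENorm 2 (KOp χ ρ w f) ≤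
      ENNReal.ofReal (C * (decay L w * (1 + ‖w‖ ^ 2))) * ‖f‖ₑ := by
  have hsupp (j : Fin 2) : tsupport (pderiv j χ) ⊆ tsupport χ :=
    SchwartzMap.tsupport_lineDerivOp_subset _ _
  obtain ⟨C, hC, h⟩ := exists_norm_source_le hχ hρ hL0 hL
  have hd (j : Fin 2) := exists_sobolevENorm_one_KOp_le (hasCompactSupport_pderiv hχ j) hρ hL0
    fun x hx y hy => hL x (hsupp j hx) y hy
  choose c hc hcw using hd
  refine ⟨C + (2 * c 0 + 2 * c 1), by have := hc 0; have := hc 1; positivity,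
    fun w hw hw1 f => ?_⟩
  have hE := decay_nonneg L w
  rw [KOp_apply_eq hχ hρ hw, ← sum_ofReal_mul_le hC (hc 0) (hc 1) (by positivity)]
  refine (sobolevENorm_two_le _ _).trans ?_
  gcongr
  · exact enorm_apply_le (h w hw hw1) f
  · exact hcw 0 w hw hw1 f
  · exact hcw 1 w hw hw1 f

/-- The cutoff free resolvent as an operator from `L²` to `H^j`. -/
theorem exists_sobolevENorm_KOp_le (hχ : HasCompactSupport χ) (hρ : HasCompactSupport ρ)
    {L : ℝ} (hL0 : 0 ≤ L) (hL : ∀ x ∈ tsupport χ, ∀ y ∈ tsupport ρ, ‖x - y‖ ≤ L) :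
    ∃ C : ℝ, 0 ≤ C ∧ ∀ w ∈ cone, 1 ≤ ‖w‖ → ∀ j ∈ ({0, 1, 2} : Set ℕ), ∀ f,
      sobolevENorm j (KOp χ ρ w f) ≤
        ENNReal.ofReal (C * (decay L w * (1 + ‖w‖ ^ 2) ^ ((j : ℝ) / 2))) * ‖f‖ₑ := by
  obtain ⟨C₀, hC₀, h₀⟩ := exists_norm_KOp_le_decay hχ hρ hL
  obtain ⟨C₂, hC₂, h₂⟩ := exists_sobolevENorm_two_KOp_le hχ hρ hL0 hL
  refine ⟨C₂ + C₀, by positivity, fun w hw hw1 j hj f => ?_⟩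
  have hE := decay_nonneg L w
  have h0 := enorm_apply_le (h₀ w hw) f
  rcases hj with rfl | rfl | rfl
  · rw [Nat.cast_zero, sobolevENorm_zero, zero_div, Real.rpow_zero, mul_one]
    refine h0.trans ?_
    gcongr
    linarith
  · rw [Nat.cast_one]
    -- This interpolation parameter balances t⁻¹(1+|w|²) against t, so both contributions equal t
    -- times the decay.
    set t := (1 + ‖w‖ ^ 2) ^ ((1 : ℝ) / 2) with ht
    have htt : t * t = 1 + ‖w‖ ^ 2 := by
      rw [ht, ← Real.rpow_add (by positivity)]; norm_num
    have ht0 : 0 < t := by positivity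
    refine (sobolevENorm_one_le_two ht0 _).trans ((add_le_add (mul_le_mul_right (h₂ w hw hw1 f) _)
      (mul_le_mul_right h0 _)).trans_eq ?_)
    generalize ‖f‖ₑ = F
    rw [← mul_assoc, ← mul_assoc (ENNReal.ofReal t), ← ENNReal.ofReal_mul (by positivity),
      ← ENNReal.ofReal_mul (by positivity), ← add_mul,
      ← ENNReal.ofReal_add (by positivity) (by positivity), ← htt]
    congr 2
    field_simp
  · rw [Nat.cast_ofNat, div_self two_ne_zero, Real.rpow_one]
    refine (h₂ w hw hw1 f).trans ?_
    gcongr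
    linarith

end SobolevBounds

/-! ### Existence of the resolvent, and its relation to the cutoff free resolvent -/

section ResolventAlgebra

variable {V : Plane → ℂ} {hV : MemLp V ∞ (volume : Measure Plane)} {ρ : Plane → ℂ}
  {hρ : MemLp ρ ∞ (volume : Measure Plane)}

theorem mulL2_comp_cutoff (h : ∀ x, V x * ρ x = V x) :
    mulL2 V hV ∘L mulL2 ρ hρ = mulL2 V hV := by
  ext1 u
  refine Lp.ext ?_
  filter_upwards [coeFn_mulL2 V hV (mulL2 ρ hρ u), coeFn_mulL2 ρ hρ u, coeFn_mulL2 V hV u]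
    with x h1 h2 h3
  rw [ContinuousLinearMap.comp_apply, h1, h2, h3, ← mul_assoc, h]

theorem cutoff_comp_mulL2 (h : ∀ x, V x * ρ x = V x) :
    mulL2 ρ hρ ∘L mulL2 V hV = mulL2 V hV := by
  ext1 u
  refine Lp.ext ?_
  filter_upwards [coeFn_mulL2 ρ hρ (mulL2 V hV u), coeFn_mulL2 V hV u] with x h1 h2
  rw [ContinuousLinearMap.comp_apply, h1, h2, ← mul_assoc, mul_comm (ρ x), h]

theorem isResolvent_iff {l : ℂ} (hl : 0 < l.im) (T : L2 →L[ℂ] L2) :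
    IsResolvent V hV l T ↔ ∀ u f : L2,
      freeRes (-Complex.I * l) (f - mulL2 V hV u) = u ↔ T f = u :=
  forall₂_congr fun u f => by rw [solvesSchrodinger_iff hV hl]

theorem IsResolvent.apply_add_left {l : ℂ} (hl : 0 < l.im) {T : L2 →L[ℂ] L2}
    (hT : IsResolvent V hV l T) (f : L2) :
    T f + freeRes (-Complex.I * l) (mulL2 V hV (T f)) = freeRes (-Complex.I * l) f := by
  have h := ((isResolvent_iff hl T).1 hT (T f) f).2 rfl
  rw [map_sub] at h
  rw [eq_comm, ← sub_eq_iff_eq_add, h]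

theorem IsResolvent.apply_add_right {l : ℂ} (hl : 0 < l.im) {T : L2 →L[ℂ] L2}
    (hT : IsResolvent V hV l T) (f : L2) :
    T f + T (mulL2 V hV (freeRes (-Complex.I * l) f)) = freeRes (-Complex.I * l) f := by
  rw [← map_add]
  refine ((isResolvent_iff hl T).1 hT _ _).1 ?_
  rw [add_sub_cancel_right]

/-- Since ‖R₀(λ)‖ ≤ (Im λ)⁻², a Neumann series inverts 1 + V R₀ once Im λ ≥ ‖V‖ + 1, and the
resolvent is R₀(1 + V R₀)⁻¹. -/
theorem exists_isResolvent (V : Plane → ℂ) (hV : MemLp V ∞ (volume : Measure Plane)) :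
    ∃ A : ℝ, 0 < A ∧ ∀ l : ℂ, A ≤ l.im → ∃ T, IsResolvent V hV l T := by
  refine ⟨‖mulL2 V hV‖ + 1, by positivity, fun l hl => ?_⟩
  have hl0 : 0 < l.im := by linarith [norm_nonneg (mulL2 V hV)]
  have hw : (-Complex.I * l).re = l.im := by simp
  set R := freeRes (-Complex.I * l) with hR
  have hRn : ‖R‖ ≤ (l.im ^ 2)⁻¹ := by
    have := norm_freeRes_le (w := -Complex.I * l) (by rwa [hw])
    rwa [hw] at this
  have hu : IsUnit (1 + mulL2 V hV ∘L R) := by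
    refine isUnit_one_add_of_norm_lt ?_
    calc ‖mulL2 V hV ∘L R‖ ≤ ‖mulL2 V hV‖ * ‖R‖ := ContinuousLinearMap.opNorm_comp_le _ _
      _ ≤ ‖mulL2 V hV‖ * (l.im ^ 2)⁻¹ := by gcongr
      _ < 1 := by
        rw [← div_eq_mul_inv, div_lt_one (by positivity)]
        nlinarith [norm_nonneg (mulL2 V hV)]
  set N := Ring.inverse (1 + mulL2 V hV ∘L R) with hN
  have h1 (f : L2) : N f + mulL2 V hV (R (N f)) = f := by
    simpa using DFunLike.congr_fun (Ring.mul_inverse_cancel _ hu) f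
  have h2 (f : L2) : N (f + mulL2 V hV (R f)) = f := by
    simpa using DFunLike.congr_fun (Ring.inverse_mul_cancel _ hu) f
  refine ⟨R ∘L N, (isResolvent_iff hl0 _).2 fun u f => ⟨fun h => ?_, fun h => ?_⟩⟩
  · have h3 := h2 (f - mulL2 V hV u)
    rw [← hR] at h
    rw [h, sub_add_cancel] at h3
    rw [ContinuousLinearMap.comp_apply, h3, h]
  · rw [ContinuousLinearMap.comp_apply] at h
    rw [← hR, ← h]
    congr 1
    rw [sub_eq_iff_eq_add]
    exact (h1 f).symm

/-- If `T = (P + V)⁻¹`, then `1 + V ρ P⁻¹ ρ` is invertible and `ρ T ρ` is expressed through the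
cutoff free resolvent. -/
theorem IsResolvent.cutoff {l : ℂ} (hl : 0 < l.im) {T : L2 →L[ℂ] L2} (hT : IsResolvent V hV l T)
    (h : ∀ x, V x * ρ x = V x) {K : L2 →L[ℂ] L2}
    (hK : mulL2 ρ hρ ∘L freeRes (-Complex.I * l) ∘L mulL2 ρ hρ = K) :
    IsUnit (1 + mulL2 V hV ∘L K) ∧
      K ∘L Ring.inverse (1 + mulL2 V hV ∘L K) = mulL2 ρ hρ ∘L T ∘L mulL2 ρ hρ := by
  subst hK
  set R := freeRes (-Complex.I * l) with hR
  set M := mulL2 ρ hρ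
  set Q := mulL2 V hV
  have hQM (u : L2) : Q (M u) = Q u := DFunLike.congr_fun (mulL2_comp_cutoff h) u
  have hMQ (u : L2) : M (Q u) = Q u := DFunLike.congr_fun (cutoff_comp_mulL2 h) u
  have hl' (u : L2) : T u + R (Q (T u)) = R u := hT.apply_add_left hl u
  have hr' (u : L2) : T u + T (Q (R u)) = R u := hT.apply_add_right hl u
  -- The inverse of 1 + VρR₀ρ is 1 - VTρ. The two products reduce to the left and right resolvent
  -- identities after deleting ρ next to V.
  have e1 : (1 + Q ∘L M ∘L R ∘L M) * (1 - Q ∘L T ∘L M) = 1 := by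
    ext1 u
    change (u - Q (T (M u))) + Q (M (R (M (u - Q (T (M u)))))) = u
    rw [hQM, map_sub M, hMQ, map_sub R, ← hl' (M u), add_sub_cancel_right, sub_add_cancel]
  have e2 : (1 - Q ∘L T ∘L M) * (1 + Q ∘L M ∘L R ∘L M) = 1 := by
    ext1 u
    change (u + Q (M (R (M u)))) - Q (T (M (u + Q (M (R (M u)))))) = u
    rw [hQM, map_add M, hMQ, map_add T, hr' (M u), add_sub_cancel_right]
  refine ⟨⟨⟨_, _, e1, e2⟩, rfl⟩, ?_⟩
  have hinv : Ring.inverse (1 + Q ∘L M ∘L R ∘L M) = 1 - Q ∘L T ∘L M :=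
    Ring.inverse_unit ⟨_, _, e1, e2⟩
  rw [hinv]
  ext1 u
  change M (R (M (u - Q (T (M u))))) = M (T (M u))
  rw [map_sub M, hMQ, map_sub R, ← hl' (M u), add_sub_cancel_right]

end ResolventAlgebra

/-! ### Meromorphic continuation of the cutoff resolvent -/

section Continuation

/-- A neighbourhood of the double sector and of the upper half plane. -/
def spectralCone : Set ℂ := {l | -Complex.I * l ∈ cone}

theorem mem_spectralCone {l : ℂ} : l ∈ spectralCone ↔ -(4 / 5 * ‖l‖) < l.im := by
  simp [spectralCone, cone]

theorem isOpen_spectralCone : IsOpen spectralCone :=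
  isOpen_cone.preimage (by fun_prop)

theorem isPreconnected_spectralCone : IsPreconnected spectralCone := by
  have h1 : IsPreconnected cone := ((starConvex_cone one_pos).isPathConnected
    (mem_cone_of_re_pos (by simp))).isConnected.isPreconnected
  have h2 : spectralCone = (fun w => Complex.I * w) '' cone := by
    ext l
    refine ⟨fun h => ⟨_, h, by linear_combination (-l) * Complex.I_sq⟩, ?_⟩
    rintro ⟨w, hw, rfl⟩
    change -Complex.I * (Complex.I * w) ∈ cone
    rwa [← mul_assoc, neg_mul, Complex.I_mul_I, neg_neg, one_mul]
  rw [h2]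
  exact h1.image _ (by fun_prop)

theorem mem_spectralCone_of_im_pos {l : ℂ} (h : 0 < l.im) : l ∈ spectralCone :=
  mem_spectralCone.2 ((neg_nonpos.2 (by positivity)).trans_lt h)

/-- In the double sector |Im λ| ≤ |λ|/√2, and 1/√2 < 4/5. -/
theorem sector_subset_spectralCone : sector ⊆ spectralCone := by
  rintro l ⟨h0, h⟩
  rw [mem_spectralCone]
  have hn := norm_pos_iff.2 h0
  have h1 : ‖l‖ ^ 2 = l.re ^ 2 + l.im ^ 2 := by
    rw [Complex.sq_norm, Complex.normSq_apply]; ring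
  have h2 : l.im ^ 2 ≤ l.re ^ 2 := sq_le_sq.2 h
  have h3 : |l.im| < 4 / 5 * ‖l‖ := by
    refine abs_lt_of_sq_lt_sq ?_ (by positivity)
    nlinarith
  exact (abs_lt.1 h3).1

variable (V : Plane → ℂ) (hV : MemLp V ∞ (volume : Measure Plane)) (ρ : Plane → ℂ)

/-- The continuation of the cutoff free resolvent in the spectral parameter. -/
def cutoffFreeRes (l : ℂ) : L2 →L[ℂ] L2 := KOp ρ ρ (-Complex.I * l)

/-- The compact operator `V ρ R₀(l) ρ`. -/
def perturbation (l : ℂ) : L2 →L[ℂ] L2 := mulL2 V hV ∘L cutoffFreeRes ρ l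

/-- The continuation of the cutoff resolvent, where `1 + V ρ R₀ ρ` is invertible. -/
def cutoffResAux (l : ℂ) : L2 →L[ℂ] L2 :=
  cutoffFreeRes ρ l ∘L Ring.inverse (1 + perturbation V hV ρ l)

/-- The continuation of the cutoff resolvent, with removable singularities removed. -/
def cutoffRes : ℂ → L2 →L[ℂ] L2 := toMeromorphicNFOn (cutoffResAux V hV ρ) spectralCone

variable {V hV ρ}

theorem analyticOnNhd_cutoffFreeRes (hρ : Continuous ρ) (hρc : HasCompactSupport ρ) :
    AnalyticOnNhd ℂ (cutoffFreeRes ρ) spectralCone := fun _ hl =>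
  (analyticOnNhd_KOp hρ hρc hρ hρc _ hl).comp (f := fun l : ℂ => -Complex.I * l)
    (analyticAt_const.mul analyticAt_id)

theorem analyticOnNhd_perturbation (hρ : Continuous ρ) (hρc : HasCompactSupport ρ) :
    AnalyticOnNhd ℂ (perturbation V hV ρ) spectralCone := fun _ hl =>
  analyticAt_clm_comp analyticAt_const (analyticOnNhd_cutoffFreeRes hρ hρc _ hl)

theorem perturbation_mem_finiteRankClosure (l : ℂ) :
    perturbation V hV ρ l ∈ finiteRankClosure L2 :=
  comp_mem_finiteRankClosure _ (KOp_mem_finiteRankClosure _)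

theorem analyticAt_cutoffResAux (hρ : Continuous ρ) (hρc : HasCompactSupport ρ) {l : ℂ}
    (hl : l ∈ spectralCone) (hu : IsUnit (1 + perturbation V hV ρ l)) :
    AnalyticAt ℂ (cutoffResAux V hV ρ) l := by
  have h1 : AnalyticAt ℂ (fun z => 1 + perturbation V hV ρ z) l :=
    analyticAt_const.add (analyticOnNhd_perturbation hρ hρc l hl)
  exact analyticAt_clm_comp (analyticOnNhd_cutoffFreeRes hρ hρc l hl)
    (analyticAt_inverse_comp h1 hu)

/-- The local Fredholm form makes the singular part of the inverse factor through ℂⁿ, and composing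
with the analytic cutoff free resolvent keeps that form. -/
theorem exists_cutoffResAux_eq (hρ : Continuous ρ) (hρc : HasCompactSupport ρ) {l₀ : ℂ}
    (hl : l₀ ∈ spectralCone) (hu : ∀ᶠ l in 𝓝[≠] l₀, IsUnit (1 + perturbation V hV ρ l)) :
    ∃ (N : ℕ) (A : ℕ → L2 →L[ℂ] L2) (G : ℂ → L2 →L[ℂ] L2),
      (∀ k, FiniteDimensional ℂ (A k).range) ∧ AnalyticAt ℂ G l₀ ∧
      ∀ᶠ l in 𝓝[≠] l₀, cutoffResAux V hV ρ l =
        ∑ k ∈ Finset.range N, ((l - l₀) ^ (k + 1))⁻¹ • A k + G l := by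
  obtain ⟨n, d, W, Φ, Ψ, hd, hW, hΦ, hΨ, h⟩ := exists_fredholm_local
    (analyticOnNhd_perturbation (V := V) (hV := hV) hρ hρc l₀ hl)
    (perturbation_mem_finiteRankClosure l₀)
  have hK := analyticOnNhd_cutoffFreeRes hρ hρc l₀ hl
  have h' := eventually_nhdsWithin_of_eventually_nhds (s := {l₀}ᶜ) h
  obtain ⟨N, A, G, hA, hG, e⟩ := exists_principal_part
    (Φ := fun l => -(cutoffFreeRes ρ l ∘L Φ l)) (analyticAt_clm_comp hK hΦ).neg hΨ hd
    (by filter_upwards [h', hu] with l h1 h2 using h1.1.1 h2)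
  refine ⟨N, A, fun l => G l + cutoffFreeRes ρ l ∘L W l, hA,
    hG.add (analyticAt_clm_comp hK hW), ?_⟩
  filter_upwards [h', hu, e] with l h1 h2 h3
  rw [← add_assoc, ← h3, cutoffResAux, h1.2 (h1.1.1 h2)]
  ext1 u
  simp [sub_eq_neg_add]

theorem meromorphicAt_cutoffResAux (hρ : Continuous ρ) (hρc : HasCompactSupport ρ) {l₀ : ℂ}
    (hl : l₀ ∈ spectralCone) (hu : ∀ᶠ l in 𝓝[≠] l₀, IsUnit (1 + perturbation V hV ρ l)) :
    MeromorphicAt (cutoffResAux V hV ρ) l₀ := by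
  obtain ⟨N, A, G, -, hG, e⟩ := exists_cutoffResAux_eq hρ hρc hl hu
  refine MeromorphicAt.congr (f := fun l => ∑ k ∈ Finset.range N, ((l - l₀) ^ (k + 1))⁻¹ • A k + G l)
    ?_ (e.mono fun l h => h.symm)
  refine MeromorphicAt.fun_add (MeromorphicAt.fun_sum fun k _ => ?_) hG.meromorphicAt
  exact (((MeromorphicAt.id l₀).fun_sub (MeromorphicAt.const l₀ l₀)).fun_pow _).fun_inv.fun_smul
    (MeromorphicAt.const _ _)

theorem cutoffRes_eventuallyEq (hm : MeromorphicOn (cutoffResAux V hV ρ) spectralCone)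
    (hρ : Continuous ρ) (hρc : HasCompactSupport ρ) {l : ℂ}
    (hl : l ∈ spectralCone) (hu : IsUnit (1 + perturbation V hV ρ l)) :
    cutoffRes V hV ρ =ᶠ[𝓝 l] cutoffResAux V hV ρ := by
  have h := toMeromorphicNFOn_eq_toMeromorphicNFAt_on_nhds hm hl
  rwa [toMeromorphicNFAt_eq_self.2 (analyticAt_cutoffResAux hρ hρc hl hu).meromorphicNFAt] at h

theorem not_isPole_of_isUnit (hm : MeromorphicOn (cutoffResAux V hV ρ) spectralCone)
    (hρ : Continuous ρ) (hρc : HasCompactSupport ρ) {l : ℂ}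
    (hl : l ∈ spectralCone) (hu : IsUnit (1 + perturbation V hV ρ l)) :
    ¬ IsPole (cutoffRes V hV ρ) l :=
  not_lt.2 ((analyticAt_cutoffResAux hρ hρc hl hu).congr
    (cutoffRes_eventuallyEq hm hρ hρc hl hu).symm).meromorphicOrderAt_nonneg

end Continuation

/-! ### Finiteness of the poles in a disc -/

section Poles

variable {V : Plane → ℂ} {hV : MemLp V ∞ (volume : Measure Plane)} {ρ : Plane → ℂ}

/-- The Fredholm alternative does not apply at 0, which lies outside the cone. The logarithmic
dichotomy replaces it and excludes an accumulation of noninvertible points there. -/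
theorem eventually_isUnit_nhdsNE_zero (hρ : Continuous ρ) (hρc : HasCompactSupport ρ)
    (hu : ∀ z ∈ spectralCone, ∀ᶠ l in 𝓝[≠] z, IsUnit (1 + perturbation V hV ρ l)) :
    ∀ᶠ l in 𝓝[≠] (0 : ℂ), l ∈ spectralCone → IsUnit (1 + perturbation V hV ρ l) := by
  obtain ⟨A, B, hA, hB, hA0, hB0, e⟩ := exists_KOp_eq_log hρ hρc hρ hρc
  have hev : ∀ᶠ w in 𝓝[≠] (0 : ℂ), w ∈ cone → mulL2 V hV ∘L KOp ρ ρ w =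
      Complex.log w • (mulL2 V hV ∘L A w) + mulL2 V hV ∘L B w := by
    filter_upwards [e.filter_mono nhdsWithin_le_nhds] with w hw hwc
    rw [hw hwc, ContinuousLinearMap.comp_add, ContinuousLinearMap.comp_smul]
  rcases eventually_isUnit_or_eventually_not_log
    (A := fun w : ℂ => mulL2 V hV ∘L A w) (B := fun w : ℂ => mulL2 V hV ∘L B w)
    (analyticAt_clm_comp analyticAt_const hA) (analyticAt_clm_comp analyticAt_const hB)
    (finiteDimensional_range_comp_left _ _ hA0) (comp_mem_finiteRankClosure _ hB0) with h | h
  · exfalso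
    have h1 : ∀ᶠ w in 𝓝[≠] (0 : ℂ), w ∈ cone → ¬ IsUnit (1 + mulL2 V hV ∘L KOp ρ ρ w) := by
      filter_upwards [hev, h] with w h1 h2 h3
      rwa [h1 h3]
    rw [eventually_nhdsWithin_iff, Metric.eventually_nhds_iff] at h1
    obtain ⟨ε, hε, h1⟩ := h1
    -- A point of the cone inside the disc where invertibility would fail throughout. Near it,
    -- however, invertibility holds on a punctured neighbourhood.
    set z : ℂ := Complex.I * (ε / 2 : ℝ) with hz
    have hzc : z ∈ spectralCone := mem_spectralCone_of_im_pos (by simp [hz, hε])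
    have hz0 : z ≠ 0 := by simp [hz, hε.ne']
    have hball : Metric.ball (0 : ℂ) ε ∈ 𝓝 z := Metric.isOpen_ball.mem_nhds (by
      simp only [hz, Metric.mem_ball, dist_zero_right, norm_mul, Complex.norm_I, one_mul,
        Complex.norm_real, Real.norm_eq_abs]
      rw [abs_of_pos (by positivity)]; linarith)
    obtain ⟨l, h2, h3, h4, h5⟩ := ((hu z hzc).and
      ((eventually_nhdsWithin_of_eventually_nhds hball).and
      ((eventually_nhdsWithin_of_eventually_nhds (isOpen_spectralCone.mem_nhds hzc)).and
        (eventually_nhdsWithin_of_eventually_nhds (isOpen_ne.mem_nhds hz0))))).exists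
    refine h1 (y := -Complex.I * l) ?_ (by simpa using h5) h4 h2
    simpa using h3
  · have h1 : ∀ᶠ w in 𝓝[≠] (0 : ℂ), w ∈ cone → IsUnit (1 + mulL2 V hV ∘L KOp ρ ρ w) := by
      filter_upwards [hev, h] with w h1 h2 h3
      rwa [h1 h3]
    have ht : Tendsto (fun l : ℂ => -Complex.I * l) (𝓝[≠] 0) (𝓝[≠] 0) := by
      refine tendsto_nhdsWithin_iff.2 ⟨?_, ?_⟩
      · have : Continuous fun l : ℂ => -Complex.I * l := by fun_prop
        simpa using (this.tendsto 0).mono_left nhdsWithin_le_nhds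
      · filter_upwards [self_mem_nhdsWithin] with l hl
        simpa using hl
    exact ht.eventually h1

/-- Infinitely many poles would accumulate at a point of the closed disc. That point is 0 or, by
closedness of |Im λ| ≤ |Re λ|, lies in the double sector, and both cases are excluded. -/
theorem finite_isPole (hm : MeromorphicOn (cutoffResAux V hV ρ) spectralCone)
    (hρ : Continuous ρ) (hρc : HasCompactSupport ρ)
    (hu : ∀ z ∈ spectralCone, ∀ᶠ l in 𝓝[≠] z, IsUnit (1 + perturbation V hV ρ l)) (C₀ : ℝ) :
    {l ∈ Metric.closedBall 0 C₀ ∩ sector | IsPole (cutoffRes V hV ρ) l}.Finite := by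
  by_contra hinf
  obtain ⟨z, -, hz⟩ := Set.Infinite.exists_accPt_of_subset_isCompact hinf
    (isCompact_closedBall (0 : ℂ) C₀) fun l hl => hl.1.1
  rw [accPt_iff_frequently_nhdsNE] at hz
  have hev : ∀ᶠ l in 𝓝[≠] z, l ∈ spectralCone → IsUnit (1 + perturbation V hV ρ l) := by
    by_cases h0 : z = 0
    · rw [h0]; exact eventually_isUnit_nhdsNE_zero hρ hρc hu
    · have hc : IsClosed {l : ℂ | |l.im| ≤ |l.re|} := isClosed_le (by fun_prop) (by fun_prop)
      have hz' : z ∈ {l : ℂ | |l.im| ≤ |l.re|} :=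
        hc.mem_of_frequently_of_tendsto (hz.mono fun l hl => hl.1.2.2)
          (tendsto_id.mono_left nhdsWithin_le_nhds)
      exact (hu z (sector_subset_spectralCone ⟨h0, hz'⟩)).mono fun l h _ => h
  obtain ⟨l, hl, h⟩ := (hz.and_eventually hev).exists
  have hlc := sector_subset_spectralCone hl.1.2
  exact not_isPole_of_isUnit hm hρ hρc hlc (h hlc) hl.2

end Poles

/-! ### Smallness of the perturbation and bounds at high energy -/

section OuterBounds

/-- Since Lδ < 1/4, the exponential is at most (1+|λ|)^(1/4) ≤ 2|λ|^(1/4), which loses only half of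
the decay |λ|^(-1/2). -/
theorem decay_le_of_mem_outerRegion {L δ C₀ : ℝ} (hL : 0 < L) (hδ : δ < 1 / (4 * L)) {l : ℂ}
    (hl : l ∈ outerRegion δ C₀) (hδ0 : 0 < δ) (h1 : 1 ≤ ‖l‖) :
    decay L (-Complex.I * l) ≤ 2 * ‖l‖ ^ (-(1 / 4) : ℝ) := by
  have hn : ‖-Complex.I * l‖ = ‖l‖ := by simp
  have hre : (-Complex.I * l).re = l.im := by simp
  rw [decay, hn, hre]
  have hlog : 0 ≤ Real.log (1 + ‖l‖) := Real.log_nonneg (by linarith)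
  have hm : max (-l.im) 0 ≤ δ * Real.log (1 + ‖l‖) :=
    max_le (by linarith [hl.1]) (by positivity)
  have hLδ : L * δ ≤ 1 / 4 := by
    rw [lt_div_iff₀ (by positivity)] at hδ; linarith
  have he : Real.exp (L * max (-l.im) 0) ≤ 2 * ‖l‖ ^ (1 / 4 : ℝ) := by
    calc Real.exp (L * max (-l.im) 0) ≤ Real.exp (Real.log (1 + ‖l‖) * (1 / 4)) := by
          refine Real.exp_le_exp.2 ?_
          calc L * max (-l.im) 0 ≤ L * (δ * Real.log (1 + ‖l‖)) := by gcongr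
            _ = Real.log (1 + ‖l‖) * (L * δ) := by ring
            _ ≤ _ := by gcongr
      _ = (1 + ‖l‖) ^ (1 / 4 : ℝ) := by rw [Real.rpow_def_of_pos (by positivity)]
      _ ≤ (2 * ‖l‖) ^ (1 / 4 : ℝ) := by gcongr; linarith
      _ = 2 ^ (1 / 4 : ℝ) * ‖l‖ ^ (1 / 4 : ℝ) := Real.mul_rpow (by norm_num) (by positivity)
      _ ≤ 2 ^ (1 : ℝ) * ‖l‖ ^ (1 / 4 : ℝ) := by gcongr <;> norm_num
      _ = _ := by rw [Real.rpow_one]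
  calc ‖l‖ ^ (-(1 / 2) : ℝ) * Real.exp (L * max (-l.im) 0)
      ≤ ‖l‖ ^ (-(1 / 2) : ℝ) * (2 * ‖l‖ ^ (1 / 4 : ℝ)) := by gcongr
    _ = 2 * (‖l‖ ^ (-(1 / 2) : ℝ) * ‖l‖ ^ (1 / 4 : ℝ)) := by ring
    _ = _ := by rw [← Real.rpow_add (by linarith)]; norm_num

variable {V : Plane → ℂ} {hV : MemLp V ∞ (volume : Measure Plane)} {ρ : 𝓢(Plane, ℂ)}

theorem exists_norm_perturbation_le (hρ : HasCompactSupport ρ) {L δ : ℝ} (hL : 0 < L)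
    (hδ0 : 0 < δ) (hδ : δ < 1 / (4 * L))
    (hρL : ∀ x ∈ tsupport ρ, ∀ y ∈ tsupport ρ, ‖x - y‖ ≤ L) :
    ∃ C₀ : ℝ, 1 ≤ C₀ ∧ ∀ l ∈ spectralCone ∩ outerRegion δ C₀,
      ‖perturbation V hV ρ l‖ ≤ 1 / 2 := by
  obtain ⟨C, hC, h⟩ := exists_norm_KOp_le_decay hρ hρ hρL
  have ht : Tendsto (fun x : ℝ => ‖mulL2 V hV‖ * C * 2 * x ^ (-(1 / 4) : ℝ)) atTop (𝓝 0) := by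
    simpa using (tendsto_rpow_neg_atTop (y := 1 / 4) (by norm_num)).const_mul
      (‖mulL2 V hV‖ * C * 2)
  -- The radius beyond which the bound 2C‖V‖|λ|^(-1/4) is at most 1/2.
  obtain ⟨R, hR⟩ := eventually_atTop.1 (ht.eventually (eventually_le_nhds (b := 1 / 2) (by norm_num)))
  refine ⟨max R 1, le_max_right _ _, fun l hl => ?_⟩
  have hl1 : 1 ≤ ‖l‖ := (le_max_right _ _).trans hl.2.2
  calc ‖perturbation V hV ρ l‖ ≤ ‖mulL2 V hV‖ * ‖cutoffFreeRes ρ l‖ :=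
        ContinuousLinearMap.opNorm_comp_le _ _
    _ ≤ ‖mulL2 V hV‖ * (C * (2 * ‖l‖ ^ (-(1 / 4) : ℝ))) := by
        gcongr
        refine (h _ hl.1).trans ?_
        gcongr
        exact decay_le_of_mem_outerRegion hL hδ hl.2 hδ0 hl1
    _ = ‖mulL2 V hV‖ * C * 2 * ‖l‖ ^ (-(1 / 4) : ℝ) := by ring
    _ ≤ 1 / 2 := hR _ ((le_max_left _ _).trans hl.2.2)

theorem norm_inverse_one_add_le {S : L2 →L[ℂ] L2} (hS : ‖S‖ ≤ 1 / 2) :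
    ‖Ring.inverse (1 + S)‖ ≤ 2 := by
  have hu := isUnit_one_add_of_norm_lt (hS.trans_lt (by norm_num))
  refine ContinuousLinearMap.opNorm_le_bound _ zero_le_two fun f => ?_
  have h1 : Ring.inverse (1 + S) f + S (Ring.inverse (1 + S) f) = f := by
    simpa using DFunLike.congr_fun (Ring.mul_inverse_cancel _ hu) f
  set g := Ring.inverse (1 + S) f
  have h2 : ‖S g‖ ≤ 1 / 2 * ‖g‖ := S.le_of_opNorm_le hS g
  have h3 : ‖g‖ ≤ ‖f‖ + ‖S g‖ := by
    calc ‖g‖ = ‖f - S g‖ := by rw [← h1, add_sub_cancel_right]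
      _ ≤ _ := norm_sub_le _ _
  linarith

theorem exists_sobolevENorm_cutoffResAux_le (hρ : HasCompactSupport ρ) {L : ℝ} (hL : 0 ≤ L)
    (hρL : ∀ x ∈ tsupport ρ, ∀ y ∈ tsupport ρ, ‖x - y‖ ≤ L) :
    ∃ C : ℝ, 0 < C ∧ ∀ l ∈ spectralCone, 1 ≤ ‖l‖ → ‖perturbation V hV ρ l‖ ≤ 1 / 2 →
      ∀ j ∈ ({0, 1, 2} : Set ℕ), ∀ f, sobolevENorm j (cutoffResAux V hV ρ l f) ≤
        ENNReal.ofReal (C * ‖l‖ ^ (-(1 / 2) : ℝ) * (1 + ‖l‖ ^ 2) ^ ((j : ℝ) / 2) *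
          Real.exp (L * max (-l.im) 0)) * ‖f‖ₑ := by
  obtain ⟨C, hC, h⟩ := exists_sobolevENorm_KOp_le hρ hρ hL hρL
  -- The factor 2 bounds the inverse of 1 + V K, and the added 1 only makes the constant positive.
  refine ⟨C * 2 + 1, by positivity, fun l hl hl1 hS j hj f => ?_⟩
  have hn : ‖-Complex.I * l‖ = ‖l‖ := by simp
  have hre : (-Complex.I * l).re = l.im := by simp
  have h1 := h _ hl (by rwa [hn]) j hj (Ring.inverse (1 + perturbation V hV ρ l) f)
  rw [decay, hn, hre] at h1
  set E := Real.exp (L * max (-l.im) 0)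
  have hE : 0 < E := Real.exp_pos _
  refine h1.trans ?_
  calc _ ≤ ENNReal.ofReal (C * (‖l‖ ^ (-(1 / 2) : ℝ) * E * (1 + ‖l‖ ^ 2) ^ ((j : ℝ) / 2))) *
        (ENNReal.ofReal 2 * ‖f‖ₑ) := by
        gcongr
        exact enorm_apply_le (norm_inverse_one_add_le hS) f
    _ = ENNReal.ofReal (C * (‖l‖ ^ (-(1 / 2) : ℝ) * E * (1 + ‖l‖ ^ 2) ^ ((j : ℝ) / 2)) * 2) *
        ‖f‖ₑ := by rw [← mul_assoc, ← ENNReal.ofReal_mul (by positivity)]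
    _ ≤ _ := by
        refine mul_le_mul_left (ENNReal.ofReal_le_ofReal ?_) _
        have : 0 ≤ ‖l‖ ^ (-(1 / 2) : ℝ) * E * (1 + ‖l‖ ^ 2) ^ ((j : ℝ) / 2) := by positivity
        nlinarith

end OuterBounds

/-! ### Assembly of the continuation -/

section Main

variable {V : Plane → ℂ} {hV : MemLp V ∞ (volume : Measure Plane)} {ρ : Plane → ℂ}

/-- The resolvent exists at a point iA high on the imaginary axis, so 1 + V K is invertible there.
The Fredholm alternative on the connected cone spreads this outside a discrete set. -/
theorem eventually_isUnit_perturbation (hρ : ContDiff ℝ ∞ ρ) (hρc : HasCompactSupport ρ)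
    (h : ∀ x, V x * ρ x = V x) :
    ∀ z ∈ spectralCone, ∀ᶠ l in 𝓝[≠] z, IsUnit (1 + perturbation V hV ρ l) := by
  obtain ⟨A, hA0, hA⟩ := exists_isResolvent V hV
  obtain ⟨T, hT⟩ := hA (Complex.I * A) (by simp)
  have him : 0 < (Complex.I * A).im := by simpa
  exact eventually_isUnit_of_preconnected isOpen_spectralCone isPreconnected_spectralCone
    (analyticOnNhd_perturbation hρ.continuous hρc) (fun l _ => perturbation_mem_finiteRankClosure l)
    (mem_spectralCone_of_im_pos him) (hT.cutoff him h
      (cutoff_freeRes (χ := hρc.toSchwartzMap hρ) (ρ := hρc.toSchwartzMap hρ) hρc hρc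
        (by simpa using him))).1

theorem isCutoffResolvent_cutoffRes (hρ : ContDiff ℝ ∞ ρ) (hρc : HasCompactSupport ρ)
    (h : ∀ x, V x * ρ x = V x) (hm : MeromorphicOn (cutoffResAux V hV ρ) spectralCone) :
    IsCutoffResolvent V hV ρ (memLp_top_of_testFunction hρ hρc) (cutoffRes V hV ρ) where
  exists_resolvent := (exists_isResolvent V hV).imp fun A hA => hA.2
  eq_resolvent l hl T hT := by
    have hlc := mem_spectralCone_of_im_pos hl
    obtain ⟨hu, he⟩ := hT.cutoff hl h
      (cutoff_freeRes (χ := hρc.toSchwartzMap hρ) (ρ := hρc.toSchwartzMap hρ) hρc hρc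
        (w := -Complex.I * l) (by simpa using hl))
    rw [(cutoffRes_eventuallyEq hm hρ.continuous hρc hlc hu).self_of_nhds]
    exact he
  meromorphic l₀ hl₀ := by
    have hlc := sector_subset_spectralCone hl₀
    obtain ⟨N, A, G, hA, hG, e⟩ := exists_cutoffResAux_eq hρ.continuous hρc hlc
      (eventually_isUnit_perturbation (hV := hV) hρ hρc h l₀ hlc)
    refine ⟨N, A, G, hA, hG, ?_⟩
    filter_upwards [e, hm.toMeromorphicNFOn_eq_self_on_nhdsNE hlc] with l h1 h2
    rw [← h1]
    exact h2
  analyticAt_of_not_isPole l hl hp :=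
    (meromorphicNFOn_toMeromorphicNFOn _ _ (sector_subset_spectralCone hl)
      ).meromorphicOrderAt_nonneg_iff_analyticAt.1 (not_lt.1 hp)

end Main

end Scattering2D

end

theorem theorem2p5 (V : Scattering2D.Plane → ℂ)
    (hV : MemLp V ∞ (volume : Measure Scattering2D.Plane)) (hVc : HasCompactSupport V)
    (ρ : Scattering2D.Plane → ℂ) (hρ : ContDiff ℝ ∞ ρ) (hρc : HasCompactSupport ρ)
    (hρV : ∀ x ∈ tsupport V, ρ x = 1) :
    ∃ F : ℂ → Scattering2D.L2 →L[ℂ] Scattering2D.L2,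
      Scattering2D.IsCutoffResolvent V hV ρ (Scattering2D.memLp_top_of_testFunction hρ hρc) F ∧
      ∀ L δ : ℝ, Metric.diam (tsupport ρ) < L → 0 < δ → δ < 1 / (4 * L) →
        ∃ C₀ C : ℝ, 0 < C₀ ∧ 0 < C ∧
          AnalyticOnNhd ℂ F (Scattering2D.sector ∩ Scattering2D.outerRegion δ C₀) ∧
          (∀ l ∈ Scattering2D.sector ∩ Scattering2D.outerRegion δ C₀, ∀ j ∈ ({0, 1, 2} : Set ℕ),
            ∀ f : Scattering2D.L2, Scattering2D.sobolevENorm j (F l f) ≤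
              ENNReal.ofReal (C * ‖l‖ ^ (-(1 / 2) : ℝ) * (1 + ‖l‖ ^ 2) ^ ((j : ℝ) / 2) *
                Real.exp (L * max (-l.im) 0)) * ‖f‖ₑ) ∧
          {l ∈ Scattering2D.innerRegion δ C₀ ∩ Scattering2D.sector |
            Scattering2D.IsPole F l}.Finite := by
  have h : ∀ x, V x * ρ x = V x := fun x => by
    by_cases hx : V x = 0
    · rw [hx, zero_mul]
    · rw [hρV x (subset_tsupport V hx), mul_one]
  have hu := Scattering2D.eventually_isUnit_perturbation (hV := hV) hρ hρc h
  have hm : MeromorphicOn (Scattering2D.cutoffResAux V hV ρ) Scattering2D.spectralCone := fun l hl =>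
    Scattering2D.meromorphicAt_cutoffResAux hρ.continuous hρc hl (hu l hl)
  refine ⟨Scattering2D.cutoffRes V hV ρ, Scattering2D.isCutoffResolvent_cutoffRes hρ hρc h hm,
    fun L δ hL hδ0 hδ => ?_⟩
  have hL0 : 0 < L := Metric.diam_nonneg.trans_lt hL
  have hρL : ∀ x ∈ tsupport (hρc.toSchwartzMap hρ), ∀ y ∈ tsupport (hρc.toSchwartzMap hρ),
      ‖x - y‖ ≤ L := fun x hx y hy => by
    rw [← dist_eq_norm]
    exact (Metric.dist_le_diam_of_mem hρc.isCompact.isBounded hx hy).trans hL.le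
  obtain ⟨C₀, hC₀, hS⟩ := Scattering2D.exists_norm_perturbation_le (V := V) (hV := hV)
    (ρ := hρc.toSchwartzMap hρ) hρc hL0 hδ0 hδ hρL
  obtain ⟨C, hC, hbound⟩ := Scattering2D.exists_sobolevENorm_cutoffResAux_le (V := V) (hV := hV)
    (ρ := hρc.toSchwartzMap hρ) hρc hL0.le hρL
  have hsub : ∀ l ∈ Scattering2D.sector ∩ Scattering2D.outerRegion δ C₀,
      l ∈ Scattering2D.spectralCone ∧ ‖Scattering2D.perturbation V hV ρ l‖ ≤ 1 / 2 ∧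
        IsUnit (1 + Scattering2D.perturbation V hV ρ l) := fun l hl => by
    have h1 := hS l ⟨Scattering2D.sector_subset_spectralCone hl.1, hl.2⟩
    exact ⟨Scattering2D.sector_subset_spectralCone hl.1, h1,
      Scattering2D.isUnit_one_add_of_norm_lt (h1.trans_lt (by norm_num))⟩
  refine ⟨C₀, C, by linarith, hC, fun l hl => ?_, fun l hl j hj f => ?_, ?_⟩
  · obtain ⟨hlc, -, hlu⟩ := hsub l hl
    exact (Scattering2D.analyticAt_cutoffResAux hρ.continuous hρc hlc hlu).congr
      (Scattering2D.cutoffRes_eventuallyEq hm hρ.continuous hρc hlc hlu).symm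
  · obtain ⟨hlc, hln, hlu⟩ := hsub l hl
    rw [(Scattering2D.cutoffRes_eventuallyEq hm hρ.continuous hρc hlc hlu).self_of_nhds]
    exact hbound l hlc (hC₀.trans hl.2.2) hln j hj f
  · refine (Scattering2D.finite_isPole hm hρ.continuous hρc hu C₀).subset fun l hl => ?_
    exact ⟨⟨by simpa using hl.1.1.2, hl.1.2⟩, hl.2⟩
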